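/- Let $V$ be a finite-dimensional real vector space with an increasing filtration $W$, nondegenerate bilinear forms $\langle\,,\rangle_w$ of parity $(-1)^w$ on $Gr^W_w$, and Hodge numbers $h^{p,q}$. Let $\mathcal M$ be the classifying space of the decreasing filtrations $F$ of $V_{\mathbb C}$ for which $(F,W)$ is a mixed Hodge structure with these Hodge numbers whose graded pieces are polarized by the $\langle\,,\rangle_w$. Let $G_{\mathbb C}$ be the group of automorphisms of $V_{\mathbb C}$ that preserve $W$ and induce isometries of $Gr^W$, let $G_{\mathbb R}$ be its subgroup of real elements, and let $\mathfrak g_{\mathbb C},\mathfrak g_{\mathbb R}$ be their Lie algebras; $\mathcal M$ is an open subset of a homogeneous space of $G_{\mathbb C}$. Let $\mathcal M_{\mathbb R}\subseteq\mathcal M$ be the locus of points that are split over $\mathbb R$, i.e. whose Deligne bigrading $V_{\mathbb C}=\bigoplus I^{p,q}$ satisfies $\overline{I^{p,q}}=I^{q,p}$. For $F\in\mathcal M$, the mixed Hodge metric $h_F$ is the hermitian inner product on $V_{\mathbb C}$ for which the $I^{p,q}$ are mutually orthogonal and $h_F(u,v)=i^{p-q}\langle u,\bar v\rangle_{p+q}$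 for $u,v\in I^{p,q}$. It induces the norm $\|\alpha\|=\mathrm{Tr}(\alpha\alpha^*)^{1/2}$ on $\mathrm{End}(V_{\mathbb C})$. An endomorphism has type $(p,q)$ if it maps each $I^{a,b}$ to $I^{a+p,b+q}$. Let $\delta=\delta(F,W)$ be the unique real element of $\Lambda^{-1,-1}=\bigoplus_{r,s<0}\mathrm{End}(V_{\mathbb C})^{r,s}$ for which $(e^{-i\delta}.F,W)$ is split over $\mathbb R$. Let $\zeta$ be the real element given by the universal Lie polynomials of Cattani, Kaplan and Schmid in the Hodge components of $\delta$ with respect to $(e^{-i\delta}.F,W)$. Explicitly, $\zeta$ is determined by the relation $e^{i\delta}=e^{\zeta}\sum_{k\ge 0}P_k$ with real $\zeta,\eta\in\Lambda^{-1,-1}$, where $P_0=1$, $P_k=-\frac1k\sum_{j=1}^kP_{k-j}C_{j+1}$, $C_{l+1}=i\sum_{p,q\ge1}b^{l-1}_{p-1,q-1}\eta^{-p,-q}$ and $(1-x)^p(1+x)^q=\sum_l b^l_{p,q}x^l$. Let $\epsilon\in\Lambda^{-1,-1}$ be defined by $e^{\epsilon}=e^{i\delta}e^{-\zeta}$, so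 that $(e^{-\epsilon}.F,W)$ is the $SL_2$-splitting of $(F,W)$, and set $$\tau(F)=1+\sum_{p,q<0}\|\epsilon^{p,q}\|^{-\frac{2}{p+q}},$$ with Hodge components and norm taken with respect to $(F,W)$. The twisted metric is obtained from the metric $\mathrm{Tr}(\alpha\beta^*)$ on $T_F\mathcal M\cong\bigoplus_{p<0,\,p+q\le 0}\mathfrak g_{\mathbb C}^{p,q}$ by rescaling the norm on type $(p,q)$ by $\tau(F)^{(p+q)/2}$, the types remaining orthogonal. Let $d_\tau$ be its Riemannian distance. A subset $U\subseteq\mathcal M$ is geodesically convex if any two of its points are joined by a unique shortest geodesic in $\mathcal M$ for the twisted metric, and this geodesic lies in $U$. Let $r\ge1$, let $H_1,\dots,H_r\in\mathfrak g_{\mathbb R}$ be the semisimple elements of commuting representations of $sl_2(\mathbb R)$ on $V$, let $Y_0$ be a real grading of $W$ that commutes with $H_1,\dots,H_r$, and let $t(y)=y_1^{-Y_0/2}\prod_{j=1}^r y_j^{-H_j/2}$ for $y\in(0,\infty)^r$, with inverse $t^{-1}(y)$. Theorem. Let $C\subset\mathcal M$ be a compact set with $C\cap\mathcal M_{\mathbb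 R}=\emptyset$. Then there is a constant $K$ such that $$d_\tau(F_1,F_2)\le K\,d_\tau\big(t^{-1}(y).F_1,\;t^{-1}(y).F_2\big)$$ for all $y\in(0,\infty)^r$ and all $F_1,F_2\in\mathcal M$ for which $t^{-1}(y).F_1$ and $t^{-1}(y).F_2$ are contained in a geodesically convex set $U\subseteq C$. In particular, if $t^{-1}(y).F_1$ and $t^{-1}(y).F_2$ lie in such a set $U$ for all sufficiently large $y_1,\dots,y_r$, then the inequality holds with the same $K$ for all sufficiently large $y_1,\dots,y_r$. -/

import Mathlib

open scoped NNReal ENNReal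

noncomputable section

namespace MixedHodge

/-- The discrete data of a classifying space of graded-polarized mixed Hodge structures.
`E` is the complexification of a real vector space, given through its complex conjugation `conj`
(the real vector space is the set of fixed points).  `W` is the (complexified) weight filtration.
The bilinear form on `Gr^W_w = W w / W (w - 1)` is written as a bilinear form `S w` of which only
the restriction to `W w` is used: that restriction has radical exactly `W (w - 1)`, that is, it is a
nondegenerate form on `Gr^W_w`.  `h p q` are the Hodge numbers of `Gr^W_{p+q}`. -/
structure Datum (E : Type*) [NormedAddCommGroup E] [NormedSpace ℂ E] where
  conj : E →ₛₗ[starRingEnd ℂ] E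
  conj_conj : ∀ v, conj (conj v) = v
  W : ℤ → Submodule ℂ E
  W_mono : Monotone W
  W_bot : ∃ k, W k = ⊥
  W_top : ∃ k, W k = ⊤
  W_real : ∀ k, ∀ v ∈ W k, conj v ∈ W k
  S : ℤ → E →ₗ[ℂ] E →ₗ[ℂ] ℂ
  S_symm : ∀ w, ∀ u ∈ W w, ∀ v ∈ W w, S w u v = (-1 : ℂ) ^ w * S w v u
  S_real : ∀ w, ∀ u ∈ W w, ∀ v ∈ W w, S w (conj u) (conj v) = starRingEnd ℂ (S w u v)
  S_nondeg : ∀ w, ∀ u ∈ W w, (∀ v ∈ W w, S w u v = 0) ↔ u ∈ W (w - 1)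
  h : ℤ → ℤ → ℕ
  h_symm : ∀ p q, h p q = h q p
  h_finite : ∀ w, (Function.support fun p => h p (w - p)).Finite
  h_dim : ∀ w, Module.finrank ℂ (W w) = Module.finrank ℂ (W (w - 1)) + ∑ᶠ p, h p (w - p)

variable {E : Type*} [NormedAddCommGroup E] [NormedSpace ℂ E]

/-- The action of endomorphisms of `E` on filtrations of `E`. -/
def act (g : E →L[ℂ] E) (F : ℤ → Submodule ℂ E) : ℤ → Submodule ℂ E :=
  fun p => (F p).map (g : E →ₗ[ℂ] E)

/-- The real power `y ^ X = exp (log y • X)` of a positive number, for an endomorphism `X`. -/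
def powEnd (y : ℝ) (X : E →L[ℂ] E) : E →L[ℂ] E :=
  NormedSpace.exp ((Real.log y : ℂ) • X)

/-- The adjoint of `b` with respect to a form `h` on `E`. It exists and is unique if `h` is a
hermitian inner product and `E` is finite-dimensional. -/
def adjointWrt (h : E → E → ℂ) (b : E →L[ℂ] E) : E →L[ℂ] E :=
  Classical.epsilon fun b' : E →L[ℂ] E => ∀ u v, h (b u) v = h u (b' v)

namespace Datum

variable (D : Datum E)

/-- An endomorphism is real if it commutes with complex conjugation. -/
def IsReal (X : E →L[ℂ] E) : Prop := ∀ v, X (D.conj v) = D.conj (X v)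

/-- The complex conjugate of a subspace (`conj` is an involution). -/
def conjSub (P : Submodule ℂ E) : Submodule ℂ E := P.comap D.conj

/-- The group `G_ℂ` of automorphisms of `E` that preserve `W` and act on each `Gr^W_w` as an
isometry. -/
def GC : Set (E →L[ℂ] E) :=
  {g | IsUnit g ∧ (∀ k, (D.W k).map (g : E →ₗ[ℂ] E) = D.W k) ∧
    ∀ w, ∀ u ∈ D.W w, ∀ v ∈ D.W w, D.S w (g u) (g v) = D.S w u v}

/-- The real Lie algebra `𝔤_ℝ` of `G_ℝ`. -/
def gR : Set (E →L[ℂ] E) :=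
  {X | D.IsReal X ∧ (∀ k, ∀ v ∈ D.W k, X v ∈ D.W k) ∧
    ∀ w, ∀ u ∈ D.W w, ∀ v ∈ D.W w, D.S w (X u) v + D.S w u (X v) = 0}

/-- The preimage in `W w` of `F^p Gr^W_w`. -/
def grFil (F : ℤ → Submodule ℂ E) (w p : ℤ) : Submodule ℂ E := (F p ⊓ D.W w) ⊔ D.W (w - 1)

/-- The preimage in `W (p + q)` of the Hodge component `H^{p,q}` of `Gr^W_{p+q}`. -/
def grHodge (F : ℤ → Submodule ℂ E) (p q : ℤ) : Submodule ℂ E :=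
  D.grFil F (p + q) p ⊓ D.conjSub (D.grFil F (p + q) q)

/-- `(F, W)` is a mixed Hodge structure such that every `(Gr^W_w, F Gr^W_w, S w)` is a polarized
Hodge structure of weight `w` with the given Hodge numbers. -/
structure IsGradedPolarizedMHS (F : ℤ → Submodule ℂ E) : Prop where
  anti : Antitone F
  eq_top : ∃ p, F p = ⊤
  eq_bot : ∃ p, F p = ⊥
  sup_eq : ∀ w p, D.grFil F w p ⊔ D.conjSub (D.grFil F w (w - p + 1)) = D.W w
  inf_eq : ∀ w p, D.grFil F w p ⊓ D.conjSub (D.grFil F w (w - p + 1)) = D.W (w - 1)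
  orth : ∀ w p q, w < p + q → ∀ u ∈ D.grFil F w p, ∀ v ∈ D.grFil F w q, D.S w u v = 0
  pos : ∀ p q, ∀ u ∈ D.grHodge F p q, u ∉ D.W (p + q - 1) →
    0 < (Complex.I ^ (p - q) * D.S (p + q) u (D.conj u)).re
  hodge_number : ∀ p q,
    Module.finrank ℂ (D.grHodge F p q) = Module.finrank ℂ (D.W (p + q - 1)) + D.h p q

/-- The classifying space `𝓜`. -/
@[ext]
structure ClassifyingSpace where
  fil : ℤ → Submodule ℂ E
  prop : D.IsGradedPolarizedMHS fil

/-- The orbit map of a point `F ∈ 𝓜`, on the set of those `g ∈ G_ℂ` for which `g.F ∈ 𝓜`. -/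
def orbitMap (F : D.ClassifyingSpace) :
    {g : E →L[ℂ] E // g ∈ D.GC ∧ D.IsGradedPolarizedMHS (act g F.fil)} → D.ClassifyingSpace :=
  fun g => ⟨act g.1 F.fil, g.2.2⟩

/-- The topology of `𝓜` as an open subset of a homogeneous space of `G_ℂ`: a set is open if and only
if its preimages under the orbit maps are. -/
instance : TopologicalSpace D.ClassifyingSpace :=
  ⨆ F : D.ClassifyingSpace, TopologicalSpace.coinduced (D.orbitMap F) inferInstance

/-! ### The Deligne bigrading -/

/-- The Deligne bigrading `I^{p,q}` of `(F, W)`: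
`I^{p,q} = F^p ∩ W_{p+q} ∩ (conj F^q ∩ W_{p+q} + ∑_{j ≥ 1} conj F^{q-j} ∩ W_{p+q-j-1})`. -/
def bigr (F : ℤ → Submodule ℂ E) (p q : ℤ) : Submodule ℂ E :=
  F p ⊓ D.W (p + q) ⊓
    ((D.conjSub (F q) ⊓ D.W (p + q)) ⊔
      ⨆ j : ℕ, D.conjSub (F (q - (j + 1))) ⊓ D.W (p + q - (j + 1) - 1))

/-- `(F, W)` is split over `ℝ`. -/
def IsSplit (F : ℤ → Submodule ℂ E) : Prop := ∀ p q, D.bigr F p q = D.conjSub (D.bigr F q p)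

/-- The locus `𝓜_ℝ` of split mixed Hodge structures. -/
def splitLocus : Set D.ClassifyingSpace := {F | D.IsSplit F.fil}

/-- `Λ^{-1,-1} = ⨁_{r, s < 0} gl(E)^{r,s}`: the endomorphisms that map each `I^{p,q}` into the sum
of all `I^{a,b}` with `a < p` and `b < q`.  They act as zero on `Gr^W`, so they lie in the Lie algebra
of `G_ℂ`. -/
def Lam (F : ℤ → Submodule ℂ E) : Set (E →L[ℂ] E) :=
  {X | ∀ p q, ∀ v ∈ D.bigr F p q, X v ∈ ⨆ (a : ℤ) (b : ℤ) (_ : a < p ∧ b < q), D.bigr F a b}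

variable [FiniteDimensional ℂ E]

open Classical in
/-- The projection of `E = ⨁ I^{a,b}` onto `I^{p,q}` (zero if this is not a direct sum). -/
def proj (F : ℤ → Submodule ℂ E) (p q : ℤ) : E →L[ℂ] E :=
  if hc : IsCompl (D.bigr F p q)
      (⨆ (a : ℤ) (b : ℤ) (_ : (a, b) ≠ (p, q)), D.bigr F a b) then
    LinearMap.toContinuousLinearMap (Submodule.projection _ _ hc)
  else 0

/-- The component `X^{p,q}` of an endomorphism `X`, the sum of the parts of `X` that map `I^{a,b}`
to `I^{a+p,b+q}`. -/
def comp (F : ℤ → Submodule ℂ E) (X : E →L[ℂ] E) (p q : ℤ) : E →L[ℂ] E :=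
  ∑ᶠ x : ℤ × ℤ, D.proj F (x.1 + p) (x.2 + q) * X * D.proj F x.1 x.2

/-! ### The mixed Hodge metric and the induced metric on endomorphisms -/

/-- The hermitian form on `E` for which the `I^{p,q}` are orthogonal and which on `I^{p,q}` is
`s ^ (p + q)` times `i ^ (p - q) S_{p+q}(u, conj v)`, so that the norm on `I^{p,q}` is scaled by
`s ^ ((p + q) / 2)`. For `s = 1` this is the mixed Hodge metric. -/
def hodgeForm (s : ℝ) (F : ℤ → Submodule ℂ E) (u v : E) : ℂ :=
  ∑ᶠ x : ℤ × ℤ, ((s : ℂ) ^ (x.1 + x.2)) *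
    (Complex.I ^ (x.1 - x.2) *
      D.S (x.1 + x.2) (D.proj F x.1 x.2 u) (D.conj (D.proj F x.1 x.2 v)))

/-- The induced form `Tr (α β*)` on endomorphisms. -/
def endForm (s : ℝ) (F : ℤ → Submodule ℂ E) (α β : E →L[ℂ] E) : ℂ :=
  LinearMap.trace ℂ E ((α * adjointWrt (D.hodgeForm s F) β : E →L[ℂ] E) : E →ₗ[ℂ] E)

/-- The norm on endomorphisms for the scaled metric; `s = 1` is the standard metric. -/
def endNorm (s : ℝ) (F : ℤ → Submodule ℂ E) (α : E →L[ℂ] E) : ℝ :=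
  Real.sqrt (D.endForm s F α α).re

/-! ### Deligne's `δ`, the elements `ζ`, `ε` of the `SL₂`-splitting, and the twisting function -/

/-- `δ` is Deligne's element of `(F, W)`: the real element of `Λ^{-1,-1}` for which
`(e^{-iδ}.F, W)` is split over `ℝ`. -/
def IsDelta (F : ℤ → Submodule ℂ E) (δ : E →L[ℂ] E) : Prop :=
  δ ∈ D.Lam F ∧ D.IsReal δ ∧ D.IsSplit (act (NormedSpace.exp (-(Complex.I • δ))) F)

/-- `slC F η l` is `C_{l+2} = i ∑_{p, q ≥ 1} b^l_{p-1,q-1} η^{-p,-q}`, where the integers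
`b^l_{m,n}` are defined by `(1 - x)^m (1 + x)^n = ∑_l b^l_{m,n} x^l`. -/
def slC (F : ℤ → Submodule ℂ E) (η : E →L[ℂ] E) (l : ℕ) : E →L[ℂ] E :=
  Complex.I • ∑ᶠ x : ℕ × ℕ,
    (((1 - Polynomial.X) ^ x.1 * (1 + Polynomial.X) ^ x.2 : Polynomial ℤ).coeff l : ℂ) •
      D.comp F η (-((x.1 : ℤ) + 1)) (-((x.2 : ℤ) + 1))

/-- The noncommutative polynomials `P_0 = 1`, `P_k = -(1/k) ∑_{j=1}^{k} P_{k-j} C_{j+1}`. -/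
def slP (F : ℤ → Submodule ℂ E) (η : E →L[ℂ] E) : ℕ → (E →L[ℂ] E)
  | 0 => 1
  | k + 1 => (-(1 / ((k : ℂ) + 1))) •
      ∑ j : Fin (k + 1), slP F η (k - (j : ℕ)) * D.slC F η (j : ℕ)
  termination_by k => k
  decreasing_by omega

/-- `ζ` is attached to `(F, W)` with Deligne element `δ` by the universal Lie polynomials of
Cattani, Kaplan and Schmid in the Hodge components of `δ` with respect to the split mixed Hodge
structure `(e^{-iδ}.F, W)`.  These are the solution in real `ζ, η ∈ Λ^{-1,-1}` of
`e^{iδ} = e^ζ (1 + ∑_{k ≥ 1} P_k(C_2, …, C_{k+1}))`. -/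
def IsZeta (F : ℤ → Submodule ℂ E) (δ ζ : E →L[ℂ] E) : Prop :=
  ζ ∈ D.Lam F ∧ D.IsReal ζ ∧ ∃ η ∈ D.Lam F, D.IsReal η ∧
    NormedSpace.exp (Complex.I • δ) = NormedSpace.exp ζ *
      ∑ᶠ k : ℕ, D.slP (act (NormedSpace.exp (-(Complex.I • δ))) F) η k

/-- `ε` is the element of `Λ^{-1,-1}` with `e^ε = e^{iδ} e^{-ζ}`. -/
def IsEps (F : ℤ → Submodule ℂ E) (ε : E →L[ℂ] E) : Prop :=
  ε ∈ D.Lam F ∧ ∃ δ ζ, D.IsDelta F δ ∧ D.IsZeta F δ ζ ∧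
    NormedSpace.exp ε = NormedSpace.exp (Complex.I • δ) * NormedSpace.exp (-ζ)

/-- The element `ε(F, W)`; it exists and is unique for every mixed Hodge structure. -/
def eps (F : ℤ → Submodule ℂ E) : E →L[ℂ] E := Classical.epsilon (D.IsEps F)

/-- The twisting function `τ(F) = 1 + ∑_{p, q < 0} ‖ε^{p,q}‖ ^ (-2 / (p + q))`. -/
def tau (F : ℤ → Submodule ℂ E) : ℝ :=
  1 + ∑ᶠ (x : ℤ × ℤ) (_ : x.1 < 0 ∧ x.2 < 0),
    D.endNorm 1 F (D.comp F (D.eps F) x.1 x.2) ^ (-2 / ((x.1 : ℝ) + (x.2 : ℝ)))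

/-! ### The twisted metric on the classifying space, its distance and its geodesics -/

/-- The projection of `𝔤_ℂ` onto `q_F = ⨁_{p < 0, p + q ≤ 0} 𝔤^{p,q} ≅ T_F 𝓜`, with kernel the Lie
algebra of the stabilizer of `F`. -/
def qPart (F : ℤ → Submodule ℂ E) (α : E →L[ℂ] E) : E →L[ℂ] E :=
  ∑ᶠ (x : ℤ × ℤ) (_ : x.1 < 0 ∧ x.1 + x.2 ≤ 0), D.comp F α x.1 x.2

/-- The twisted norm of the tangent vector `d/dt e^{tα}.F |_{t = 0}` of `𝓜` at `F`. -/
def twistedNorm (F : ℤ → Submodule ℂ E) (α : E →L[ℂ] E) : ℝ :=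
  D.endNorm (D.tau F) F (D.qPart F α)

/-- `γ` is a `C¹` curve on `[0, 1]` in `𝓜`, with `C¹` lift `g` to `G_ℂ`, that is,
`γ t = g t . γ 0`. -/
def IsLift (γ : ℝ → D.ClassifyingSpace) (g : ℝ → E →L[ℂ] E) : Prop :=
  ContDiffOn ℝ 1 g (Set.Icc 0 1) ∧
    ∀ t ∈ Set.Icc (0 : ℝ) 1, g t ∈ D.GC ∧ (γ t).fil = act (g t) (γ 0).fil

/-- The speed of `γ` at time `t` for the twisted metric, computed from a lift `g` of `γ`: the velocity
is the tangent vector represented by `g'(t) g(t)⁻¹ ∈ 𝔤_ℂ`. -/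
def speed (γ : ℝ → D.ClassifyingSpace) (g : ℝ → E →L[ℂ] E) (t : ℝ) : ℝ≥0∞ :=
  ENNReal.ofReal
    (D.twistedNorm (γ t).fil (derivWithin g (Set.Icc 0 1) t * Ring.inverse (g t)))

/-- The Riemannian distance `d_τ` of the twisted metric: the infimum of the lengths of the `C¹` curves
in `𝓜` between two points (infinite if there are none). -/
def twistedDist (P Q : D.ClassifyingSpace) : ℝ≥0∞ :=
  ⨅ (γ : ℝ → D.ClassifyingSpace) (g : ℝ → E →L[ℂ] E)
    (_ : D.IsLift γ g ∧ γ 0 = P ∧ γ 1 = Q), ∫⁻ t in Set.Icc (0 : ℝ) 1, D.speed γ g t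

/-- `γ` is a shortest geodesic from `P` to `Q` in `𝓜`, parametrized on `[0, 1]` proportionally to arc
length: a `C¹` curve with constant speed `d_τ(P, Q)`. -/
def IsShortestGeodesic (γ : ℝ → D.ClassifyingSpace) (P Q : D.ClassifyingSpace) : Prop :=
  γ 0 = P ∧ γ 1 = Q ∧
    ∃ g, D.IsLift γ g ∧ ∀ t ∈ Set.Icc (0 : ℝ) 1, D.speed γ g t = D.twistedDist P Q

/-- `U` is geodesically convex: any two of its points are joined by a unique shortest geodesic in `𝓜`,
and this geodesic lies in `U`. -/
def GeodesicallyConvex (U : Set D.ClassifyingSpace) : Prop :=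
  ∀ P ∈ U, ∀ Q ∈ U, ∃ γ : ℝ → D.ClassifyingSpace, D.IsShortestGeodesic γ P Q ∧
    (∀ t ∈ Set.Icc (0 : ℝ) 1, γ t ∈ U) ∧
    ∀ γ', D.IsShortestGeodesic γ' P Q → Set.EqOn γ' γ (Set.Icc 0 1)

/-! ### The family of automorphisms `t(y)` -/

/-- `Y` is a grading of `W` defined over `ℝ`: a real semisimple endomorphism such that `W k` is the
direct sum of `W (k - 1)` and the `k`-eigenspace of `Y`. -/
structure IsRealGrading (Y : E →L[ℂ] E) : Prop where
  real : D.IsReal Y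
  semisimple : Module.End.IsSemisimple (Y : E →ₗ[ℂ] E)
  sup_eq : ∀ k : ℤ,
    D.W (k - 1) ⊔ Module.End.eigenspace (Y : E →ₗ[ℂ] E) (k : ℂ) = D.W k
  inf_eq : ∀ k : ℤ,
    D.W (k - 1) ⊓ Module.End.eigenspace (Y : E →ₗ[ℂ] E) (k : ℂ) = ⊥

/-- Semisimple elements `H_1, …, H_r ∈ 𝔤_ℝ` of commuting representations of `sl₂(ℝ)`, given by the
triples `(N_j, H_j, N_j⁺)`, with a real grading `Y_0` of `W` that commutes with them. -/
structure TwistDatum (r : ℕ) where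
  N : Fin r → E →L[ℂ] E
  H : Fin r → E →L[ℂ] E
  Np : Fin r → E →L[ℂ] E
  Y₀ : E →L[ℂ] E
  N_real : ∀ j, D.IsReal (N j)
  Np_real : ∀ j, D.IsReal (Np j)
  H_mem : ∀ j, H j ∈ D.gR
  lie_H_N : ∀ j, H j * N j - N j * H j = -((2 : ℂ) • N j)
  lie_H_Np : ∀ j, H j * Np j - Np j * H j = (2 : ℂ) • Np j
  lie_Np_N : ∀ j, Np j * N j - N j * Np j = H j
  comm_N : ∀ i j, i ≠ j → Commute (N i) (N j)
  comm_Np : ∀ i j, i ≠ j → Commute (Np i) (Np j)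
  comm_N_Np : ∀ i j, i ≠ j → Commute (N i) (Np j)
  grading : D.IsRealGrading Y₀
  comm_Y₀ : ∀ j, Commute Y₀ (H j)

/-- `t(y) = y_1^{-Y_0/2} ∏_j y_j^{-H_j/2}`. -/
def TwistDatum.t {D : Datum E} {r : ℕ} [NeZero r] (T : D.TwistDatum r) (y : Fin r → ℝ) :
    E →L[ℂ] E :=
  powEnd (y 0) (-((1 / 2 : ℂ) • T.Y₀)) *
    (List.ofFn fun j => powEnd (y j) (-((1 / 2 : ℂ) • T.H j))).prod

end Datum

end MixedHodge

end

/-! The element `t = t(y)` is real, preserves `W` and multiplies the form on `Gr^W_w` by `c ^ w`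
with `c = 1 / y_1`: the factors `y_j^{-H_j/2}` are isometries, and `y_1^{-Y_0/2}` acts on `Gr^W_w`
as `y_1^{-w/2}`. Such a similitude acts on `𝓜`, carries the Deligne bigrading of `F` to that of
`t.F`, and satisfies `ε(t.F) = t ε(F) t⁻¹`. Pulled back by `t`, the mixed Hodge metric at `t.F` is
the one at `F` with `I^{p,q}` rescaled by `c ^ (p + q)`.

Hence the norm of `ε^{p,q}` changes by the factor `c ^ ((p + q) / 2)`. The exponent `-2 / (p + q)`
in `τ` turns every one of these factors into `c⁻¹`, so `τ(t.F) - 1 = (τ(F) - 1) / c`. The twisted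
norm at `t.F` therefore pulls back to the norm at `F` with twisting parameter `τ(t.F) c = c + (τ(F)
- 1)`, while the twisted norm at `F` itself has parameter `τ(F)`. Tangent vectors have types with `p
+ q ≤ 0`, on which the norm decreases as the parameter grows. Where `τ - 1` is bounded below by a
positive constant, `τ ≤ κ (τ - 1) ≤ κ (c + τ - 1)` with `κ` independent of `y`, and `t` stretches
tangent vectors at most by a power of `κ` (`IsSimilitude.tau_act`, `IsSimilitude.twistedNorm_act`,
`endNorm_qPart_le`). Applying `t` to the shortest geodesic in `U ⊆ C` gives a competing curve
between `F₁` and `F₂`, hence the inequality.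

The lower bound on `C` is `exists_lt_tau_sub_one`. Otherwise some point `F` of `C` is a cluster
point along which `τ → 1`. The Deligne projections are continuous on `𝓜` (`continuous_pr`), so the
Hodge norms near `F` are comparable to a fixed norm and `ε → 0`. Since `e^{-ε}.G` is always split
over `ℝ`, the limit `F` is split, contrary to the hypothesis on `C`.

As `ε` is given by a choice, its equivariance and the splitting property need existence and
uniqueness of `δ`, `ζ` and `ε` (`existsUnique_isDelta`, `existsUnique_isZeta`,
`existsUnique_isEps`). These are equations in the nilpotent algebra `Λ^{-1,-1}`, solved by a fixed
point argument for the filtration `LamN`: a map that gains one level on differences becomes constant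
after finitely many iterations. -/

noncomputable section

set_option linter.unusedSectionVars false

namespace MixedHodge

/-! ### Bigradings given by orthogonal idempotents -/

section Bigrading

variable {A : Type*} [Ring A] [Algebra ℂ A]

/-- A finite family of orthogonal idempotents with sum `1`, indexed by `ℤ × ℤ`. -/
structure IsBigrading (π : ℤ × ℤ → A) : Prop where
  orth : ∀ x y, x ≠ y → π x * π y = 0
  idem : ∀ x, π x * π x = π x
  finite : (Function.support π).Finite
  sum_eq : ∑ᶠ x, π x = 1

/-- Both coordinates of `x` are smaller than those of `y`. -/
def Below (x y : ℤ × ℤ) : Prop := x.1 < y.1 ∧ x.2 < y.2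

/-- `m (x - y)` times the block `π x * X * π y`, summed over all blocks. -/
def mult (π : ℤ × ℤ → A) (m : ℤ × ℤ → ℂ) (X : A) : A :=
  ∑ᶠ z : (ℤ × ℤ) × (ℤ × ℤ), m (z.1 - z.2) • (π z.1 * X * π z.2)

/-- The elements all of whose blocks lower both indices, and the sum of the indices by at least `n`. -/
def LamN (π : ℤ × ℤ → A) (n : ℕ) : Submodule ℂ A where
  carrier := {X | ∀ x y, ¬ (Below x y ∧ x.1 + x.2 + n ≤ y.1 + y.2) → π x * X * π y = 0}
  add_mem' := fun ha hb x y h => by rw [mul_add, add_mul, ha x y h, hb x y h, add_zero]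
  zero_mem' := fun x y _ => by simp
  smul_mem' := fun c X hX x y h => by
    rw [mul_smul_comm, smul_mul_assoc, hX x y h, smul_zero]

theorem mem_LamN_two {π : ℤ × ℤ → A} {X : A} : X ∈ LamN π 2 ↔
    ∀ x y, ¬ Below x y → π x * X * π y = 0 := by
  refine ⟨fun h x y hxy => h x y (fun h' => hxy h'.1), fun h x y hxy => h x y fun h' => hxy ⟨h', ?_⟩⟩
  have := h'.1
  have := h'.2
  push_cast
  omega

theorem LamN_anti (π : ℤ × ℤ → A) : Antitone (LamN π) := fun m n hmn _ hX x y h =>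
  hX x y fun h' => h ⟨h'.1, by have := h'.2; have : (m : ℤ) ≤ n := by exact_mod_cast hmn
                               omega⟩

theorem LamN_le_two (π : ℤ × ℤ → A) (n : ℕ) : LamN π n ≤ LamN π 2 := fun _ hX =>
  mem_LamN_two.2 fun x y h => hX x y fun h' => h h'.1

/-- Lowering both indices already lowers their sum by 2, so the filtration starts at level 2. This
lets inductions on the level begin at 0. -/
theorem LamN_zero_eq (π : ℤ × ℤ → A) : LamN π 0 = LamN π 2 :=
  le_antisymm (LamN_le_two π 0) (LamN_anti π (by norm_num))

namespace IsBigrading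

variable {π : ℤ × ℤ → A} (hπ : IsBigrading π)
include hπ

theorem sum_finset : ∑ x ∈ hπ.finite.toFinset, π x = 1 := by
  rw [← hπ.sum_eq, finsum_eq_sum _ hπ.finite]

theorem mul_eq (x y : ℤ × ℤ) : π x * π y = if x = y then π x else 0 := by
  split_ifs with h
  · rw [← h, hπ.idem]
  · exact hπ.orth x y h

theorem ext_left {X Y : A} (h : ∀ x, π x * X = π x * Y) : X = Y := by
  rw [← one_mul X, ← one_mul Y, ← hπ.sum_finset, Finset.sum_mul, Finset.sum_mul]
  exact Finset.sum_congr rfl fun x _ => h x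

theorem ext_right {X Y : A} (h : ∀ x, X * π x = Y * π x) : X = Y := by
  rw [← mul_one X, ← mul_one Y, ← hπ.sum_finset, Finset.mul_sum, Finset.mul_sum]
  exact Finset.sum_congr rfl fun x _ => h x

theorem ext {X Y : A} (h : ∀ x y, π x * X * π y = π x * Y * π y) : X = Y :=
  hπ.ext_left fun x => hπ.ext_right fun y => h x y

theorem mul_entry (X Y : A) (x y : ℤ × ℤ) :
    π x * (X * Y) * π y = ∑ z ∈ hπ.finite.toFinset, (π x * X * π z) * (π z * Y * π y) := by
  have : ∀ z, (π x * X * π z) * (π z * Y * π y) = π x * X * π z * (Y * π y) := fun z => by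
    rw [show (π x * X * π z) * (π z * Y * π y) = π x * X * (π z * π z) * (Y * π y) by noncomm_ring,
      hπ.idem]
  simp_rw [this]
  rw [← Finset.sum_mul, ← Finset.mul_sum, hπ.sum_finset]
  noncomm_ring

theorem entry_block (X : A) (x y a b : ℤ × ℤ) :
    π x * (π a * X * π b) * π y = if x = a ∧ y = b then π x * X * π y else 0 := by
  rw [show π x * (π a * X * π b) * π y = (π x * π a) * X * (π b * π y) by noncomm_ring,
    hπ.mul_eq, hπ.mul_eq]
  by_cases h : x = a <;> by_cases h' : y = b <;> simp_all [eq_comm]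

theorem mult_eq_sum (m : ℤ × ℤ → ℂ) (X : A) :
    mult π m X = ∑ z ∈ hπ.finite.toFinset ×ˢ hπ.finite.toFinset,
      m (z.1 - z.2) • (π z.1 * X * π z.2) := by
  refine finsum_eq_sum_of_support_subset _ fun z hz => ?_
  simp only [Finset.coe_product, Set.Finite.coe_toFinset]
  refine ⟨fun h => hz ?_, fun h => hz ?_⟩ <;> simp [h]

theorem mult_entry (m : ℤ × ℤ → ℂ) (X : A) (x y : ℤ × ℤ) :
    π x * mult π m X * π y = m (x - y) • (π x * X * π y) := by
  rw [hπ.mult_eq_sum, Finset.mul_sum, Finset.sum_mul]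
  simp_rw [mul_smul_comm, smul_mul_assoc, hπ.entry_block]
  rw [Finset.sum_eq_single (x, y)]
  · simp
  · rintro ⟨a, b⟩ _ hab
    rw [if_neg, smul_zero]
    rintro ⟨rfl, rfl⟩
    exact hab rfl
  · intro h
    rw [Finset.mem_product, not_and_or] at h
    rcases h with h | h <;> simp at h <;> simp [h]

/-- An element is determined by its blocks; nearly every identity about `mult` below is checked this
way. -/
theorem mult_unique {m : ℤ × ℤ → ℂ} {X Y : A}
    (h : ∀ x y, π x * Y * π y = m (x - y) • (π x * X * π y)) : Y = mult π m X :=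
  hπ.ext fun x y => by rw [h, hπ.mult_entry]

theorem mult_add (m : ℤ × ℤ → ℂ) (X Y : A) : mult π m (X + Y) = mult π m X + mult π m Y := by
  symm
  refine hπ.mult_unique fun x y => ?_
  rw [mul_add, add_mul, hπ.mult_entry, hπ.mult_entry, mul_add, add_mul, smul_add]

theorem mult_smul (m : ℤ × ℤ → ℂ) (c : ℂ) (X : A) : mult π m (c • X) = c • mult π m X := by
  symm
  refine hπ.mult_unique fun x y => ?_
  rw [mul_smul_comm, smul_mul_assoc, hπ.mult_entry, mul_smul_comm, smul_mul_assoc, smul_comm]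

theorem mult_sub (m : ℤ × ℤ → ℂ) (X Y : A) : mult π m (X - Y) = mult π m X - mult π m Y := by
  rw [sub_eq_add_neg, ← neg_one_smul ℂ Y, hπ.mult_add, hπ.mult_smul, neg_one_smul, sub_eq_add_neg]

theorem mult_mult (m m' : ℤ × ℤ → ℂ) (X : A) :
    mult π m (mult π m' X) = mult π (fun d => m d * m' d) X :=
  hπ.mult_unique fun x y => by rw [hπ.mult_entry, hπ.mult_entry, smul_smul]

theorem mult_mem {m : ℤ × ℤ → ℂ} {n : ℕ} {X : A} (hX : X ∈ LamN π n) : mult π m X ∈ LamN π n :=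
  fun x y h => by rw [hπ.mult_entry, hX x y h, smul_zero]

theorem mul_mem {m n : ℕ} {X Y : A} (hX : X ∈ LamN π m) (hY : Y ∈ LamN π n) :
    X * Y ∈ LamN π (m + n) := by
  intro x y h
  rw [hπ.mul_entry]
  refine Finset.sum_eq_zero fun z _ => ?_
  by_cases h1 : Below x z ∧ x.1 + x.2 + m ≤ z.1 + z.2
  · by_cases h2 : Below z y ∧ z.1 + z.2 + n ≤ y.1 + y.2
    · refine absurd ⟨⟨h1.1.1.trans h2.1.1, h1.1.2.trans h2.1.2⟩, ?_⟩ h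
      have := h1.2
      have := h2.2
      push_cast
      omega
    · rw [hY z y h2, mul_zero]
  · rw [hX x z h1, zero_mul]

theorem mul_mem_left {n : ℕ} {X Y : A} (hX : X ∈ LamN π 2) (hY : Y ∈ LamN π n) :
    X * Y ∈ LamN π (n + 1) := LamN_anti π (by omega) (hπ.mul_mem hX hY)

theorem mul_mem_right {n : ℕ} {X Y : A} (hX : X ∈ LamN π n) (hY : Y ∈ LamN π 2) :
    X * Y ∈ LamN π (n + 1) := LamN_anti π (by omega) (hπ.mul_mem hX hY)

/-- Only finitely many indices carry a nonzero idempotent, so the possible drop of the index sum is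
bounded. -/
theorem exists_LamN_eq_bot : ∃ N : ℕ, ∀ n, N ≤ n → LamN π n = ⊥ := by
  obtain ⟨N, hN⟩ : ∃ N : ℕ, ∀ x ∈ hπ.finite.toFinset, ∀ y ∈ hπ.finite.toFinset,
      y.1 + y.2 - (x.1 + x.2) < N := by
    -- A crude bound: the sum of all drops dominates each single one, and the `+ 1` makes the
    -- inequality strict.
    refine ⟨∑ x ∈ hπ.finite.toFinset, ∑ y ∈ hπ.finite.toFinset,
      ((y.1 + y.2 - (x.1 + x.2)).toNat + 1), fun x hx y hy => ?_⟩
    have h1 : (y.1 + y.2 - (x.1 + x.2)).toNat + 1 ≤ ∑ y ∈ hπ.finite.toFinset,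
      ((y.1 + y.2 - (x.1 + x.2)).toNat + 1) :=
      Finset.single_le_sum (f := fun y : ℤ × ℤ => (y.1 + y.2 - (x.1 + x.2)).toNat + 1)
        (fun _ _ => Nat.zero_le _) hy
    have h2 : _ ≤ ∑ x ∈ hπ.finite.toFinset, ∑ y ∈ hπ.finite.toFinset,
      ((y.1 + y.2 - (x.1 + x.2)).toNat + 1) := 
      Finset.single_le_sum (f := fun x : ℤ × ℤ => ∑ y ∈ hπ.finite.toFinset,
        ((y.1 + y.2 - (x.1 + x.2)).toNat + 1)) (fun _ _ => Nat.zero_le _) hx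
    have := h1.trans h2
    omega
  refine ⟨N, fun n hn => (Submodule.eq_bot_iff _).2 fun X hX => hπ.ext fun x y => ?_⟩
  rw [mul_zero, zero_mul]
  by_cases hx : π x = 0
  · simp [hx]
  by_cases hy : π y = 0
  · simp [hy]
  refine hX x y fun h => ?_
  have := hN x (by simpa using hx) y (by simpa using hy)
  have := h.2
  omega

/-- A self-map that contracts the filtration `LamN` has a unique fixed point. -/
theorem existsUnique_fixedPoint {S : Set A} (hS : S.Nonempty) (hS2 : S ⊆ LamN π 2) {f : A → A}
    (hf : ∀ X ∈ S, f X ∈ S)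
    (hc : ∀ n, ∀ X ∈ S, ∀ Y ∈ S, X - Y ∈ LamN π n → f X - f Y ∈ LamN π (n + 1)) :
    ∃! X, X ∈ S ∧ f X = X := by
  have hit : ∀ n, ∀ X ∈ S, f^[n] X ∈ S := fun n => by
    induction n with
    | zero => exact fun X hX => hX
    | succ n ih => intro X hX; rw [Function.iterate_succ_apply']; exact hf _ (ih X hX)
  have hdiff : ∀ n, ∀ X ∈ S, ∀ Y ∈ S, f^[n] X - f^[n] Y ∈ LamN π n := fun n => by
    induction n with
    | zero =>
      intro X hX Y hY
      rw [LamN_zero_eq]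
      exact sub_mem (hS2 hX) (hS2 hY)
    | succ n ih =>
      intro X hX Y hY
      rw [Function.iterate_succ_apply', Function.iterate_succ_apply']
      exact hc n _ (hit n X hX) _ (hit n Y hY) (ih X hX Y hY)
  obtain ⟨N, hN⟩ := hπ.exists_LamN_eq_bot
  have heq : ∀ X ∈ S, ∀ Y ∈ S, f^[N] X = f^[N] Y := fun X hX Y hY => by
    have := hdiff N X hX Y hY
    rwa [hN N le_rfl, Submodule.mem_bot, sub_eq_zero] at this
  obtain ⟨Z, hZ⟩ := hS
  -- The iterate `f^[N]` is constant on `S`; its value is fixed by `f`, and every fixed point equals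
  -- it.
  refine ⟨f^[N] Z, ⟨hit N Z hZ, ?_⟩, fun Y hY => ?_⟩
  · rw [← Function.iterate_succ_apply' f N Z, Function.iterate_succ_apply]
    exact heq _ (hf Z hZ) _ hZ
  · rw [heq Z hZ Y hY.1, Function.iterate_fixed hY.2]

/-- Telescoping writes the difference as a sum of products containing `X - Y` and at least one more
factor that lowers the indices, which gains a level. -/
theorem pow_sub_pow_mem {n : ℕ} {X Y : A} (hX : X ∈ LamN π 2) (hY : Y ∈ LamN π 2)
    (h : X - Y ∈ LamN π n) (k : ℕ) : X ^ (k + 2) - Y ^ (k + 2) ∈ LamN π (n + 1) := by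
  have hpow : ∀ k, X ^ (k + 1) ∈ LamN π 2 := fun k => by
    induction k with
    | zero => simpa using hX
    | succ k ih => rw [pow_succ]; exact LamN_le_two π _ (hπ.mul_mem ih hX)
  have hd : ∀ k, X ^ (k + 1) - Y ^ (k + 1) ∈ LamN π n := fun k => by
    induction k with
    | zero => simpa using h
    | succ k ih =>
      rw [show X ^ (k + 1 + 1) - Y ^ (k + 1 + 1) =
        X ^ (k + 1) * (X - Y) + (X ^ (k + 1) - Y ^ (k + 1)) * Y by
          rw [pow_succ X (k + 1), pow_succ Y (k + 1)]; noncomm_ring]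
      exact add_mem (LamN_anti π n.le_succ (hπ.mul_mem_left (hpow k) h))
        (LamN_anti π n.le_succ (hπ.mul_mem_right ih hY))
  rw [show X ^ (k + 2) - Y ^ (k + 2) =
        X ^ (k + 1) * (X - Y) + (X ^ (k + 1) - Y ^ (k + 1)) * Y by
          rw [pow_succ X (k + 1), pow_succ Y (k + 1)]; noncomm_ring]
  exact add_mem (hπ.mul_mem_left (hpow k) h) (hπ.mul_mem_right (hd k) hY)

end IsBigrading

end Bigrading

/-! ### Exponential and logarithm on `Λ^{-1,-1}` -/

section Exp

variable {A : Type*} [NormedRing A] [NormedAlgebra ℂ A] [CompleteSpace A]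

theorem isClosed_LamN (π : ℤ × ℤ → A) (n : ℕ) : IsClosed (LamN π n : Set A) := by
  have : (LamN π n : Set A) = ⋂ (x : ℤ × ℤ) (y : ℤ × ℤ)
      (_ : ¬ (Below x y ∧ x.1 + x.2 + n ≤ y.1 + y.2)), {X | π x * X * π y = 0} := by
    ext X
    simp only [Set.mem_iInter]
    rfl
  rw [this]
  refine isClosed_iInter fun x => isClosed_iInter fun y => isClosed_iInter fun _ =>
    isClosed_eq (by fun_prop) continuous_const

namespace IsBigrading

variable {π : ℤ × ℤ → A} (hπ : IsBigrading π)
include hπ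

/-- To leading order `exp` is the identity: only the terms of degree at least two remain, and `LamN`
is closed, so it contains their infinite sum. -/
theorem exp_sub_exp_mem {n : ℕ} {X Y : A} (hX : X ∈ LamN π 2) (hY : Y ∈ LamN π 2)
    (h : X - Y ∈ LamN π n) :
    NormedSpace.exp X - NormedSpace.exp Y - (X - Y) ∈ LamN π (n + 1) := by
  have hs : ∀ Z : A, HasSum (fun k : ℕ => ((k + 2).factorial⁻¹ : ℂ) • Z ^ (k + 2))
      (NormedSpace.exp Z - 1 - Z) := fun Z => by
    have := (hasSum_nat_add_iff' 2).2 (NormedSpace.exp_series_hasSum_exp' (𝕂 := ℂ) Z)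
    simpa [Finset.sum_range_succ, sub_sub] using this
  have h2 := (hs X).sub (hs Y)
  rw [show NormedSpace.exp X - 1 - X - (NormedSpace.exp Y - 1 - Y) =
    NormedSpace.exp X - NormedSpace.exp Y - (X - Y) by abel] at h2
  refine (isClosed_LamN π (n + 1)).mem_of_tendsto h2 (Filter.Eventually.of_forall fun s => ?_)
  refine sum_mem fun k _ => ?_
  rw [← smul_sub]
  exact Submodule.smul_mem _ _ (hπ.pow_sub_pow_mem hX hY h k)

theorem exp_sub_one_mem {X : A} (hX : X ∈ LamN π 2) : NormedSpace.exp X - 1 ∈ LamN π 2 := by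
  have := hπ.exp_sub_exp_mem (n := 2) hX (zero_mem _) (by simpa using hX)
  rw [NormedSpace.exp_zero, sub_zero] at this
  simpa using add_mem (LamN_le_two π _ this) hX

/-- The logarithm is the fixed point of `X ↦ X + (u - e^X)`, a contraction for `LamN` because `e^X -
e^Y` agrees with `X - Y` up to the next level. -/
theorem existsUnique_log {u : A} (hu : u - 1 ∈ LamN π 2) :
    ∃! X, X ∈ LamN π 2 ∧ NormedSpace.exp X = u := by
  have := hπ.existsUnique_fixedPoint (S := LamN π 2) ⟨0, zero_mem _⟩ subset_rfl
    (f := fun X => X + (u - NormedSpace.exp X))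
    (fun X hX => by
      have : X + (u - NormedSpace.exp X) = X + ((u - 1) - (NormedSpace.exp X - 1)) := by abel
      simp only [this]
      exact add_mem hX (sub_mem hu (hπ.exp_sub_one_mem hX)))
    (fun n X hX Y hY h => by
      have := neg_mem (hπ.exp_sub_exp_mem hX hY h)
      convert this using 1
      abel)
  simpa [sub_eq_zero, eq_comm] using this

theorem exp_injOn {X Y : A} (hX : X ∈ LamN π 2) (hY : Y ∈ LamN π 2)
    (h : NormedSpace.exp X = NormedSpace.exp Y) : X = Y :=
  (hπ.existsUnique_log (hπ.exp_sub_one_mem hY)).unique ⟨hX, h⟩ ⟨hY, rfl⟩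

end IsBigrading

end Exp

/-- A family of submodules over a linear order is independent if each of them meets the span of the
smaller ones trivially. -/
theorem iSupIndep_of_disjoint_lt {ι R M : Type*} [LinearOrder ι] [Ring R] [AddCommGroup M]
    [Module R M] (I : ι → Submodule R M) (h : ∀ i, Disjoint (I i) (⨆ (j) (_ : j < i), I j)) :
    iSupIndep I := by
  classical
  rw [iSupIndep_iff_finsetSum_eq_zero_imp_eq_zero]
  intro s v hv hsum i₀ hi₀
  by_contra hne
  have hne' : (s.filter fun i => v i ≠ 0).Nonempty := ⟨i₀, by simp [hi₀, hne]⟩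
  set i := (s.filter fun i => v i ≠ 0).max' hne' with hi
  obtain ⟨his, hvi⟩ := Finset.mem_filter.1 (Finset.max'_mem _ hne')
  rw [← hi] at his hvi
  rw [← Finset.add_sum_erase _ _ his, add_eq_zero_iff_eq_neg] at hsum
  refine hvi (Submodule.disjoint_def.1 (h i) _ (hv i his) ?_)
  rw [hsum]
  refine neg_mem (sum_mem fun j hj => ?_)
  by_cases hvj : v j = 0
  · rw [hvj]
    exact zero_mem _
  have hjs := Finset.mem_of_mem_erase hj
  have hlt : j < i := lt_of_le_of_ne (Finset.le_max' _ _ (by simp [hjs, hvj]))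
    (Finset.ne_of_mem_erase hj)
  exact Submodule.mem_iSup_of_mem j (Submodule.mem_iSup_of_mem hlt (hv j hjs))

/-! ### The Deligne bigrading splits `W` and `F` -/

variable {E : Type*} [NormedAddCommGroup E] [NormedSpace ℂ E]

namespace Datum

variable (D : Datum E)

theorem mem_conjSub {P : Submodule ℂ E} {v : E} : v ∈ D.conjSub P ↔ D.conj v ∈ P := Iff.rfl

theorem conjSub_mono {P Q : Submodule ℂ E} (h : P ≤ Q) : D.conjSub P ≤ D.conjSub Q :=
  fun _ hv => h hv

theorem conj_mem_W {k : ℤ} {v : E} : D.conj v ∈ D.W k ↔ v ∈ D.W k :=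
  ⟨fun h => by simpa [D.conj_conj] using D.W_real k _ h, D.W_real k v⟩

/-- The sum of the `conj F^{k - p + 1} ∩ W k` with `k ≤ w`; a complement of `F^p ∩ W w` in `W w`. -/
def opp (F : ℤ → Submodule ℂ E) (p w : ℤ) : Submodule ℂ E :=
  ⨆ (k : ℤ) (_ : k ≤ w), D.conjSub (F (k - p + 1)) ⊓ D.W k

variable {D} {F : ℤ → Submodule ℂ E}

theorem le_opp {p w k : ℤ} (h : k ≤ w) : D.conjSub (F (k - p + 1)) ⊓ D.W k ≤ D.opp F p w :=
  le_iSup₂_of_le k h le_rfl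

theorem opp_le_W (p w : ℤ) : D.opp F p w ≤ D.W w :=
  iSup₂_le fun _ hk => inf_le_right.trans (D.W_mono hk)

theorem opp_mono_right (p : ℤ) {w w' : ℤ} (h : w ≤ w') : D.opp F p w ≤ D.opp F p w' :=
  iSup₂_le fun _ hk => le_opp (hk.trans h)

theorem opp_eq (p w : ℤ) :
    D.opp F p w = D.conjSub (F (w - p + 1)) ⊓ D.W w ⊔ D.opp F p (w - 1) := by
  refine le_antisymm (iSup₂_le fun k hk => ?_)
    (sup_le (le_opp le_rfl) (opp_mono_right p (by omega)))
  rcases hk.eq_or_lt with rfl | hk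
  · exact le_sup_left
  · exact (le_opp (w := w - 1) (by omega)).trans le_sup_right

/-- The part of `W (p + q)` in which `bigr F p q` is the intersection with `F p`. -/
def pre (D : Datum E) (F : ℤ → Submodule ℂ E) (p q : ℤ) : Submodule ℂ E :=
  D.conjSub (F q) ⊓ D.W (p + q) ⊔ D.opp F p (p + q - 1)

theorem pre_le_W (p q : ℤ) : D.pre F p q ≤ D.W (p + q) :=
  sup_le inf_le_right ((opp_le_W _ _).trans (D.W_mono (by omega)))

/-- Deligne's sum omits the weight `p + q - 1`, but that term is contained in `conj F^q ∩ W_{p+q}`.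
So `I^{p,q}` is the intersection of `F^p` with a subspace built from `conj F` and `W` alone. -/
theorem bigr_eq (p q : ℤ) : D.bigr F p q = F p ⊓ D.pre F p q := by
  have h1 : (⨆ j : ℕ, D.conjSub (F (q - (j + 1))) ⊓ D.W (p + q - (j + 1) - 1)) =
      D.opp F p (p + q - 1 - 1) := by
    refine le_antisymm (iSup_le fun j => ?_) (iSup₂_le fun k hk => ?_)
    · rw [show q - (j + 1 : ℤ) = (p + q - (j + 1) - 1) - p + 1 by ring]
      exact le_opp (by omega)
    · refine le_iSup_of_le (p + q - 2 - k).toNat ?_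
      have : ((p + q - 2 - k).toNat : ℤ) = p + q - 2 - k := Int.toNat_of_nonneg (by omega)
      rw [this, show q - (p + q - 2 - k + 1) = k - p + 1 by ring,
        show p + q - (p + q - 2 - k + 1) - 1 = k by ring]
  have h2 : D.pre F p q = D.conjSub (F q) ⊓ D.W (p + q) ⊔ D.opp F p (p + q - 1 - 1) := by
    rw [pre, opp_eq, show p + q - 1 - p + 1 = q by ring, ← sup_assoc,
      sup_eq_left.2 (inf_le_inf_left (D.conjSub (F q))
        (D.W_mono (show p + q - 1 ≤ p + q by omega)))]
  rw [bigr, h1, ← h2, inf_assoc, inf_eq_right.2 (pre_le_W p q)]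

theorem bigr_le_F (p q : ℤ) : D.bigr F p q ≤ F p := by rw [bigr_eq]; exact inf_le_left
theorem bigr_le_pre (p q : ℤ) : D.bigr F p q ≤ D.pre F p q := by rw [bigr_eq]; exact inf_le_right
theorem bigr_le_W (p q : ℤ) : D.bigr F p q ≤ D.W (p + q) := (bigr_le_pre p q).trans (pre_le_W p q)

theorem W_induction {P : ℤ → Prop} (h0 : ∀ w, D.W w = ⊥ → P w) (h1 : ∀ w, P (w - 1) → P w) (w : ℤ) :
    P w := by
  obtain ⟨k, hk⟩ := D.W_bot
  rcases le_total w k with h | h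
  · exact h0 w (eq_bot_iff.2 (hk ▸ D.W_mono h))
  · induction w, h using Int.leInduction with
    | base => exact h0 k hk
    | succ n _ ih => exact h1 _ (by simpa using ih)

namespace IsGradedPolarizedMHS

variable (hF : D.IsGradedPolarizedMHS F)
include hF

theorem opp_anti {p p' : ℤ} (w : ℤ) (h : p ≤ p') : D.opp F p w ≤ D.opp F p' w :=
  iSup₂_le fun k hk => le_trans (inf_le_inf_right _ (D.conjSub_mono (hF.anti (by omega))))
    (le_opp hk)

/-- Induction on the weight: modulo `W (w - 1)` the decomposition is the opposedness of `F` and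
`conj F` on `Gr^W_w`. -/
theorem sup_opp (p w : ℤ) : F p ⊓ D.W w ⊔ D.opp F p w = D.W w := by
  refine le_antisymm (sup_le inf_le_right (opp_le_W p w)) ?_
  revert w
  refine W_induction (D := D) (fun w hw => by simp [hw]) fun w ih => ?_
  have hW : D.W (w - 1) ≤ F p ⊓ D.W w ⊔ D.opp F p w := ih.trans
    (sup_le_sup (inf_le_inf_left _ (D.W_mono (by omega))) (opp_mono_right p (by omega)))
  conv_lhs => rw [← hF.sup_eq w p]
  refine sup_le (sup_le le_sup_left hW) fun v hv => ?_
  obtain ⟨a, ha, b, hb, hab⟩ := Submodule.mem_sup.1 (D.mem_conjSub.1 hv)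
  have : v = D.conj a + D.conj b := by rw [← map_add, hab, D.conj_conj]
  rw [this]
  refine add_mem (le_sup_right (a := F p ⊓ D.W w) (le_opp le_rfl ⟨?_, D.W_real _ _ ha.2⟩))
    (hW (D.W_real _ _ hb))
  rw [SetLike.mem_coe, mem_conjSub, D.conj_conj]
  exact ha.1

theorem disjoint_opp (p w : ℤ) : Disjoint (F p) (D.opp F p w) := by
  rw [disjoint_iff_inf_le]
  revert w
  refine W_induction (D := D) (fun w hw => ?_) fun w ih => ?_
  · exact inf_le_right.trans (hw ▸ opp_le_W p w)
  · rintro v ⟨hv, hv'⟩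
    have hvW := opp_le_W p w hv'
    rw [opp_eq] at hv'
    obtain ⟨a, ha, b, hb, rfl⟩ := Submodule.mem_sup.1 hv'
    have hbW := opp_le_W p _ hb
    have : a + b ∈ D.W (w - 1) := by
      rw [← hF.inf_eq w p]
      refine ⟨le_sup_left (a := F p ⊓ D.W w) ⟨hv, hvW⟩, ?_⟩
      rw [SetLike.mem_coe, mem_conjSub, map_add]
      exact Submodule.add_mem_sup ⟨ha.1, D.W_real _ _ ha.2⟩ (D.W_real _ _ hbW)
    -- The class of `a + b` in `Gr^W_w` vanishes, so `a` drops to weight `w - 1` and joins the lower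
    -- part of `opp`.
    refine ih ⟨hv, add_mem ?_ hb⟩
    refine le_opp le_rfl ⟨D.conjSub_mono (hF.anti (by omega)) ha.1, ?_⟩
    simpa using sub_mem this hbW

theorem exists_add_of_mem_W {w : ℤ} (p : ℤ) {v : E} (hv : v ∈ D.W w) :
    ∃ f ∈ F p, f ∈ D.W w ∧ ∃ l ∈ D.opp F p w, f + l = v := by
  rw [← hF.sup_opp p w] at hv
  obtain ⟨f, hf, l, hl, h⟩ := Submodule.mem_sup.1 hv
  exact ⟨f, hf.1, hf.2, l, hl, h⟩

theorem eq_zero_of_mem {p w : ℤ} {v : E} (h : v ∈ F p) (h' : v ∈ D.opp F p w) : v = 0 :=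
  Submodule.disjoint_def.1 (hF.disjoint_opp p w) v h h'

/-- Strictness: splitting `v` inside `W w`, its component in `F p` also lies in `opp` for the larger
weight and hence vanishes. -/
theorem opp_inf_W {p w w' : ℤ} {v : E} (h : v ∈ D.opp F p w') (hv : v ∈ D.W w) :
    v ∈ D.opp F p w := by
  obtain ⟨f, hf, hfW, l, hl, rfl⟩ := hF.exists_add_of_mem_W p hv
  have h1 : f + l ∈ D.opp F p (max w w') := opp_mono_right p (le_max_right _ _) h
  have h2 : l ∈ D.opp F p (max w w') := opp_mono_right p (le_max_left _ _) hl
  have : f = 0 := hF.eq_zero_of_mem hf (by simpa using sub_mem h1 h2)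
  simpa [this] using hl

end IsGradedPolarizedMHS

/-- The sum of the `I^x` for `x` in a set of indices. -/
def bigrSet (D : Datum E) (F : ℤ → Submodule ℂ E) (s : Set (ℤ × ℤ)) : Submodule ℂ E :=
  ⨆ (x : ℤ × ℤ) (_ : x ∈ s), D.bigr F x.1 x.2

theorem bigrSet_mono {s t : Set (ℤ × ℤ)} (h : s ⊆ t) : D.bigrSet F s ≤ D.bigrSet F t :=
  iSup₂_le fun x hx => le_iSup₂_of_le x (h hx) le_rfl

theorem bigr_le_bigrSet {s : Set (ℤ × ℤ)} {p q : ℤ} (h : (p, q) ∈ s) :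
    D.bigr F p q ≤ D.bigrSet F s := le_iSup₂_of_le (p, q) h le_rfl

theorem bigrSet_le_iff {s : Set (ℤ × ℤ)} {P : Submodule ℂ E} :
    D.bigrSet F s ≤ P ↔ ∀ p q, (p, q) ∈ s → D.bigr F p q ≤ P := by
  rw [bigrSet, iSup₂_le_iff, Prod.forall]

namespace IsGradedPolarizedMHS

variable (hF : D.IsGradedPolarizedMHS F)
include hF

/-- This is the row of first index `p`. The lower-weight part `b` is split along `F p`; moving its
component `f` across leaves `a + l` in `I^{p,w-p}` and `f` for the induction on the weight. -/
theorem inf_opp_le (p w : ℤ) :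
    F p ⊓ D.opp F (p + 1) w ≤ D.bigrSet F {x | x.1 = p ∧ x.1 + x.2 ≤ w} := by
  revert w
  refine W_induction (D := D) (fun w hw => ?_) fun w ih => ?_
  · exact (inf_le_right.trans (hw ▸ opp_le_W _ w)).trans bot_le
  · rintro v ⟨hv, hv'⟩
    rw [SetLike.mem_coe, opp_eq] at hv'
    obtain ⟨a, ha, b, hb, rfl⟩ := Submodule.mem_sup.1 hv'
    obtain ⟨f, hf, hfW, l, hl, rfl⟩ := hF.exists_add_of_mem_W p (opp_le_W _ _ hb)
    rw [show a + (f + l) = (a + l) + f by abel]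
    refine add_mem (bigr_le_bigrSet (p := p) (q := w - p) (by simp) ?_)
      (bigrSet_mono ?_ (ih ⟨hf, ?_⟩))
    · rw [bigr_eq]
      refine ⟨by simpa [add_assoc, add_sub_assoc, add_comm f l] using sub_mem hv hf, ?_⟩
      rw [SetLike.mem_coe, pre, show p + (w - p) = w by ring]
      rw [show w - (p + 1) + 1 = w - p by ring] at ha
      exact Submodule.add_mem_sup ha hl
    · rintro x ⟨h1, h2⟩
      exact ⟨h1, by omega⟩
    · simpa using sub_mem hb (hF.opp_anti _ (by omega) hl)

/-- Descending induction from an index where `F` vanishes; each step adds one row. The bound on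
`opp` below ascends in the same way from an index where `F` is everything. -/
theorem F_inf_W_le (p w : ℤ) : F p ⊓ D.W w ≤ D.bigrSet F {x | p ≤ x.1 ∧ x.1 + x.2 ≤ w} := by
  obtain ⟨m, hm⟩ := hF.eq_bot
  rcases le_total m p with h | h
  · exact (inf_le_left.trans (hm ▸ hF.anti h)).trans bot_le
  · induction p, h using Int.leInductionDown with
    | base => exact (inf_le_left.trans hm.le).trans bot_le
    | pred n _ ih =>
      rintro v ⟨hv, hvW⟩
      obtain ⟨f, hf, hfW, l, hl, rfl⟩ := hF.exists_add_of_mem_W n hvW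
      refine add_mem (bigrSet_mono ?_ (ih ⟨hf, hfW⟩)) (bigrSet_mono ?_
        (hF.inf_opp_le (n - 1) w ⟨?_, by simpa using hl⟩))
      · rintro x ⟨h1, h2⟩
        exact ⟨by omega, h2⟩
      · rintro x ⟨h1, h2⟩
        exact ⟨h1.ge, h2⟩
      · simpa using sub_mem hv (hF.anti (by omega : n - 1 ≤ n) hf)

theorem opp_le_bigrSet (p w : ℤ) : D.opp F p w ≤ D.bigrSet F {x | x.1 < p ∧ x.1 + x.2 ≤ w} := by
  obtain ⟨m, hm⟩ := hF.eq_top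
  have h0 : ∀ p ≤ m, D.opp F p w = ⊥ := fun p hp => by
    have := hF.disjoint_opp p w
    rwa [show F p = ⊤ from top_unique (hm ▸ hF.anti hp), top_disjoint] at this
  rcases le_total p m with h | h
  · exact (h0 p h).le.trans bot_le
  · induction p, h using Int.leInduction with
    | base => exact (h0 m le_rfl).le.trans bot_le
    | succ n _ ih =>
      intro v hv
      obtain ⟨f, hf, hfW, l, hl, rfl⟩ := hF.exists_add_of_mem_W n (opp_le_W _ _ hv)
      refine add_mem (bigrSet_mono ?_ (hF.inf_opp_le n w ⟨hf, ?_⟩)) (bigrSet_mono ?_ (ih hl))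
      · rintro x ⟨h1, h2⟩
        exact ⟨by omega, h2⟩
      · simpa using sub_mem hv (hF.opp_anti w (by omega : n ≤ n + 1) hl)
      · rintro x ⟨h1, h2⟩
        exact ⟨by omega, h2⟩

theorem bigr_le_opp {a b p w : ℤ} (h : a < p) (hw : a + b ≤ w) : D.bigr F a b ≤ D.opp F p w := by
  refine (bigr_le_pre a b).trans (sup_le ?_ ?_)
  · refine le_trans ?_ (hF.opp_anti w (by omega : a + 1 ≤ p))
    refine le_trans ?_ (le_opp hw)
    rw [show a + b - (a + 1) + 1 = b by ring]
  · exact (hF.opp_anti _ h.le).trans (opp_mono_right _ (by omega))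

theorem F_inf_W_eq (p w : ℤ) : F p ⊓ D.W w = D.bigrSet F {x | p ≤ x.1 ∧ x.1 + x.2 ≤ w} :=
  le_antisymm (hF.F_inf_W_le p w) (bigrSet_le_iff.2 fun _ _ h =>
    le_inf ((bigr_le_F _ _).trans (hF.anti h.1)) ((bigr_le_W _ _).trans (D.W_mono h.2)))

theorem W_eq (w : ℤ) : D.W w = D.bigrSet F {x | x.1 + x.2 ≤ w} := by
  refine le_antisymm ?_ (bigrSet_le_iff.2 fun _ _ h => (bigr_le_W _ _).trans (D.W_mono h))
  obtain ⟨m, hm⟩ := hF.eq_top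
  have := hF.F_inf_W_le m w
  rw [hm, top_inf_eq] at this
  exact this.trans (bigrSet_mono fun x hx => hx.2)

theorem F_eq (p : ℤ) : F p = D.bigrSet F {x | p ≤ x.1} := by
  refine le_antisymm ?_ (bigrSet_le_iff.2 fun _ _ h => (bigr_le_F _ _).trans (hF.anti h))
  obtain ⟨m, hm⟩ := D.W_top
  have := hF.F_inf_W_le p m
  rw [hm, inf_top_eq] at this
  exact this.trans (bigrSet_mono fun x hx => hx.1)

theorem bigr_inf_W {p q : ℤ} {v : E} (hv : v ∈ D.bigr F p q) (hW : v ∈ D.W (p + q - 1)) : v = 0 := by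
  have hv' := bigr_le_pre p q hv
  obtain ⟨a, ha, b, hb, rfl⟩ := Submodule.mem_sup.1 hv'
  refine hF.eq_zero_of_mem (p := p) (w := p + q - 1) (bigr_le_F p q hv) (add_mem ?_ hb)
  have := le_opp (D := D) (F := F) (p := p) (le_refl (p + q - 1))
  rw [show p + q - 1 - p + 1 = q by ring] at this
  exact this ⟨ha.1, by simpa using sub_mem hW (opp_le_W _ _ hb)⟩

/-- The index set is closed under lowering both indices, which makes `pre` stable under `Λ^{-1,-1}`.
-/
theorem pre_eq_bigrSet (p q : ℤ) : D.pre F p q =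
    D.bigrSet F {x | x = (p, q) ∨ x.1 < p ∧ x.1 + x.2 ≤ p + q} := by
  have hle : D.opp F p (p + q) ≤ D.pre F p q := by
    rw [opp_eq, pre]
    refine sup_le_sup_right (inf_le_inf_right _ (D.conjSub_mono (hF.anti (by omega)))) _
  refine le_antisymm (sup_le ?_ ?_) (bigrSet_le_iff.2 ?_)
  · intro v hv
    have hpre : v ∈ D.pre F p q := le_sup_left (a := D.conjSub (F q) ⊓ D.W (p + q)) hv
    obtain ⟨f, hf, hfW, l, hl, rfl⟩ := hF.exists_add_of_mem_W p hv.2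
    refine add_mem (bigr_le_bigrSet (p := p) (q := q) (Or.inl rfl) ?_)
      (bigrSet_mono (fun x hx => Or.inr hx) (hF.opp_le_bigrSet _ _ hl))
    rw [bigr_eq]
    exact ⟨hf, by simpa using sub_mem hpre (hle hl)⟩
  · exact (hF.opp_le_bigrSet _ _).trans
      (bigrSet_mono fun x hx => Or.inr ⟨hx.1, by have := hx.2; omega⟩)
  · rintro a b (h | h)
    · cases h
      exact bigr_le_pre p q
    · exact (hF.bigr_le_opp h.1 h.2).trans hle

theorem iSupIndep_bigr : iSupIndep fun x : ℤ × ℤ => D.bigr F x.1 x.2 := by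
  have : iSupIndep fun x : ℤ ×ₗ ℤ => D.bigr F (ofLex x).1 (ofLex x).2 := by
    refine iSupIndep_of_disjoint_lt _ fun x => Submodule.disjoint_def.2 fun v hv hv' => ?_
    obtain ⟨k, hk⟩ := D.W_top
    -- In lexicographic order, earlier rows lie in `opp`, and earlier members of the same row lie in
    -- `F^p` with strictly smaller weight; neither part contributes to `I^{p,q}`.
    have hle : (⨆ (j : ℤ ×ₗ ℤ) (_ : j < x), D.bigr F (ofLex j).1 (ofLex j).2) ≤
        D.opp F (ofLex x).1 k ⊔ F (ofLex x).1 ⊓ D.W ((ofLex x).1 + (ofLex x).2 - 1) := by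
      refine iSup₂_le fun j hj => ?_
      rcases Prod.Lex.lt_iff.1 hj with h | ⟨h1, h2⟩
      · rcases le_total ((ofLex j).1 + (ofLex j).2) k with h' | h'
        · exact (hF.bigr_le_opp h h').trans le_sup_left
        · refine (hF.bigr_le_opp h le_rfl).trans (le_trans (fun v hv => ?_) le_sup_left)
          exact hF.opp_inf_W hv (hk ▸ Submodule.mem_top)
      · refine le_trans (le_inf ?_ ?_) le_sup_right
        · rw [← h1]; exact bigr_le_F _ _
        · exact (bigr_le_W _ _).trans (D.W_mono (by omega))
    obtain ⟨l, hl, s, hs, rfl⟩ := Submodule.mem_sup.1 (hle hv')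
    have hl0 : l = 0 := hF.eq_zero_of_mem (p := (ofLex x).1)
      (by simpa using sub_mem (bigr_le_F _ _ hv) hs.1) hl
    rw [hl0, zero_add] at hv ⊢
    exact hF.bigr_inf_W hv hs.2
  exact this.comp toLex.injective

theorem iSup_bigr : ⨆ x : ℤ × ℤ, D.bigr F x.1 x.2 = ⊤ := by
  obtain ⟨k, hk⟩ := D.W_top
  rw [eq_top_iff, ← hk, hF.W_eq k]
  exact iSup₂_le fun x _ => le_iSup (fun x : ℤ × ℤ => D.bigr F x.1 x.2) x

end IsGradedPolarizedMHS

end Datum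

/-! ### Exponential identities -/

section Exp

variable {A : Type*} [NormedRing A] [NormedAlgebra ℂ A] [CompleteSpace A]

theorem continuous_exp : Continuous (NormedSpace.exp : A → A) := by
  let _ := NormedAlgebra.restrictScalars ℚ ℂ A
  exact NormedSpace.exp_continuous

theorem exp_mul_exp_neg (X : A) : NormedSpace.exp X * NormedSpace.exp (-X) = 1 := by
  let _ := NormedAlgebra.restrictScalars ℚ ℂ A
  rw [← NormedSpace.exp_add_of_commute (Commute.neg_right (Commute.refl X)), add_neg_cancel,
    NormedSpace.exp_zero]

theorem exp_neg_mul_exp (X : A) : NormedSpace.exp (-X) * NormedSpace.exp X = 1 := by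
  simpa using exp_mul_exp_neg (-X)

theorem exp_mul_exp_self (X : A) :
    NormedSpace.exp X * NormedSpace.exp X = NormedSpace.exp ((2 : ℂ) • X) := by
  let _ := NormedAlgebra.restrictScalars ℚ ℂ A
  rw [← NormedSpace.exp_add_of_commute (Commute.refl X), two_smul]

theorem map_exp_of_continuous (f : A →+* A) (hf : Continuous f) (X : A) :
    f (NormedSpace.exp X) = NormedSpace.exp (f X) := by
  let _ := NormedAlgebra.restrictScalars ℚ ℂ A
  exact NormedSpace.map_exp f hf X

theorem exp_conj_of_mul_eq_one {g g' : A} (h : g * g' = 1) (h' : g' * g = 1) (X : A) :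
    NormedSpace.exp (g * X * g') = g * NormedSpace.exp X * g' := by
  let _ := NormedAlgebra.restrictScalars ℚ ℂ A
  exact NormedSpace.exp_units_conj ⟨g, g', h, h'⟩ X

end Exp

/-! ### Unipotent elements intertwining two nearby bigradings -/

section Intertwine

variable {A : Type*} [Ring A] [Algebra ℂ A]

/-- Two bigradings that agree up to elements of `LamN`. -/
def Near (π π' : ℤ × ℤ → A) : Prop :=
  ∀ x y, x ≠ y → ¬ Below x y → π x * π' y = 0 ∧ π' x * π y = 0

variable {π π' : ℤ × ℤ → A}

theorem Near.symm (h : Near π π') : Near π' π := fun x y h1 h2 => (h x y h1 h2).symm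

/-- Expand `X` in its `π`-blocks. Passing between the two bigradings keeps an index or moves it in
the lowering direction, so no drop is lost. -/
theorem IsBigrading.LamN_le_of_near (hπ : IsBigrading π) (h : Near π π') (n : ℕ) :
    LamN π n ≤ LamN π' n := by
  intro X hX x y hxy
  rw [show π' x * X * π' y = ∑ a ∈ hπ.finite.toFinset, ∑ b ∈ hπ.finite.toFinset,
    π' x * (π a * X * π b) * π' y by
      conv_lhs => rw [← one_mul X, ← mul_one (1 * X), ← hπ.sum_finset]
      simp_rw [Finset.sum_mul, Finset.mul_sum, Finset.sum_mul]]
  refine Finset.sum_eq_zero fun a _ => Finset.sum_eq_zero fun b _ => ?_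
  have haux : ∀ u v : ℤ × ℤ, u = v ∨ Below u v → u.1 ≤ v.1 ∧ u.2 ≤ v.2 := by
    rintro u v (rfl | h)
    · exact ⟨le_rfl, le_rfl⟩
    · exact ⟨h.1.le, h.2.le⟩
  by_cases hxa : x = a ∨ Below x a
  · by_cases hby : b = y ∨ Below b y
    · rw [hX a b, mul_zero, zero_mul]
      intro hab
      obtain ⟨h1, h2⟩ := haux _ _ hxa
      obtain ⟨h3, h4⟩ := haux _ _ hby
      obtain ⟨⟨h5, h6⟩, h7⟩ := hab
      exact hxy ⟨⟨by omega, by omega⟩, by omega⟩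
    · rw [not_or] at hby
      rw [show π' x * (π a * X * π b) * π' y = π' x * (π a * X) * (π b * π' y) by noncomm_ring,
        (h b y hby.1 hby.2).1, mul_zero]
  · rw [not_or] at hxa
    rw [show π' x * (π a * X * π b) * π' y = (π' x * π a) * (X * π b * π' y) by noncomm_ring,
        (h x a hxa.1 hxa.2).2, zero_mul]

theorem IsBigrading.LamN_eq_of_near (hπ : IsBigrading π) (hπ' : IsBigrading π') (h : Near π π')
    (n : ℕ) : LamN π n = LamN π' n :=
  le_antisymm (hπ.LamN_le_of_near h n) (hπ'.LamN_le_of_near h.symm n)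

/-- The element `∑ π' x * π x`, which carries the bigrading `π` to a near bigrading `π'`. -/
def carrier (π π' : ℤ × ℤ → A) : A := ∑ᶠ x, π' x * π x

theorem IsBigrading.carrier_eq (hπ : IsBigrading π) :
    carrier π π' = ∑ x ∈ hπ.finite.toFinset, π' x * π x := by
  refine finsum_eq_sum_of_support_subset _ fun x hx => ?_
  rw [Set.Finite.coe_toFinset]
  intro h
  exact hx (by simp [h])

theorem IsBigrading.carrier_mul (hπ : IsBigrading π) (x : ℤ × ℤ) :
    carrier π π' * π x = π' x * π x := by
  rw [hπ.carrier_eq, Finset.sum_mul]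
  simp_rw [mul_assoc, hπ.mul_eq]
  rw [Finset.sum_eq_single x]
  · simp
  · intro y _ hy
    simp [hy]
  · intro h
    simp at h
    simp [h]

theorem IsBigrading.mul_carrier (hπ : IsBigrading π) (hπ' : IsBigrading π') (x : ℤ × ℤ) :
    π' x * carrier π π' = π' x * π x := by
  rw [hπ.carrier_eq, Finset.mul_sum]
  simp_rw [← mul_assoc, hπ'.mul_eq]
  rw [Finset.sum_eq_single x]
  · simp
  · intro y _ hy
    simp [hy.symm]
  · intro h
    simp at h
    simp [h]

theorem IsBigrading.carrier_sub_one_mem (hπ : IsBigrading π) (hπ' : IsBigrading π')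
    (h : Near π π') : carrier π π' - 1 ∈ LamN π 2 := by
  rw [mem_LamN_two]
  intro x y hxy
  rw [mul_sub, sub_mul, mul_assoc, hπ.carrier_mul, mul_one, ← mul_assoc]
  by_cases hne : x = y
  · subst hne
    -- Diagonal block: a term with `z ≠ x` survives only if `x` is below `z` and `z` is below `x`,
    -- which is impossible.
    have : π x * (∑ z ∈ hπ'.finite.toFinset, π' z) * π x = π x * π' x * π x := by
      rw [Finset.mul_sum, Finset.sum_mul, Finset.sum_eq_single x]
      · intro z _ hz
        by_cases hb : Below x z
        · rw [mul_assoc, (h z x hz fun hb' => absurd (hb.1.trans hb'.1) (lt_irrefl _)).2, mul_zero]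
        · rw [(h x z hz.symm hb).1, zero_mul]
      · intro hx
        simp at hx
        simp [hx]
    rw [← this, hπ'.sum_finset, mul_one, sub_self]
  · rw [(h x y hne hxy).1, zero_mul, hπ.orth x y hne, sub_zero]

/-- An element of `1 + LamN` that commutes with the bigrading is `1`. -/
theorem IsBigrading.eq_one_of_commute (hπ : IsBigrading π) {u : A} (hu : u - 1 ∈ LamN π 2)
    (hc : ∀ x, u * π x = π x * u) : u = 1 := by
  rw [← sub_eq_zero]
  refine hπ.ext fun x y => ?_
  rw [mul_zero, zero_mul]
  by_cases h : Below x y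
  · rw [mul_assoc, sub_mul, hc, one_mul, mul_sub, ← mul_assoc, hπ.mul_eq, if_neg]
    · simp
    · rintro rfl
      exact lt_irrefl _ h.1
  · exact mem_LamN_two.1 hu x y h

theorem IsBigrading.mul_sub_one_mem (hπ : IsBigrading π) {u v : A} (hu : u - 1 ∈ LamN π 2)
    (hv : v - 1 ∈ LamN π 2) : u * v - 1 ∈ LamN π 2 := by
  rw [show u * v - 1 = (u - 1) * (v - 1) + (u - 1) + (v - 1) by noncomm_ring]
  exact add_mem (add_mem (LamN_le_two π _ (hπ.mul_mem hu hv)) hu) hv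

end Intertwine

/-! ### Complex conjugation and the bigrading -/

section Conj

variable {E : Type*} [NormedAddCommGroup E] [NormedSpace ℂ E] [FiniteDimensional ℂ E]

namespace Datum

variable (D : Datum E)

theorem continuous_conj : Continuous D.conj := by
  let f : E →ₗ[ℝ] E :=
    { toFun := D.conj
      map_add' := map_add D.conj
      map_smul' := fun r v => by
        rw [← Complex.coe_smul, LinearMap.map_smulₛₗ, Complex.conj_ofReal, Complex.coe_smul]
        rfl }
  exact f.continuous_of_finiteDimensional

/-- The complex conjugate `conj ∘ X ∘ conj` of an endomorphism. -/
def bar : (E →L[ℂ] E) →+* (E →L[ℂ] E) where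
  toFun X :=
    { toFun := fun v => D.conj (X (D.conj v))
      map_add' := fun u v => by simp
      map_smul' := fun c v => by simp
      cont := D.continuous_conj.comp (X.continuous.comp D.continuous_conj) }
  map_one' := by ext v; exact D.conj_conj v
  map_mul' X Y := by ext v; simp [D.conj_conj]
  map_zero' := by ext v; simp
  map_add' X Y := by ext v; simp

theorem bar_apply (X : E →L[ℂ] E) (v : E) : D.bar X v = D.conj (X (D.conj v)) := rfl

theorem bar_conj (X : E →L[ℂ] E) (v : E) : D.bar X (D.conj v) = D.conj (X v) := by
  rw [bar_apply, D.conj_conj]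

theorem bar_bar (X : E →L[ℂ] E) : D.bar (D.bar X) = X := by
  ext v
  simp [bar_apply, D.conj_conj]

theorem bar_smul (c : ℂ) (X : E →L[ℂ] E) : D.bar (c • X) = starRingEnd ℂ c • D.bar X := by
  ext v
  simp [bar_apply]

theorem continuous_bar : Continuous D.bar := by
  let f : (E →L[ℂ] E) →ₗ[ℝ] (E →L[ℂ] E) :=
    { toFun := D.bar
      map_add' := map_add D.bar
      map_smul' := fun r v => by
        rw [← Complex.coe_smul, bar_smul, Complex.conj_ofReal, Complex.coe_smul]
        rfl }
  exact f.continuous_of_finiteDimensional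

theorem isReal_iff {X : E →L[ℂ] E} : D.IsReal X ↔ D.bar X = X := by
  refine ⟨fun h => ?_, fun h v => ?_⟩
  · ext v
    rw [bar_apply, ← h, D.conj_conj]
  · rw [← bar_conj, h]

theorem bar_exp (X : E →L[ℂ] E) : D.bar (NormedSpace.exp X) = NormedSpace.exp (D.bar X) :=
  map_exp_of_continuous D.bar D.continuous_bar X

/-- The projections onto the `I^{p,q}`, as a family indexed by pairs. -/
def pr (F : ℤ → Submodule ℂ E) (x : ℤ × ℤ) : E →L[ℂ] E := D.proj F x.1 x.2

/-- `E` is the direct sum of the `I^{p,q}`. -/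
def Decomposes (F : ℤ → Submodule ℂ E) : Prop :=
  iSupIndep (fun x : ℤ × ℤ => D.bigr F x.1 x.2) ∧ ⨆ x : ℤ × ℤ, D.bigr F x.1 x.2 = ⊤

/-- The conjugate projections. -/
def prBar (F : ℤ → Submodule ℂ E) (x : ℤ × ℤ) : E →L[ℂ] E := D.bar (D.pr F x.swap)

variable {D} {F : ℤ → Submodule ℂ E}

theorem IsGradedPolarizedMHS.decomposes (hF : D.IsGradedPolarizedMHS F) : D.Decomposes F :=
  ⟨hF.iSupIndep_bigr, hF.iSup_bigr⟩

namespace Decomposes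

variable (hF : D.Decomposes F)
include hF

theorem isCompl (p q : ℤ) : IsCompl (D.bigr F p q)
    (⨆ (a : ℤ) (b : ℤ) (_ : (a, b) ≠ (p, q)), D.bigr F a b) := by
  have h : (⨆ (a : ℤ) (b : ℤ) (_ : (a, b) ≠ (p, q)), D.bigr F a b) =
      ⨆ (x : ℤ × ℤ) (_ : x ≠ (p, q)), D.bigr F x.1 x.2 := by rw [iSup_prod]
  rw [h]
  refine ⟨hF.1 (p, q), codisjoint_iff_le_sup.2 ?_⟩
  rw [← hF.2]
  refine iSup_le fun x => ?_
  by_cases hx : x = (p, q)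
  · rw [hx]
    exact le_sup_left
  · exact le_trans (le_iSup₂_of_le (f := fun (x : ℤ × ℤ) (_ : x ≠ (p, q)) => D.bigr F x.1 x.2)
      x hx le_rfl) le_sup_right

theorem pr_mem (x : ℤ × ℤ) (v : E) : D.pr F x v ∈ D.bigr F x.1 x.2 := by
  rw [pr, proj, dif_pos (hF.isCompl x.1 x.2)]
  exact Submodule.projection_apply_mem _ _

theorem pr_of_mem {x : ℤ × ℤ} {v : E} (hv : v ∈ D.bigr F x.1 x.2) : D.pr F x v = v := by
  rw [pr, proj, dif_pos (hF.isCompl x.1 x.2)]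
  exact Submodule.projection_apply_of_mem_left _ hv

theorem pr_of_mem_ne {x y : ℤ × ℤ} (h : y ≠ x) {v : E} (hv : v ∈ D.bigr F y.1 y.2) :
    D.pr F x v = 0 := by
  rw [pr, proj, dif_pos (hF.isCompl x.1 x.2)]
  exact (Submodule.projection_apply_eq_zero_iff _).2
    (Submodule.mem_iSup_of_mem y.1 (Submodule.mem_iSup_of_mem y.2 (Submodule.mem_iSup_of_mem h hv)))

theorem ext {X Y : E →L[ℂ] E} (h : ∀ x : ℤ × ℤ, ∀ v ∈ D.bigr F x.1 x.2, X v = Y v) : X = Y := by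
  ext v
  have hv : v ∈ ⨆ x : ℤ × ℤ, D.bigr F x.1 x.2 := hF.2 ▸ Submodule.mem_top
  induction hv using Submodule.iSup_induction' with
  | mem x v hv => exact h x v hv
  | zero => simp
  | add u v _ _ hu hv => rw [map_add, map_add, hu, hv]

theorem isBigrading : IsBigrading (D.pr F) := by
  have hfin : (Function.support (D.pr F)).Finite := by
    refine (WellFoundedGT.finite_ne_bot_of_iSupIndep hF.1).subset fun x hx h => hx ?_
    ext v
    have := hF.pr_mem x v
    rw [h] at this
    simpa using this
  refine ⟨fun x y h => ?_, fun x => ?_, hfin, ?_⟩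
  · ext v
    exact hF.pr_of_mem_ne h.symm (hF.pr_mem y v)
  · ext v
    exact hF.pr_of_mem (hF.pr_mem x v)
  · rw [finsum_eq_sum _ hfin]
    refine hF.ext fun x v hv => ?_
    rw [sum_apply, Finset.sum_eq_single x]
    · exact hF.pr_of_mem hv
    · exact fun y _ hy => hF.pr_of_mem_ne hy.symm hv
    · intro h
      simp at h
      simp [h]

theorem mem_bigr_iff {x : ℤ × ℤ} {v : E} : v ∈ D.bigr F x.1 x.2 ↔ D.pr F x v = v :=
  ⟨hF.pr_of_mem, fun h => h ▸ hF.pr_mem x v⟩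

theorem mem_bigrSet_iff {s : Set (ℤ × ℤ)} {v : E} :
    v ∈ D.bigrSet F s ↔ ∀ x ∉ s, D.pr F x v = 0 := by
  refine ⟨fun hv x hx => ?_, fun h => ?_⟩
  · have : D.bigrSet F s ≤ LinearMap.ker (D.pr F x : E →ₗ[ℂ] E) :=
      iSup₂_le fun y hy u hu => hF.pr_of_mem_ne (ne_of_mem_of_not_mem hy hx) hu
    exact this hv
  · have : v = ∑ x ∈ hF.isBigrading.finite.toFinset, D.pr F x v := by
      rw [← sum_apply, hF.isBigrading.sum_finset]
      rfl
    rw [this]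
    refine sum_mem fun x _ => ?_
    by_cases hx : x ∈ s
    · exact bigr_le_bigrSet (p := x.1) (q := x.2) hx (hF.pr_mem x v)
    · rw [h x hx]
      exact zero_mem _

theorem bigr_eq_bigrSet (x : ℤ × ℤ) : D.bigr F x.1 x.2 = D.bigrSet F {x} :=
  le_antisymm (bigr_le_bigrSet rfl) (bigrSet_le_iff.2 fun _ _ h => by cases h; exact le_rfl)

theorem mem_Lam_iff {X : E →L[ℂ] E} : X ∈ D.Lam F ↔ X ∈ LamN (D.pr F) 2 := by
  have key : ∀ p q : ℤ, (⨆ (a : ℤ) (b : ℤ) (_ : a < p ∧ b < q), D.bigr F a b) =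
      D.bigrSet F {x | Below x (p, q)} := fun p q => by
    rw [bigrSet, iSup_prod]
    rfl
  rw [mem_LamN_two]
  simp only [Lam, Set.mem_ofPred_eq, key]
  refine ⟨fun h x y hxy => ?_, fun h p q v hv => ?_⟩
  · ext v
    exact hF.mem_bigrSet_iff.1 (h y.1 y.2 _ (hF.pr_mem y v)) x hxy
  · refine hF.mem_bigrSet_iff.2 fun x hx => ?_
    have := DFunLike.congr_fun (h x (p, q) hx) v
    simpa [hF.pr_of_mem (x := (p, q)) hv] using this

theorem isBigrading_prBar : IsBigrading (D.prBar F) := by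
  have h := hF.isBigrading
  refine ⟨fun x y hxy => ?_, fun x => ?_, ?_, ?_⟩
  · rw [prBar, prBar, ← map_mul, h.orth _ _ (fun h' => hxy (Prod.swap_injective h')), map_zero]
  · rw [prBar, ← map_mul, h.idem]
  · refine (h.finite.image Prod.swap).subset fun x hx => ⟨x.swap, fun h' => hx ?_, x.swap_swap⟩
    rw [prBar, h', map_zero]
  · have : ∑ᶠ x, D.prBar F x = ∑ᶠ x, D.bar (D.pr F x) :=
      finsum_comp_equiv (f := fun x => D.bar (D.pr F x)) (Equiv.prodComm ℤ ℤ)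
    rw [this]
    refine ((D.bar : (E →L[ℂ] E) →+ (E →L[ℂ] E)).map_finsum h.finite).symm.trans ?_
    rw [h.sum_eq]
    exact map_one D.bar

theorem bar_mem_LamN {n : ℕ} {X : E →L[ℂ] E} :
    D.bar X ∈ LamN (D.prBar F) n ↔ X ∈ LamN (D.pr F) n := by
  constructor
  · intro h x y hxy
    have := h x.swap y.swap fun h' => hxy ⟨⟨h'.1.2, h'.1.1⟩, by
      have := h'.2
      simp only [Prod.fst_swap, Prod.snd_swap] at this
      omega⟩
    simp only [prBar, Prod.swap_swap] at this
    rw [← map_mul, ← map_mul] at this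
    rw [← D.bar_bar (D.pr F x * X * D.pr F y), this, map_zero]
  · intro h x y hxy
    have := h x.swap y.swap fun h' => hxy ⟨⟨h'.1.2, h'.1.1⟩, by
      have := h'.2
      simp only [Prod.fst_swap, Prod.snd_swap] at this
      omega⟩
    rw [prBar, prBar, ← map_mul, ← map_mul, this, map_zero]

theorem isSplit_iff : D.IsSplit F ↔ ∀ x, D.prBar F x = D.pr F x := by
  constructor
  · intro h x
    refine hF.ext fun y v hv => ?_
    have hv' : D.conj v ∈ D.bigr F y.swap.1 y.swap.2 := by
      rw [h] at hv
      exact hv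
    rw [prBar, bar_apply]
    by_cases hxy : y = x
    · subst hxy
      rw [hF.pr_of_mem hv, hF.pr_of_mem hv', D.conj_conj]
    · rw [hF.pr_of_mem_ne hxy hv,
        hF.pr_of_mem_ne (fun h => hxy (Prod.swap_injective h)) hv', map_zero]
  · intro h p q
    ext v
    rw [mem_conjSub, hF.mem_bigr_iff (x := (p, q)), hF.mem_bigr_iff (x := (q, p)), ← h (p, q),
      prBar, bar_apply, Prod.swap_prod_mk]
    constructor
    · intro h'
      conv_rhs => rw [← h']
      rw [D.conj_conj]
    · intro h'
      rw [h', D.conj_conj]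

end Decomposes

namespace IsGradedPolarizedMHS

variable (hF : D.IsGradedPolarizedMHS F)
include hF

/-- Deligne's congruence `conj I^{q,p} ≡ I^{p,q}` modulo lower terms. Two inclusions combine: `conj
v` lies in `pre` at `(p, q)`, which controls the first index, and in the conjugate of `pre` at `(q,
p)`, which controls the second. -/
theorem conj_mem_of_mem_bigr {p q : ℤ} {v : E} (hv : v ∈ D.bigr F q p) :
    D.conj v ∈ D.bigrSet F {x | x = (p, q) ∨ Below x (p, q)} := by
  have h1 : D.conj v ∈ D.bigrSet F {x | x = (p, q) ∨ x.1 < p ∧ x.1 + x.2 ≤ p + q} := by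
    rw [← hF.pre_eq_bigrSet]
    refine le_sup_left (a := D.conjSub (F q) ⊓ D.W (p + q)) ⟨?_, ?_⟩
    · rw [SetLike.mem_coe, mem_conjSub, D.conj_conj]
      exact bigr_le_F _ _ hv
    · exact D.W_real _ _ (add_comm q p ▸ bigr_le_W _ _ hv)
  have h2 : D.conj v ∈ D.bigrSet F {x | p ≤ x.1 ∨ x.2 < q} := by
    have hle : D.pre F q p ≤ D.conjSub (D.bigrSet F {x | p ≤ x.1 ∨ x.2 < q}) := by
      refine sup_le (inf_le_left.trans (D.conjSub_mono ?_)) (iSup₂_le fun k hk => ?_)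
      · rw [hF.F_eq]
        exact bigrSet_mono fun x hx => Or.inl hx
      · rintro u ⟨hu, hu'⟩
        rw [mem_conjSub]
        have : D.conj u ∈ F (k - q + 1) ⊓ D.W k := ⟨hu, D.W_real _ _ hu'⟩
        rw [hF.F_inf_W_eq] at this
        refine bigrSet_mono (fun x hx => Or.inr ?_) this
        have h1 := hx.1
        have h2 := hx.2
        omega
    exact hle (bigr_le_pre _ _ hv)
  rw [hF.decomposes.mem_bigrSet_iff] at h1 h2 ⊢
  intro x hx
  by_contra hne
  have h1' := not_imp_comm.1 (h1 x) hne
  have h2' := not_imp_comm.1 (h2 x) hne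
  rcases h1' with h | h
  · exact hx (Or.inl h)
  · refine hx (Or.inr ⟨h.1, ?_⟩)
    rcases h2' with h' | h'
    · exact absurd h.1 (not_lt.2 h')
    · exact h'

theorem near : Near (D.pr F) (D.prBar F) := by
  have key : ∀ x y : ℤ × ℤ, x ≠ y → ¬ Below x y → D.pr F x * D.prBar F y = 0 := by
    intro x y hne hb
    ext v
    have := hF.conj_mem_of_mem_bigr (p := y.1) (q := y.2)
      (hF.decomposes.pr_mem y.swap (D.conj v))
    exact hF.decomposes.mem_bigrSet_iff.1 this x (by rintro (h | h); exacts [hne h, hb h])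
  refine fun x y hne hb => ⟨key x y hne hb, ?_⟩
  have := key x.swap y.swap (fun h => hne (Prod.swap_injective h)) fun h => hb ⟨h.2, h.1⟩
  rw [prBar, Prod.swap_swap] at this
  rw [prBar, ← D.bar_bar (D.pr F y), ← map_mul, this, map_zero]

/-- Although conjugation need not preserve the bigrading, it preserves `Λ^{-1,-1}` and its
filtration. -/
theorem LamN_prBar (n : ℕ) : LamN (D.prBar F) n = LamN (D.pr F) n :=
  (hF.decomposes.isBigrading.LamN_eq_of_near hF.decomposes.isBigrading_prBar hF.near n).symm

theorem bar_mem_LamN {n : ℕ} {X : E →L[ℂ] E} :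
    D.bar X ∈ LamN (D.pr F) n ↔ X ∈ LamN (D.pr F) n := by
  conv_lhs => rw [← hF.LamN_prBar]
  exact hF.decomposes.bar_mem_LamN

end IsGradedPolarizedMHS

end Datum

end Conj

/-! ### Bigradings and multipliers under conjugation by a unit -/

section Ring

variable {A : Type*} [Ring A] [Algebra ℂ A] {π : ℤ × ℤ → A}

theorem IsBigrading.conj (hπ : IsBigrading π) {g g' : A} (h : g * g' = 1) (h' : g' * g = 1) :
    IsBigrading fun x => g * π x * g' := by
  have key : ∀ x y, g * π x * g' * (g * π y * g') = g * (π x * π y) * g' := fun x y => by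
    rw [show g * π x * g' * (g * π y * g') = g * π x * (g' * g) * π y * g' by noncomm_ring, h']
    noncomm_ring
  have hfin : (Function.support fun x => g * π x * g').Finite :=
    hπ.finite.subset fun x hx h0 => hx (by simp [h0])
  refine ⟨fun x y hxy => by rw [key, hπ.orth x y hxy]; simp, fun x => by rw [key, hπ.idem],
    hfin, ?_⟩
  rw [finsum_eq_sum_of_support_subset (s := hπ.finite.toFinset), ← Finset.sum_mul,
    ← Finset.mul_sum, hπ.sum_finset, mul_one, h]
  intro x hx
  rw [Set.Finite.coe_toFinset]
  exact fun h0 => hx (by simp [h0])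

theorem IsBigrading.mult_conj (hπ : IsBigrading π) {g g' : A} (h : g * g' = 1) (h' : g' * g = 1)
    (m : ℤ × ℤ → ℂ) (X : A) :
    mult (fun x => g * π x * g') m (g * X * g') = g * mult π m X * g' := by
  symm
  refine (hπ.conj h h').mult_unique fun x y => ?_
  have key : ∀ Y, g * π x * g' * (g * Y * g') * (g * π y * g') = g * (π x * Y * π y) * g' :=
    fun Y => by
      rw [show g * π x * g' * (g * Y * g') * (g * π y * g') =
        g * π x * (g' * g) * Y * (g' * g) * π y * g' by noncomm_ring, h']
      noncomm_ring
  rw [key, key, hπ.mult_entry, mul_smul_comm, smul_mul_assoc]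

theorem IsBigrading.conj_mem_LamN (hπ : IsBigrading π) {g g' X : A} {n : ℕ}
    (hg : g - 1 ∈ LamN π 2) (hg' : g' - 1 ∈ LamN π 2) (hX : X ∈ LamN π n) :
    g * X * g' ∈ LamN π n := by
  rw [show g * X * g' = X + (g - 1) * X + X * (g' - 1) + (g - 1) * X * (g' - 1) by noncomm_ring]
  have h1 : (g - 1) * X ∈ LamN π n := LamN_anti π n.le_succ (hπ.mul_mem_left hg hX)
  exact add_mem (add_mem (add_mem hX h1) (LamN_anti π n.le_succ (hπ.mul_mem_right hX hg')))
    (LamN_anti π n.le_succ (hπ.mul_mem_right h1 hg'))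

theorem mem_LamN_conj {g g' X : A} {n : ℕ} (h' : g' * g = 1) :
    g * X * g' ∈ LamN (fun x => g * π x * g') n ↔ X ∈ LamN π n := by
  have key : ∀ x y, g * π x * g' * (g * X * g') * (g * π y * g') = g * (π x * X * π y) * g' :=
    fun x y => by
      rw [show g * π x * g' * (g * X * g') * (g * π y * g') =
        g * π x * (g' * g) * X * (g' * g) * π y * g' by noncomm_ring, h']
      noncomm_ring
  refine ⟨fun hX x y hxy => ?_, fun hX x y hxy => ?_⟩
  · have := hX x y hxy
    rw [key] at this
    rw [show π x * X * π y = (g' * g) * (π x * X * π y) * (g' * g) by simp [h'],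
      show (g' * g) * (π x * X * π y) * (g' * g) = g' * (g * (π x * X * π y) * g') * g by
        noncomm_ring, this]
    simp
  · rw [key, hX x y hxy]
    simp

theorem IsBigrading.LamN_conj_eq (hπ : IsBigrading π) {g g' : A} (n : ℕ) (h : g * g' = 1)
    (h' : g' * g = 1) (hg : g - 1 ∈ LamN π 2) (hg' : g' - 1 ∈ LamN π 2) :
    LamN (fun x => g * π x * g') n = LamN π n := by
  ext X
  have hX : X = g * (g' * X * g) * g' := by
    rw [show g * (g' * X * g) * g' = (g * g') * X * (g * g') by noncomm_ring, h]
    simp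
  constructor
  · intro hX'
    rw [hX, mem_LamN_conj h'] at hX'
    rw [hX]
    exact hπ.conj_mem_LamN hg hg' hX'
  · intro hX'
    rw [hX, mem_LamN_conj h']
    exact hπ.conj_mem_LamN hg' hg hX'

/-- Decomposition of `mult` into components. -/
theorem IsBigrading.finsum_mult (hπ : IsBigrading π) {ι : Type*} {f : ι → ℤ × ℤ}
    (hf : Function.Injective f) (c : ι → ℂ) (m : ℤ × ℤ → ℂ) (hm : ∀ i, m (f i) = c i)
    (hm' : ∀ d ∉ Set.range f, m d = 0) (X : A) :
    ∑ᶠ i, c i • mult π (fun d => if d = f i then 1 else 0) X = mult π m X := by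
  have hfin : (Function.support fun i => c i • mult π (fun d => if d = f i then 1 else 0) X).Finite := by
    refine (((hπ.finite.prod hπ.finite).image fun z => z.1 - z.2).preimage
      hf.injOn).subset fun i hi => ?_
    by_contra hne
    refine hi ?_
    have : mult π (fun d => if d = f i then 1 else 0) X = 0 := by
      rw [hπ.mult_eq_sum]
      refine Finset.sum_eq_zero fun z hz => ?_
      rw [if_neg, zero_smul]
      intro h
      refine hne ⟨z, ?_, h⟩
      simpa using hz
    simp [this]
  rw [finsum_eq_sum _ hfin]
  refine hπ.mult_unique fun x y => ?_
  rw [Finset.mul_sum, Finset.sum_mul]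
  simp_rw [mul_smul_comm, smul_mul_assoc, hπ.mult_entry]
  by_cases hr : x - y ∈ Set.range f
  · obtain ⟨i, hi⟩ := hr
    rw [Finset.sum_eq_single i]
    · rw [← hi, hm]
      simp
    · intro j _ hj
      rw [if_neg fun h => hj (hf (h.symm.trans hi.symm)), zero_smul, smul_zero]
    · intro h
      have h0 : c i • mult π (fun d => if d = f i then 1 else 0) X = 0 := by
        rwa [Set.Finite.mem_toFinset, Function.notMem_support] at h
      have := hπ.mult_entry (fun d => if d = f i then 1 else 0) X x y
      rw [← this, ← smul_mul_assoc, ← mul_smul_comm, h0]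
      simp
  · rw [hm' _ hr, zero_smul]
    refine Finset.sum_eq_zero fun i _ => ?_
    rw [if_neg fun h => hr ⟨i, h.symm⟩, zero_smul, smul_zero]

end Ring

/-! ### The action of automorphisms on the bigrading -/

section

variable {E : Type*} [NormedAddCommGroup E] [NormedSpace ℂ E]

theorem act_mul (g h : E →L[ℂ] E) (F : ℤ → Submodule ℂ E) : act (g * h) F = act g (act h F) := by
  funext p
  simp only [act]
  rw [← Submodule.map_comp]
  rfl

theorem act_one (F : ℤ → Submodule ℂ E) : act 1 F = F := by
  funext p
  simp only [act]
  exact Submodule.map_id _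

theorem injective_of_mul_eq_one {g g' : E →L[ℂ] E} (h : g' * g = 1) : Function.Injective g :=
  Function.LeftInverse.injective (g := g') fun v => DFunLike.congr_fun h v

namespace Datum

variable {D : Datum E} {F : ℤ → Submodule ℂ E}

variable [FiniteDimensional ℂ E]

theorem conjSub_map (g : E →L[ℂ] E) (P : Submodule ℂ E) :
    D.conjSub (P.map (g : E →ₗ[ℂ] E)) = (D.conjSub P).map (D.bar g : E →ₗ[ℂ] E) := by
  ext v
  rw [mem_conjSub, Submodule.mem_map, Submodule.mem_map]
  constructor
  · rintro ⟨u, hu, h⟩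
    refine ⟨D.conj u, by rwa [mem_conjSub, D.conj_conj], ?_⟩
    change D.bar g (D.conj u) = v
    rw [bar_conj]
    change D.conj ((g : E →ₗ[ℂ] E) u) = v
    rw [h, D.conj_conj]
  · rintro ⟨u, hu, rfl⟩
    exact ⟨D.conj u, hu, by
      change g (D.conj u) = D.conj (D.bar g u)
      rw [bar_apply, D.conj_conj]⟩

theorem opp_act {g : E →L[ℂ] E} (hg : Function.Injective (D.bar g))
    (hW : ∀ k, (D.W k).map (D.bar g : E →ₗ[ℂ] E) = D.W k) (p w : ℤ) :
    D.opp (act g F) p w = (D.opp F p w).map (D.bar g : E →ₗ[ℂ] E) := by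
  simp only [opp, act, Submodule.map_iSup]
  refine iSup_congr fun k => iSup_congr fun _ => ?_
  rw [conjSub_map, Submodule.map_inf _ hg, hW]

theorem pre_act {g : E →L[ℂ] E} (hg : Function.Injective (D.bar g))
    (hW : ∀ k, (D.W k).map (D.bar g : E →ₗ[ℂ] E) = D.W k) (p q : ℤ) :
    D.pre (act g F) p q = (D.pre F p q).map (D.bar g : E →ₗ[ℂ] E) := by
  rw [pre, opp_act hg hW, pre, Submodule.map_sup, Submodule.map_inf _ hg, hW, act, conjSub_map]

/-- The bigrading of `act g F` is the image of that of `F`. -/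
def Moves (D : Datum E) (g : E →L[ℂ] E) (F : ℤ → Submodule ℂ E) : Prop :=
  ∀ p q, D.bigr (act g F) p q = (D.bigr F p q).map (g : E →ₗ[ℂ] E)

/-- A real `g` moves `F` and `conj F` alike and fixes `W`, hence carries every ingredient of
Deligne's formula along. -/
theorem moves_of_real {g g' : E →L[ℂ] E} (h' : g' * g = 1) (hr : D.IsReal g)
    (hW : ∀ k, (D.W k).map (g : E →ₗ[ℂ] E) = D.W k) : D.Moves g F := by
  have hb : D.bar g = g := D.isReal_iff.1 hr
  have hi := injective_of_mul_eq_one h'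
  intro p q
  rw [bigr_eq, pre_act (by rwa [hb]) (by rwa [hb]), hb, bigr_eq]
  exact (Submodule.map_inf (g : E →ₗ[ℂ] E) hi).symm

namespace Decomposes

variable (hF : D.Decomposes F)
include hF

theorem act {g g' : E →L[ℂ] E} (h : g * g' = 1) (h' : g' * g = 1) (hm : D.Moves g F) :
    D.Decomposes (act g F) := by
  let e : E ≃ₗ[ℂ] E := LinearEquiv.ofLinearMap (g : E →ₗ[ℂ] E) (g' : E →ₗ[ℂ] E)
    (by ext v; exact DFunLike.congr_fun h v) (by ext v; exact DFunLike.congr_fun h' v)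
  have he : ∀ x : ℤ × ℤ, D.bigr (MixedHodge.act g F) x.1 x.2 =
      Submodule.orderIsoMapComap e (D.bigr F x.1 x.2) := fun x => hm x.1 x.2
  refine ⟨?_, ?_⟩
  · simp_rw [he]
    exact hF.1.map_orderIso (Submodule.orderIsoMapComap e)
  · simp_rw [he]
    rw [← OrderIso.map_iSup, hF.2, OrderIso.map_top]

theorem pr_act {g g' : E →L[ℂ] E} (h : g * g' = 1) (h' : g' * g = 1) (hm : D.Moves g F)
    (x : ℤ × ℤ) : D.pr (MixedHodge.act g F) x = g * D.pr F x * g' := by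
  have hF' := hF.act h h' hm
  refine hF'.ext fun y v hv => ?_
  have hv' := hv
  rw [hm] at hv'
  obtain ⟨u, hu, rfl⟩ := hv'
  have hgu : g' (g u) = u := DFunLike.congr_fun h' u
  change _ = g (D.pr F x (g' (g u)))
  rw [hgu]
  by_cases hxy : y = x
  · subst hxy
    rw [hF'.pr_of_mem hv, hF.pr_of_mem hu]
    rfl
  · rw [hF'.pr_of_mem_ne hxy hv, hF.pr_of_mem_ne hxy hu, map_zero]

/-- Hodge components, `qPart` and `slC` all become block multipliers, so that equivariance and norm
formulas need only one proof. -/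
theorem comp_eq_mult (X : E →L[ℂ] E) (p q : ℤ) :
    D.comp F X p q = mult (D.pr F) (fun d => if d = (p, q) then 1 else 0) X := by
  have hπ := hF.isBigrading
  have hfin : (Function.support fun x : ℤ × ℤ =>
      D.proj F (x.1 + p) (x.2 + q) * X * D.proj F x.1 x.2).Finite :=
    hπ.finite.subset fun x hx h => hx (by
      change D.pr F (x + (p, q)) * X * D.pr F x = 0
      rw [h, mul_zero])
  have hcomp : D.comp F X p q = ∑ x ∈ hfin.toFinset, D.pr F (x + (p, q)) * X * D.pr F x :=
    finsum_eq_sum _ hfin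
  refine hπ.mult_unique fun x y => ?_
  rw [hcomp, Finset.mul_sum, Finset.sum_mul]
  simp_rw [hπ.entry_block]
  by_cases hxy : x - y = (p, q)
  · have hx : x = y + (p, q) := by rw [← hxy]; abel
    rw [if_pos hxy, one_smul, Finset.sum_eq_single y]
    · simp [hx]
    · intro z _ hz
      rw [if_neg]
      exact fun h => hz h.2.symm
    · intro h
      have h0 : D.pr F (y + (p, q)) * X * D.pr F y = 0 := by
        by_contra hne
        exact h ((Set.Finite.mem_toFinset _).2 hne)
      rw [hx, h0]
      simp
  · rw [if_neg hxy, zero_smul]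
    refine Finset.sum_eq_zero fun z _ => ?_
    rw [if_neg]
    rintro ⟨rfl, rfl⟩
    exact hxy (by abel)

theorem qPart_eq_mult (X : E →L[ℂ] E) :
    D.qPart F X = mult (D.pr F) (fun d => if d.1 < 0 ∧ d.1 + d.2 ≤ 0 then 1 else 0) X := by
  rw [← hF.isBigrading.finsum_mult (f := id) Function.injective_id
    (fun d => if d.1 < 0 ∧ d.1 + d.2 ≤ 0 then 1 else 0) _ (fun _ => rfl) (by simp)]
  refine finsum_congr fun d => ?_
  rw [finsum_eq_if, hF.comp_eq_mult]
  split_ifs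
  · rw [one_smul]
    rfl
  · rw [zero_smul]

end Decomposes

end Datum

end

/-! ### Unipotent elements and Deligne's `δ` -/

namespace Datum

variable {E : Type*} [NormedAddCommGroup E] [NormedSpace ℂ E] [FiniteDimensional ℂ E]

variable {D : Datum E} {F : ℤ → Submodule ℂ E}

theorem Decomposes.apply_mem_bigrSet (hF : D.Decomposes F) {s : Set (ℤ × ℤ)}
    (hs : ∀ x y, Below x y → y ∈ s → x ∈ s) {X : E →L[ℂ] E} (hX : X ∈ LamN (D.pr F) 2) {v : E}
    (hv : v ∈ D.bigrSet F s) : X v ∈ D.bigrSet F s := by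
  rw [hF.mem_bigrSet_iff] at hv ⊢
  intro x hx
  have : D.pr F x * X = ∑ y ∈ hF.isBigrading.finite.toFinset, D.pr F x * X * D.pr F y := by
    rw [← Finset.mul_sum, hF.isBigrading.sum_finset, mul_one]
  change (D.pr F x * X) v = 0
  rw [this, sum_apply]
  refine Finset.sum_eq_zero fun y _ => ?_
  by_cases hy : y ∈ s
  · rw [mem_LamN_two.1 hX x y fun h => hx (hs x y h hy)]
    rfl
  · change (D.pr F x * X) (D.pr F y v) = 0
    rw [hv y hy, map_zero]

theorem Decomposes.map_exp_bigrSet (hF : D.Decomposes F) {s : Set (ℤ × ℤ)}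
    (hs : ∀ x y, Below x y → y ∈ s → x ∈ s) {X : E →L[ℂ] E} (hX : X ∈ LamN (D.pr F) 2) :
    (D.bigrSet F s).map ((NormedSpace.exp X : E →L[ℂ] E) : E →ₗ[ℂ] E) = D.bigrSet F s := by
  have key : ∀ Y ∈ LamN (D.pr F) 2, ∀ v ∈ D.bigrSet F s,
      (NormedSpace.exp Y : E →L[ℂ] E) v ∈ D.bigrSet F s := fun Y hY v hv => by
    have := add_mem (hF.apply_mem_bigrSet hs (hF.isBigrading.exp_sub_one_mem hY) hv) hv
    simpa using this
  refine le_antisymm (Submodule.map_le_iff_le_comap.2 fun v hv => key X hX v hv) fun v hv => ?_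
  exact ⟨_, key _ (neg_mem hX) v hv, DFunLike.congr_fun (exp_mul_exp_neg X) v⟩

theorem exp_sub_one_mem {X : E →L[ℂ] E} (hF : D.Decomposes F) (hX : X ∈ LamN (D.pr F) 2) :
    NormedSpace.exp X - 1 ∈ LamN (D.pr F) 2 := hF.isBigrading.exp_sub_one_mem hX

namespace IsGradedPolarizedMHS

variable (hF : D.IsGradedPolarizedMHS F)
include hF

theorem map_exp_W {X : E →L[ℂ] E} (hX : X ∈ LamN (D.pr F) 2) (k : ℤ) :
    (D.W k).map ((NormedSpace.exp X : E →L[ℂ] E) : E →ₗ[ℂ] E) = D.W k := by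
  rw [hF.W_eq]
  refine hF.decomposes.map_exp_bigrSet (fun x y h hy => ?_) hX
  have h1 := h.1
  have h2 := h.2
  simp only [Set.mem_ofPred_eq] at hy ⊢
  omega

theorem map_exp_pre {X : E →L[ℂ] E} (hX : X ∈ LamN (D.pr F) 2) (p q : ℤ) :
    (D.pre F p q).map ((NormedSpace.exp X : E →L[ℂ] E) : E →ₗ[ℂ] E) = D.pre F p q := by
  rw [hF.pre_eq_bigrSet]
  refine hF.decomposes.map_exp_bigrSet (fun x y h hy => Or.inr ?_) hX
  obtain ⟨h1, h2⟩ := h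
  rcases hy with rfl | ⟨h3, h4⟩
  · exact ⟨h1, by omega⟩
  · exact ⟨by omega, by omega⟩

/-- `I^{p,q} = F^p ∩ pre`, and `pre` is moved by the conjugate of `e^X`. Both `e^X` and its
conjugate stabilize `pre`, so its change is the same as under `e^X`. -/
theorem moves_exp {X : E →L[ℂ] E} (hX : X ∈ LamN (D.pr F) 2) : D.Moves (NormedSpace.exp X) F := by
  have hX' := hF.bar_mem_LamN.2 hX
  intro p q
  rw [bigr_eq, pre_act, D.bar_exp, hF.map_exp_pre hX', ← hF.map_exp_pre hX, bigr_eq]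
  · exact (Submodule.map_inf _ (injective_of_mul_eq_one (exp_neg_mul_exp X))).symm
  · rw [D.bar_exp]
    exact injective_of_mul_eq_one (exp_neg_mul_exp _)
  · rw [D.bar_exp]
    exact hF.map_exp_W hX'

/-- The unipotent element carrying the bigrading to its complex conjugate. -/
theorem bar_carrier_mul : D.bar (carrier (D.pr F) (D.prBar F)) * carrier (D.pr F) (D.prBar F) = 1 := by
  have hπ := hF.decomposes.isBigrading
  have hπ' := hF.decomposes.isBigrading_prBar
  set u := carrier (D.pr F) (D.prBar F) with hu
  have h1 : u - 1 ∈ LamN (D.pr F) 2 := hπ.carrier_sub_one_mem hπ' hF.near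
  have hint : ∀ x, u * D.pr F x = D.prBar F x * u := fun x => by
    rw [hu, hπ.carrier_mul, hπ.mul_carrier hπ']
  -- The product is unipotent, and it commutes with every projection: `u` carries `π` to its
  -- conjugate and `D.bar u` carries it back.
  refine hπ.eq_one_of_commute (hπ.mul_sub_one_mem ?_ h1) fun x => ?_
  · rw [← map_one D.bar, ← map_sub]
    exact hF.bar_mem_LamN.2 h1
  · have h2 : D.bar u * D.prBar F x = D.pr F x * D.bar u := by
      have := congrArg D.bar (hint x.swap)
      rw [map_mul, map_mul, prBar, Prod.swap_swap, D.bar_bar] at this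
      exact this
    rw [mul_assoc, hint, ← mul_assoc, h2, mul_assoc]

/-- For `X = -iδ` with `δ` real, conjugation sends `X` to `-X`. Splitting then says that `e^{2X}`
intertwines the bigrading with its conjugate, and a unipotent intertwiner is unique. -/
theorem isSplit_exp_iff {δ : E →L[ℂ] E} (hδ : δ ∈ LamN (D.pr F) 2) (hr : D.bar δ = δ) :
    D.IsSplit (act (NormedSpace.exp (-(Complex.I • δ))) F) ↔
      NormedSpace.exp ((2 : ℂ) • -(Complex.I • δ)) = carrier (D.pr F) (D.prBar F) := by
  have hπ := hF.decomposes.isBigrading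
  have hπ' := hF.decomposes.isBigrading_prBar
  set X : E →L[ℂ] E := -(Complex.I • δ) with hX
  have hXm : X ∈ LamN (D.pr F) 2 := neg_mem (Submodule.smul_mem _ _ hδ)
  have hbX : D.bar X = -X := by
    rw [hX, map_neg, D.bar_smul, hr, Complex.conj_I, neg_smul]
  clear_value X
  have hm := hF.moves_exp hXm
  have h1 := exp_mul_exp_neg X
  have h2 := exp_neg_mul_exp X
  have hact := hF.decomposes.act h1 h2 hm
  rw [hact.isSplit_iff]
  have hpr := hF.decomposes.pr_act h1 h2 hm
  have hprb : ∀ x, D.prBar (act (NormedSpace.exp X) F) x =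
      NormedSpace.exp (-X) * D.prBar F x * NormedSpace.exp X := fun x => by
    rw [prBar, hpr, map_mul, map_mul, D.bar_exp, D.bar_exp, map_neg, hbX, neg_neg, prBar]
  simp_rw [hprb, hpr]
  rw [show NormedSpace.exp ((2 : ℂ) • X) = _ from (exp_mul_exp_self X).symm]
  set g := NormedSpace.exp X with hg
  set g' := NormedSpace.exp (-X) with hg'
  set u := carrier (D.pr F) (D.prBar F) with hu
  have hint : ∀ x, u * D.pr F x = D.prBar F x * u := fun x => by
    rw [hu, hπ.carrier_mul, hπ.mul_carrier hπ']
  constructor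
  · intro h
    have hc : ∀ x, D.prBar F x * (g * g) = g * g * D.pr F x := fun x => by
      rw [show D.prBar F x * (g * g) = (g * g') * D.prBar F x * g * g by rw [h1, one_mul]; rfl,
        show (g * g') * D.prBar F x * g * g = g * (g' * D.prBar F x * g) * g by noncomm_ring, h,
        show g * (g * D.pr F x * g') * g = g * g * D.pr F x * (g' * g) by noncomm_ring, h2, mul_one]
    have hu1 : u - 1 ∈ LamN (D.pr F) 2 := hπ.carrier_sub_one_mem hπ' hF.near
    have hg1 : g - 1 ∈ LamN (D.pr F) 2 := hπ.exp_sub_one_mem hXm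
    have hbu : D.bar u * (g * g) = 1 := by
      refine hπ.eq_one_of_commute (hπ.mul_sub_one_mem ?_ (hπ.mul_sub_one_mem hg1 hg1)) fun x => ?_
      · rw [← map_one D.bar, ← map_sub]
        exact hF.bar_mem_LamN.2 hu1
      · have h2 : D.bar u * D.prBar F x = D.pr F x * D.bar u := by
          have := congrArg D.bar (hint x.swap)
          rw [map_mul, map_mul, prBar, Prod.swap_swap, D.bar_bar] at this
          exact this
        rw [mul_assoc, ← hc, ← mul_assoc, h2, mul_assoc]
    have huu : u * D.bar u = 1 := by
      have := congrArg D.bar hF.bar_carrier_mul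
      rwa [map_mul, D.bar_bar, map_one] at this
    calc g * g = u * D.bar u * (g * g) := by rw [huu, one_mul]
      _ = u * (D.bar u * (g * g)) := mul_assoc _ _ _
      _ = u := by rw [hbu, mul_one]
  · intro h x
    have := hint x
    rw [← h] at this
    calc g' * D.prBar F x * g = g' * (D.prBar F x * (g * g)) * g' := by
          rw [show g' * (D.prBar F x * (g * g)) * g' = g' * D.prBar F x * g * (g * g') by
            noncomm_ring, h1, mul_one]
      _ = g * D.pr F x * g' := by
          rw [← this, show g' * (g * g * D.pr F x) * g' = (g' * g) * g * D.pr F x * g' by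
            noncomm_ring, h2, one_mul]

theorem isDelta_iff {δ : E →L[ℂ] E} : D.IsDelta F δ ↔ δ ∈ LamN (D.pr F) 2 ∧ D.bar δ = δ ∧
      NormedSpace.exp ((2 : ℂ) • -(Complex.I • δ)) = carrier (D.pr F) (D.prBar F) := by
  rw [IsDelta, hF.decomposes.mem_Lam_iff, D.isReal_iff]
  exact and_congr_right fun h => and_congr_right fun h' => hF.isSplit_exp_iff h h'

/-- The solution is `δ = (i/2) log u` with `u` the intertwiner; it is real because `bar u = u⁻¹`.
Uniqueness is that of the logarithm. -/
theorem existsUnique_isDelta : ∃! δ, D.IsDelta F δ := by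
  have hπ := hF.decomposes.isBigrading
  have hπ' := hF.decomposes.isBigrading_prBar
  set u := carrier (D.pr F) (D.prBar F) with hu
  have hu1 : u - 1 ∈ LamN (D.pr F) 2 := hπ.carrier_sub_one_mem hπ' hF.near
  obtain ⟨L, ⟨hL, hLu⟩, hLuniq⟩ := hπ.existsUnique_log hu1
  have hbL : D.bar L = -L := by
    refine hπ.exp_injOn (hF.bar_mem_LamN.2 hL) (neg_mem hL) ?_
    rw [← D.bar_exp, hLu]
    calc D.bar u = D.bar u * (u * NormedSpace.exp (-L)) := by rw [← hLu, exp_mul_exp_neg, mul_one]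
      _ = NormedSpace.exp (-L) := by rw [← mul_assoc, hF.bar_carrier_mul, one_mul]
  have hcoef : ∀ X : E →L[ℂ] E, (2 : ℂ) • -(Complex.I • (Complex.I / 2) • X) = X := fun X => by
    rw [smul_smul, ← neg_smul, smul_smul, show (2 : ℂ) * -(Complex.I * (Complex.I / 2)) = 1 by
      ring_nf; simp, one_smul]
  refine ⟨(Complex.I / 2) • L, ?_, fun δ hδ => ?_⟩
  · refine hF.isDelta_iff.2 ?_
    refine ⟨Submodule.smul_mem _ _ hL, ?_, by rw [hcoef, hLu]⟩
    rw [D.bar_smul, hbL, smul_neg, ← neg_smul]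
    congr 1
    rw [map_div₀, Complex.conj_I, map_ofNat, neg_div, neg_neg]
  · replace hδ := hF.isDelta_iff.1 hδ
    have := hLuniq _ ⟨Submodule.smul_mem _ 2 (neg_mem (Submodule.smul_mem _ Complex.I hδ.1)), hδ.2.2⟩
    rw [← this]
    have := hcoef δ
    rw [smul_neg, smul_smul, smul_neg, smul_smul, ← neg_smul]
    conv_lhs => rw [← one_smul ℂ δ]
    congr 1
    ring_nf
    simp

end IsGradedPolarizedMHS

/-! ### Bounds for the universal polynomials -/

/-- `slC` as a multiplier. -/
def slM (l : ℕ) (d : ℤ × ℤ) : ℂ :=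
  if d.1 < 0 ∧ d.2 < 0 then
    Complex.I * (((1 - Polynomial.X) ^ (-d.1 - 1).toNat * (1 + Polynomial.X) ^ (-d.2 - 1).toNat :
      Polynomial ℤ).coeff l : ℂ)
  else 0

namespace Decomposes

variable (hF : D.Decomposes F)
include hF

theorem slC_eq_mult (η : E →L[ℂ] E) (l : ℕ) : D.slC F η l = mult (D.pr F) (slM l) η := by
  have hinj : Function.Injective fun x : ℕ × ℕ => (-((x.1 : ℤ) + 1), -((x.2 : ℤ) + 1)) := by
    rintro ⟨a, b⟩ ⟨c, d⟩ h
    simp only [Prod.mk.injEq, neg_inj, add_left_inj, Nat.cast_inj] at h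
    ext
    exacts [h.1, h.2]
  have := hF.isBigrading.finsum_mult hinj
    (fun x => (((1 - Polynomial.X) ^ x.1 * (1 + Polynomial.X) ^ x.2 : Polynomial ℤ).coeff l : ℂ))
    (fun d => -Complex.I * slM l d) (fun x => by
      have h1 : (-(-((x.1 : ℤ) + 1)) - 1).toNat = x.1 := by omega
      have h2 : (-(-((x.2 : ℤ) + 1)) - 1).toNat = x.2 := by omega
      have h3 : (-((x.1 : ℤ) + 1) < 0 ∧ -((x.2 : ℤ) + 1) < 0) := ⟨by omega, by omega⟩
      simp only [slM]
      rw [if_pos h3, h1, h2, ← mul_assoc, neg_mul, Complex.I_mul_I, neg_neg, one_mul])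
    (fun d hd => by
      rw [slM, if_neg, mul_zero]
      rintro ⟨h1, h2⟩
      refine hd ⟨((-d.1 - 1).toNat, (-d.2 - 1).toNat), ?_⟩
      ext <;> simp only <;> omega) η
  rw [slC]
  simp_rw [hF.comp_eq_mult]
  rw [this]
  refine hF.isBigrading.mult_unique fun x y => ?_
  rw [mul_smul_comm, smul_mul_assoc, hF.isBigrading.mult_entry, smul_smul, ← mul_assoc, mul_neg,
    Complex.I_mul_I, neg_neg, one_mul]

/-- `b^l_{p-1,q-1}` vanishes for `l > p + q - 2`, the degree of the polynomial, so only types with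
`p + q ≥ l + 2` occur. -/
theorem slC_mem {η : E →L[ℂ] E} (hη : η ∈ LamN (D.pr F) 2) (l : ℕ) :
    D.slC F η l ∈ LamN (D.pr F) (l + 2) := by
  intro x y hxy
  rw [hF.slC_eq_mult, hF.isBigrading.mult_entry]
  by_cases hb : Below x y
  · obtain ⟨h1, h2⟩ := hb
    have : slM l (x - y) = 0 := by
      rw [slM, if_pos ⟨sub_neg.2 h1, sub_neg.2 h2⟩, Polynomial.coeff_eq_zero_of_natDegree_lt]
      · simp
      · refine (Polynomial.natDegree_mul_le_of_le (m := (-(x - y).1 - 1).toNat)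
          (n := (-(x - y).2 - 1).toNat) ?_ ?_).trans_lt ?_
        · compute_degree
          simp only [Prod.fst_sub]
          omega
        · compute_degree
          simp only [Prod.snd_sub]
          omega
        · rw [not_and, not_le] at hxy
          have := hxy ⟨h1, h2⟩
          simp only [Prod.fst_sub, Prod.snd_sub]
          push_cast at this
          omega
    rw [this, zero_smul]
  · rw [mem_LamN_two.1 hη x y hb, smul_zero]

theorem slC_sub (η η' : E →L[ℂ] E) (l : ℕ) :
    D.slC F η l - D.slC F η' l = D.slC F (η - η') l := by
  simp_rw [hF.slC_eq_mult, hF.isBigrading.mult_sub]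

theorem slC_mem' {n : ℕ} {η : E →L[ℂ] E} (hη : η ∈ LamN (D.pr F) n) (l : ℕ) :
    D.slC F η l ∈ LamN (D.pr F) n := by
  rw [hF.slC_eq_mult]
  exact hF.isBigrading.mult_mem hη

omit hF in
theorem slP_succ (η : E →L[ℂ] E) (k : ℕ) : D.slP F η (k + 1) = (-(1 / ((k : ℂ) + 1))) •
    (∑ j ∈ Finset.range k, D.slP F η (k - j) * D.slC F η j + D.slC F η k) := by
  rw [slP, Fin.sum_univ_eq_sum_range (fun j => D.slP F η (k - j) * D.slC F η j) (k + 1),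
    Finset.sum_range_succ, Nat.sub_self, slP, one_mul]

theorem slP_mem {η : E →L[ℂ] E} (hη : η ∈ LamN (D.pr F) 2) (k : ℕ) :
    D.slP F η (k + 1) ∈ LamN (D.pr F) (k + 2) := by
  induction k using Nat.strong_induction_on with
  | _ k ih =>
    rw [slP_succ]
    refine Submodule.smul_mem _ _ (add_mem (sum_mem fun j hj => ?_) (hF.slC_mem hη k))
    have hj' := Finset.mem_range.1 hj
    have h1 := ih (k - j - 1) (by omega)
    rw [show k - j - 1 + 1 = k - j by omega] at h1
    exact LamN_anti _ (by omega) (hF.isBigrading.mul_mem h1 (hF.slC_mem hη j))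

/-- Only the term `P_0 C` of the recursion is linear in `η`; the other products have two factors
from `Λ^{-1,-1}`, so their differences gain a level. -/
theorem slP_sub_mem {n : ℕ} {η η' : E →L[ℂ] E} (hη : η ∈ LamN (D.pr F) 2)
    (hη' : η' ∈ LamN (D.pr F) 2) (h : η - η' ∈ LamN (D.pr F) n) (k : ℕ) :
    D.slP F η (k + 1) - D.slP F η' (k + 1) + (1 / ((k : ℂ) + 1)) • D.slC F (η - η') k ∈
      LamN (D.pr F) (n + 1) := by
  induction k using Nat.strong_induction_on with
  | _ k ih =>
    rw [slP_succ, slP_succ, ← hF.slC_sub]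
    have : ∀ (a : ℂ) (S S' T T' : E →L[ℂ] E), (-a) • (S + T) - (-a) • (S' + T') + a • (T - T') =
      (-a) • (S - S') := fun a S S' T T' => by module
    rw [this, ← Finset.sum_sub_distrib]
    refine Submodule.smul_mem _ _ (sum_mem fun j hj => ?_)
    have hj' := Finset.mem_range.1 hj
    have h1 := hF.slP_mem hη (k - j - 1)
    have h2 := ih (k - j - 1) (by omega)
    rw [show k - j - 1 + 1 = k - j by omega] at h1 h2
    rw [show ∀ a a' b b' : E →L[ℂ] E, a * b - a' * b' = a * (b - b') + (a - a') * b' by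
      intros; noncomm_ring, hF.slC_sub]
    refine add_mem (hF.isBigrading.mul_mem_left (LamN_le_two _ _ h1) (hF.slC_mem' h j))
      (hF.isBigrading.mul_mem_right ?_ (hF.slC_mem' hη' j))
    have h3 := sub_mem (LamN_anti _ n.le_succ h2)
      (Submodule.smul_mem _ (1 / (((k - j - 1 : ℕ) : ℂ) + 1)) (hF.slC_mem' h (k - j - 1)))
    simpa using h3

end Decomposes

end Datum

/-- The integral `∫₀¹ (1 - x)^m (1 + x)^n dx`. -/
def betaInt (m n : ℕ) : ℝ := ∫ x in (0 : ℝ)..1, (1 - x) ^ m * (1 + x) ^ n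

/-- This positivity is what makes the equation for `η` solvable. -/
theorem betaInt_pos (m n : ℕ) : 0 < betaInt m n := by
  refine intervalIntegral.intervalIntegral_pos_of_pos_on (Continuous.intervalIntegrable
    (by fun_prop) _ _) (fun x hx => ?_) one_pos
  have h1 := hx.1
  have h2 := sub_pos.2 hx.2
  positivity

/-- Integrate the polynomial termwise; the weights `1 / (k + 1)` are those of the linear terms of
the `P_{k+1}`. -/
theorem sum_coeff_eq_betaInt {m n N : ℕ} (h : m + n < N) :
    ∑ k ∈ Finset.range N, (((1 - Polynomial.X) ^ m * (1 + Polynomial.X) ^ n :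
      Polynomial ℤ).coeff k : ℝ) / (k + 1) = betaInt m n := by
  set p : Polynomial ℤ := (1 - Polynomial.X) ^ m * (1 + Polynomial.X) ^ n with hp
  have hdeg : p.natDegree < N := by
    refine lt_of_le_of_lt (Polynomial.natDegree_mul_le_of_le (m := m) (n := n) ?_ ?_) h
    · compute_degree
    · compute_degree
  have heval : ∀ x : ℝ, (1 - x) ^ m * (1 + x) ^ n =
      ∑ k ∈ Finset.range N, (p.coeff k : ℝ) * x ^ k := fun x => by
    have h1 : (p.map (Int.castRingHom ℝ)).eval x = (1 - x) ^ m * (1 + x) ^ n := by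
      simp [hp]
    rw [← h1, Polynomial.eval_eq_sum_range' (Polynomial.natDegree_map_le.trans_lt hdeg)]
    simp
  rw [betaInt]
  simp_rw [heval]
  rw [intervalIntegral.integral_finsetSum fun k _ =>
    Continuous.intervalIntegrable (by fun_prop) _ _]
  refine Finset.sum_congr rfl fun k _ => ?_
  rw [intervalIntegral.integral_const_mul, integral_pow]
  simp
  ring

/-! ### Solving the equation for `η` -/

namespace Datum

variable {E : Type*} [NormedAddCommGroup E] [NormedSpace ℂ E] [FiniteDimensional ℂ E]

variable {D : Datum E} {F : ℤ → Submodule ℂ E}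

/-- The leading coefficients of `∑ P_k`. -/
def slBeta (d : ℤ × ℤ) : ℝ := betaInt (-d.1 - 1).toNat (-d.2 - 1).toNat

namespace Decomposes

variable (hF : D.Decomposes F)
include hF

/-- A single `N` truncates the sum of the `P_k`, since `P_{k+1}` lies ever deeper in the filtration,
and is large enough to collect the complete linear part, which is `-i` times the multiplier
`slBeta`. -/
theorem exists_bound : ∃ N : ℕ, LamN (D.pr F) N = ⊥ ∧
    (∀ η ∈ LamN (D.pr F) 2, ∑ᶠ k, D.slP F η k = 1 + ∑ k ∈ Finset.range N, D.slP F η (k + 1)) ∧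
    ∀ θ ∈ LamN (D.pr F) 2, ∑ k ∈ Finset.range N, (1 / ((k : ℂ) + 1)) • D.slC F θ k =
      Complex.I • mult (D.pr F) (fun d => (slBeta d : ℂ)) θ := by
  have hπ := hF.isBigrading
  obtain ⟨N, hN⟩ := hπ.exists_LamN_eq_bot
  refine ⟨N, hN N le_rfl, fun η hη => ?_, fun θ hθ => ?_⟩
  · rw [finsum_eq_sum_of_support_subset (s := Finset.range (N + 1)), Finset.sum_range_succ', slP,
      add_comm]
    intro k hk
    rw [Finset.coe_range, Set.mem_Iio]
    by_contra hlt
    obtain ⟨j, rfl⟩ : ∃ j, k = j + 1 := ⟨k - 1, by omega⟩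
    have := hF.slP_mem hη j
    rw [hN _ (by omega), Submodule.mem_bot] at this
    exact hk this
  · refine hπ.ext fun x y => ?_
    rw [Finset.mul_sum, Finset.sum_mul, mul_smul_comm, smul_mul_assoc, hπ.mult_entry]
    simp_rw [mul_smul_comm, smul_mul_assoc, hF.slC_eq_mult, hπ.mult_entry, smul_smul]
    rw [← Finset.sum_smul]
    by_cases h0 : D.pr F x * θ * D.pr F y = 0
    · rw [h0, smul_zero, smul_zero]
    congr 1
    have hb : Below x y := by
      by_contra hb
      exact h0 (mem_LamN_two.1 hθ x y hb)
    have hlt : y.1 + y.2 < x.1 + x.2 + N := by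
      by_contra hle
      refine h0 ?_
      have : D.pr F x * θ * D.pr F y ∈ LamN (D.pr F) N := by
        intro a b hab
        rw [hπ.entry_block, if_neg]
        rintro ⟨rfl, rfl⟩
        exact hab ⟨hb, by omega⟩
      rwa [hN N le_rfl, Submodule.mem_bot] at this
    obtain ⟨h1, h2⟩ := hb
    rw [slBeta, ← sum_coeff_eq_betaInt (N := N), Complex.ofReal_sum, Finset.mul_sum]
    · refine Finset.sum_congr rfl fun k _ => ?_
      rw [slM, if_pos ⟨sub_neg.2 h1, sub_neg.2 h2⟩]
      push_cast
      ring
    · simp only [Prod.fst_sub, Prod.snd_sub]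
      omega

theorem slSum_sub_one_mem {η : E →L[ℂ] E} (hη : η ∈ LamN (D.pr F) 2) :
    ∑ᶠ k, D.slP F η k - 1 ∈ LamN (D.pr F) 2 := by
  obtain ⟨N, -, h, -⟩ := hF.exists_bound
  rw [h η hη, add_sub_cancel_left]
  exact sum_mem fun k _ => LamN_le_two _ _ (hF.slP_mem hη k)

theorem slSum_sub_mem {n : ℕ} {η η' : E →L[ℂ] E} (hη : η ∈ LamN (D.pr F) 2)
    (hη' : η' ∈ LamN (D.pr F) 2) (h : η - η' ∈ LamN (D.pr F) n) :
    ∑ᶠ k, D.slP F η k - ∑ᶠ k, D.slP F η' k +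
      Complex.I • mult (D.pr F) (fun d => (slBeta d : ℂ)) (η - η') ∈ LamN (D.pr F) (n + 1) := by
  obtain ⟨N, -, h1, h2⟩ := hF.exists_bound
  rw [h1 η hη, h1 η' hη', ← h2 _ (LamN_le_two _ _ h), add_sub_add_left_eq_sub,
    ← Finset.sum_sub_distrib, ← Finset.sum_add_distrib]
  exact sum_mem fun k _ => hF.slP_sub_mem hη hη' h k

theorem bar_mult (hs : ∀ x, D.prBar F x = D.pr F x) (m : ℤ × ℤ → ℂ) (X : E →L[ℂ] E) :
    D.bar (mult (D.pr F) m X) = mult (D.pr F) (fun d => starRingEnd ℂ (m d.swap)) (D.bar X) := by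
  have hπ := hF.isBigrading
  have hb : ∀ x, D.pr F x = D.bar (D.pr F x.swap) := fun x => (hs x).symm
  refine hπ.mult_unique fun x y => ?_
  rw [hb x, hb y, ← map_mul, ← map_mul, hπ.mult_entry, D.bar_smul, map_mul, map_mul]
  rfl

theorem bar_mem_LamN_of_split (hs : ∀ x, D.prBar F x = D.pr F x) {n : ℕ} {X : E →L[ℂ] E}
    (hX : X ∈ LamN (D.pr F) n) : D.bar X ∈ LamN (D.pr F) n := by
  have := hF.bar_mem_LamN.2 hX
  rwa [show D.prBar F = D.pr F from funext hs] at this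

/-- Twice the imaginary part of `(∑ P_k) v`, called `Φ η`, varies to leading order as `-(β(d) +
β(d.swap))` on the component of `η` of type `d`, with nonzero coefficients. Dividing by them, `η ↦ η
+ c⁻¹ Φ η` is a contraction that preserves real elements, and its fixed points are the solutions. -/
theorem existsUnique_real_slSum (hs : ∀ x, D.prBar F x = D.pr F x) {v : E →L[ℂ] E}
    (hv : v - 1 ∈ LamN (D.pr F) 2) :
    ∃! η, (η ∈ LamN (D.pr F) 2 ∧ D.bar η = η) ∧
      D.bar ((∑ᶠ k, D.slP F η k) * v) = (∑ᶠ k, D.slP F η k) * v := by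
  have hπ := hF.isBigrading
  set c : ℤ × ℤ → ℝ := fun d => slBeta d + slBeta d.swap with hc
  have hcpos : ∀ d, 0 < c d := fun d => add_pos (betaInt_pos _ _) (betaInt_pos _ _)
  have hcne : ∀ d, (c d : ℂ) ≠ 0 := fun d => by exact_mod_cast (hcpos d).ne'
  have hcswap : ∀ d, c d.swap = c d := fun d => by rw [hc]; simp [add_comm]
  set Y : (E →L[ℂ] E) → (E →L[ℂ] E) := fun η => (∑ᶠ k, D.slP F η k) * v with hY
  set Φ : (E →L[ℂ] E) → (E →L[ℂ] E) := fun η => (-Complex.I) • (Y η - D.bar (Y η)) with hΦ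
  have hY1 : ∀ η ∈ LamN (D.pr F) 2, Y η - 1 ∈ LamN (D.pr F) 2 := fun η hη =>
    hπ.mul_sub_one_mem (hF.slSum_sub_one_mem hη) hv
  have hΦm : ∀ η ∈ LamN (D.pr F) 2, Φ η ∈ LamN (D.pr F) 2 := fun η hη => by
    have h1 := hY1 η hη
    have h2 := hF.bar_mem_LamN_of_split hs h1
    rw [map_sub, map_one] at h2
    have := sub_mem h1 h2
    rw [sub_sub_sub_cancel_right] at this
    exact Submodule.smul_mem _ _ this
  have hΦr : ∀ η, D.bar (Φ η) = Φ η := fun η => by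
    rw [hΦ]
    simp only
    rw [D.bar_smul, map_sub, D.bar_bar, map_neg, Complex.conj_I, neg_neg, ← neg_sub (Y η), smul_neg,
      neg_smul]
  have hΨ : ∀ η, D.bar (mult (D.pr F) (fun d => ((c d)⁻¹ : ℂ)) (Φ η)) =
      mult (D.pr F) (fun d => ((c d)⁻¹ : ℂ)) (Φ η) := fun η => by
    rw [hF.bar_mult hs, hΦr]
    congr 1
    funext d
    rw [map_inv₀, Complex.conj_ofReal, hcswap]
  have hfix := hπ.existsUnique_fixedPoint (S := {η | η ∈ LamN (D.pr F) 2 ∧ D.bar η = η})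
    ⟨0, zero_mem _, map_zero _⟩ (fun η hη => hη.1)
    (f := fun η => η + mult (D.pr F) (fun d => ((c d)⁻¹ : ℂ)) (Φ η))
    (fun η hη => ⟨add_mem hη.1 (hπ.mult_mem (hΦm η hη.1)), by
      rw [map_add, hη.2, hΨ]⟩)
    (fun n η hη η' hη' h => by
      set θ := η - η' with hθ
      have hθr : D.bar θ = θ := by rw [hθ, map_sub, hη.2, hη'.2]
      set B := mult (D.pr F) (fun d => (slBeta d : ℂ)) θ with hB
      have hZ0 := hF.slSum_sub_mem hη.1 hη'.1 h
      rw [← hθ, ← hB] at hZ0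
      have hZ : Y η - Y η' + Complex.I • B ∈ LamN (D.pr F) (n + 1) := by
        set G := ∑ᶠ k, D.slP F η k with hG
        set G' := ∑ᶠ k, D.slP F η' k with hG'
        have h1 : G - G' ∈ LamN (D.pr F) n := by
          have := sub_mem (LamN_anti _ n.le_succ hZ0)
            (Submodule.smul_mem _ Complex.I (hπ.mult_mem (m := fun d => (slBeta d : ℂ)) h))
          rwa [← hB, add_sub_cancel_right] at this
        have h2 := add_mem hZ0 (hπ.mul_mem_right h1 hv)
        convert h2 using 1
        simp only [hY, ← hG, ← hG']
        noncomm_ring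
      have hZb := hF.bar_mem_LamN_of_split hs hZ
      have hBb : D.bar B = mult (D.pr F) (fun d => (slBeta d.swap : ℂ)) θ := by
        rw [hB, hF.bar_mult hs, hθr]
        simp_rw [Complex.conj_ofReal]
      rw [map_add, map_sub, D.bar_smul, Complex.conj_I] at hZb
      -- Up to the next level the variation of `Φ` is `-(B + D.bar B)`, which the multiplier `c⁻¹`
      -- turns into `-θ`.
      have hd : Φ η - Φ η' = (-Complex.I) • ((Y η - Y η' + Complex.I • B) -
          (D.bar (Y η) - D.bar (Y η') + -Complex.I • D.bar B)) - (B + D.bar B) := by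
        have hI : Complex.I * Complex.I = -1 := Complex.I_mul_I
        simp only [hΦ]
        match_scalars <;> simp
      have hsum : B + D.bar B = mult (D.pr F) (fun d => (c d : ℂ)) θ := by
        rw [hBb]
        refine hπ.mult_unique fun x y => ?_
        rw [mul_add, add_mul, hB, hπ.mult_entry, hπ.mult_entry, ← add_smul, hc]
        push_cast
        rfl
      have hinv : mult (D.pr F) (fun d => ((c d)⁻¹ : ℂ)) (B + D.bar B) = θ := by
        rw [hsum, hπ.mult_mult]
        symm
        refine hπ.mult_unique fun x y => ?_
        rw [inv_mul_cancel₀ (hcne _), one_smul]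
      rw [add_sub_add_comm, ← hπ.mult_sub, hd, hπ.mult_sub, hinv, ← hθ, add_sub_cancel]
      exact hπ.mult_mem (Submodule.smul_mem _ _ (sub_mem hZ hZb)))
  have hiff : ∀ η, η + mult (D.pr F) (fun d => ((c d)⁻¹ : ℂ)) (Φ η) = η ↔ D.bar (Y η) = Y η := by
    intro η
    rw [add_eq_left]
    constructor
    · intro h
      have h2 : mult (D.pr F) (fun d => (c d : ℂ)) (mult (D.pr F) (fun d => ((c d)⁻¹ : ℂ)) (Φ η)) =
          Φ η := by
        rw [hπ.mult_mult]
        symm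
        refine hπ.mult_unique fun x y => ?_
        rw [mul_inv_cancel₀ (hcne _), one_smul]
      rw [h] at h2
      have h3 : mult (D.pr F) (fun d => (c d : ℂ)) 0 = 0 := by
        symm
        exact hπ.mult_unique fun x y => by simp
      rw [h3] at h2
      have h4 : Y η - D.bar (Y η) = 0 :=
        (smul_eq_zero.1 h2.symm).resolve_left (neg_ne_zero.2 Complex.I_ne_zero)
      exact (sub_eq_zero.1 h4).symm
    · intro h
      have : Φ η = 0 := by simp only [hΦ]; rw [h, sub_self, smul_zero]
      rw [this]
      symm
      exact hπ.mult_unique fun x y => by simp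
  simpa only [hiff, Set.mem_ofPred_eq] using hfix

end Decomposes

end Datum

/-! ### Existence and uniqueness of `ζ` and `ε` -/

namespace Datum

variable {E : Type*} [NormedAddCommGroup E] [NormedSpace ℂ E] [FiniteDimensional ℂ E]

variable {D : Datum E} {F : ℤ → Submodule ℂ E}

namespace IsGradedPolarizedMHS

variable (hF : D.IsGradedPolarizedMHS F)
include hF

theorem decomposes_exp {X : E →L[ℂ] E} (hX : X ∈ LamN (D.pr F) 2) :
    D.Decomposes (act (NormedSpace.exp X) F) :=
  hF.decomposes.act (exp_mul_exp_neg X) (exp_neg_mul_exp X) (hF.moves_exp hX)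

theorem pr_exp {X : E →L[ℂ] E} (hX : X ∈ LamN (D.pr F) 2) (x : ℤ × ℤ) :
    D.pr (act (NormedSpace.exp X) F) x = NormedSpace.exp X * D.pr F x * NormedSpace.exp (-X) :=
  hF.decomposes.pr_act (exp_mul_exp_neg X) (exp_neg_mul_exp X) (hF.moves_exp hX) x

theorem LamN_exp {X : E →L[ℂ] E} (hX : X ∈ LamN (D.pr F) 2) (n : ℕ) :
    LamN (D.pr (act (NormedSpace.exp X) F)) n = LamN (D.pr F) n := by
  rw [show D.pr (act (NormedSpace.exp X) F) = _ from funext (hF.pr_exp hX)]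
  exact hF.decomposes.isBigrading.LamN_conj_eq n (exp_mul_exp_neg X) (exp_neg_mul_exp X)
    (exp_sub_one_mem hF.decomposes hX) (exp_sub_one_mem hF.decomposes (neg_mem hX))

/-- The defining relation reads `(∑ P_k(η)) e^{-iδ} = e^{-ζ}`. A real `ζ` exists exactly when the
left side is real, which determines `η`; then `ζ` is minus its logarithm. The spaces `LamN` are the
same for `F` and `e^{-iδ}.F`. -/
theorem existsUnique_isZeta {δ : E →L[ℂ] E} (hδ : D.IsDelta F δ) : ∃! ζ, D.IsZeta F δ ζ := by
  have hπ := hF.decomposes.isBigrading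
  have hδm := hF.decomposes.mem_Lam_iff.1 hδ.1
  have hX : -(Complex.I • δ) ∈ LamN (D.pr F) 2 := neg_mem (Submodule.smul_mem _ _ hδm)
  have hF' := hF.decomposes_exp hX
  have hs := hF'.isSplit_iff.1 hδ.2.2
  have hLam := hF.LamN_exp hX 2
  have h1 := exp_mul_exp_neg (Complex.I • δ)
  have h2 := exp_neg_mul_exp (Complex.I • δ)
  have hv := exp_sub_one_mem hF.decomposes hX
  rw [← hLam] at hv
  have hlem := hF'.existsUnique_real_slSum hs hv
  have hG : ∀ η ∈ LamN (D.pr F) 2,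
      ∑ᶠ k, D.slP (act (NormedSpace.exp (-(Complex.I • δ))) F) η k - 1 ∈ LamN (D.pr F) 2 :=
    fun η hη => by
      rw [← hLam] at hη ⊢
      exact hF'.slSum_sub_one_mem hη
  rw [hLam] at hlem hv
  have hdef : ∀ ζ, D.IsZeta F δ ζ ↔ ζ ∈ LamN (D.pr F) 2 ∧ D.bar ζ = ζ ∧
      ∃ η, (η ∈ LamN (D.pr F) 2 ∧ D.bar η = η) ∧ NormedSpace.exp (Complex.I • δ) =
        NormedSpace.exp ζ * ∑ᶠ k, D.slP (act (NormedSpace.exp (-(Complex.I • δ))) F) η k := by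
    intro ζ
    simp only [IsZeta, hF.decomposes.mem_Lam_iff, D.isReal_iff, and_assoc]
  set G := fun η => ∑ᶠ k, D.slP (act (NormedSpace.exp (-(Complex.I • δ))) F) η k with hGdef
  set e := NormedSpace.exp (Complex.I • δ) with he
  set v := NormedSpace.exp (-(Complex.I • δ)) with hvdef
  obtain ⟨η, ⟨hη, hηr⟩, hηu⟩ := hlem
  obtain ⟨L, ⟨hL, hLe⟩, -⟩ := hπ.existsUnique_log (hπ.mul_sub_one_mem (hG η hη.1) hv)
  have hLr : D.bar L = L := by
    refine hπ.exp_injOn (hF.bar_mem_LamN.2 hL) hL ?_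
    rw [← D.bar_exp, hLe, hηr]
  refine ⟨-L, (hdef _).2 ⟨neg_mem hL, by rw [map_neg, hLr], η, hη, ?_⟩, fun ζ hζ => ?_⟩
  · calc e = NormedSpace.exp (-L) * NormedSpace.exp L * e := by rw [exp_neg_mul_exp, one_mul]
      _ = NormedSpace.exp (-L) * G η * (v * e) := by rw [hLe]; noncomm_ring
      _ = NormedSpace.exp (-L) * G η := by rw [h2, mul_one]
  · obtain ⟨hζ, hζr, η', hη', heq⟩ := (hdef ζ).1 hζ
    have hGv : G η' * v = NormedSpace.exp (-ζ) := by
      calc G η' * v = NormedSpace.exp (-ζ) * NormedSpace.exp ζ * G η' * v := by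
            rw [exp_neg_mul_exp, one_mul]
        _ = NormedSpace.exp (-ζ) * (NormedSpace.exp ζ * G η') * v := by noncomm_ring
        _ = NormedSpace.exp (-ζ) := by rw [← heq, mul_assoc, h1, mul_one]
    have : η' = η := hηu η' ⟨hη', by
      change D.bar (G η' * v) = G η' * v
      rw [hGv, D.bar_exp, map_neg, hζr]⟩
    rw [this] at hGv
    have := hπ.exp_injOn (neg_mem hζ) hL (by rw [← hGv, hLe])
    rw [← this, neg_neg]

theorem existsUnique_isEps : ∃! ε, D.IsEps F ε := by
  have hπ := hF.decomposes.isBigrading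
  obtain ⟨δ, hδ, hδu⟩ := hF.existsUnique_isDelta
  obtain ⟨ζ, hζ, hζu⟩ := hF.existsUnique_isZeta hδ
  have hδm := hF.decomposes.mem_Lam_iff.1 hδ.1
  have hζm := hF.decomposes.mem_Lam_iff.1 hζ.1
  obtain ⟨ε, ⟨hε, hεe⟩, hεu⟩ := hπ.existsUnique_log (hπ.mul_sub_one_mem
    (exp_sub_one_mem hF.decomposes (Submodule.smul_mem _ Complex.I hδm))
    (exp_sub_one_mem hF.decomposes (neg_mem hζm)))
  refine ⟨ε, ⟨hF.decomposes.mem_Lam_iff.2 hε, δ, ζ, hδ, hζ, hεe⟩, ?_⟩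
  rintro ε' ⟨hε', δ', ζ', hδ', hζ', heq⟩
  obtain rfl := hδu δ' hδ'
  obtain rfl := hζu ζ' hζ'
  exact hεu ε' ⟨hF.decomposes.mem_Lam_iff.1 hε', heq⟩

theorem isEps_eps : D.IsEps F (D.eps F) := Classical.epsilon_spec hF.existsUnique_isEps.exists

theorem eps_mem : D.eps F ∈ LamN (D.pr F) 2 := hF.decomposes.mem_Lam_iff.1 hF.isEps_eps.1

/-- `(e^{-ε}.F, W)` is split over `ℝ`, in terms of the projections. -/
theorem bar_exp_eps (x : ℤ × ℤ) :
    D.bar (NormedSpace.exp (-D.eps F) * D.pr F x.swap * NormedSpace.exp (D.eps F)) =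
      NormedSpace.exp (-D.eps F) * D.pr F x * NormedSpace.exp (D.eps F) := by
  obtain ⟨-, δ, ζ, hδ, hζ, heq⟩ := hF.isEps_eps
  have hδm := hF.decomposes.mem_Lam_iff.1 hδ.1
  have hX : -(Complex.I • δ) ∈ LamN (D.pr F) 2 := neg_mem (Submodule.smul_mem _ _ hδm)
  have hs := (hF.decomposes_exp hX).isSplit_iff.1 hδ.2.2 x
  rw [prBar, hF.pr_exp hX, hF.pr_exp hX, neg_neg] at hs
  have hζr := D.isReal_iff.1 hζ.2.1
  -- `e^{-ε} = e^ζ e^{-iδ}`: the split structure `e^{-iδ}.F` is moved by the real element `e^ζ` and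
  -- stays split.
  have hinv : NormedSpace.exp (-D.eps F) =
      NormedSpace.exp ζ * NormedSpace.exp (-(Complex.I • δ)) := by
    refine left_inv_eq_right_inv (exp_neg_mul_exp _) ?_
    rw [heq]
    calc _ = NormedSpace.exp (Complex.I • δ) * (NormedSpace.exp (-ζ) * NormedSpace.exp ζ) *
          NormedSpace.exp (-(Complex.I • δ)) := by noncomm_ring
      _ = 1 := by rw [exp_neg_mul_exp, mul_one, exp_mul_exp_neg]
  have key : ∀ y, NormedSpace.exp (-D.eps F) * D.pr F y * NormedSpace.exp (D.eps F) =
      NormedSpace.exp ζ * (NormedSpace.exp (-(Complex.I • δ)) * D.pr F y *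
        NormedSpace.exp (Complex.I • δ)) * NormedSpace.exp (-ζ) := fun y => by
    rw [hinv, heq]
    noncomm_ring
  rw [key, key, map_mul, map_mul, hs, D.bar_exp, D.bar_exp, map_neg, hζr]

end IsGradedPolarizedMHS

/-- A real automorphism preserving `W`, with inverse `t'`. -/
structure IsRealAut (D : Datum E) (t t' : E →L[ℂ] E) : Prop where
  mul_inv : t * t' = 1
  inv_mul : t' * t = 1
  real : D.bar t = t
  map_W : ∀ k, (D.W k).map (t : E →ₗ[ℂ] E) = D.W k

/-! ### Equivariance of `δ`, `ζ` and `ε` under real automorphisms -/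

namespace IsRealAut

variable {t t' : E →L[ℂ] E} (ht : D.IsRealAut t t')
include ht

theorem real_inv : D.bar t' = t' := by
  refine left_inv_eq_right_inv (a := t) ?_ ht.mul_inv
  conv_lhs => rw [← ht.real]
  rw [← map_mul, ht.inv_mul, map_one]

theorem moves : D.Moves t F := moves_of_real ht.inv_mul (D.isReal_iff.2 ht.real) ht.map_W

theorem decomposes (hF : D.Decomposes F) : D.Decomposes (act t F) :=
  hF.act ht.mul_inv ht.inv_mul ht.moves

theorem pr_act (hF : D.Decomposes F) (x : ℤ × ℤ) : D.pr (act t F) x = t * D.pr F x * t' :=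
  hF.pr_act ht.mul_inv ht.inv_mul ht.moves x

theorem mult_act (hF : D.Decomposes F) (m : ℤ × ℤ → ℂ) (X : E →L[ℂ] E) :
    mult (D.pr (act t F)) m (t * X * t') = t * mult (D.pr F) m X * t' := by
  rw [show D.pr (act t F) = _ from funext (ht.pr_act hF)]
  exact hF.isBigrading.mult_conj ht.mul_inv ht.inv_mul m X

theorem comp_act (hF : D.Decomposes F) (X : E →L[ℂ] E) (p q : ℤ) :
    D.comp (act t F) (t * X * t') p q = t * D.comp F X p q * t' := by
  rw [(ht.decomposes hF).comp_eq_mult, hF.comp_eq_mult, ht.mult_act hF]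

theorem qPart_act (hF : D.Decomposes F) (X : E →L[ℂ] E) :
    D.qPart (act t F) (t * X * t') = t * D.qPart F X * t' := by
  rw [(ht.decomposes hF).qPart_eq_mult, hF.qPart_eq_mult, ht.mult_act hF]

theorem slP_act (hF : D.Decomposes F) (η : E →L[ℂ] E) (k : ℕ) :
    D.slP (act t F) (t * η * t') k = t * D.slP F η k * t' := by
  have hC : ∀ l, D.slC (act t F) (t * η * t') l = t * D.slC F η l * t' := fun l => by
    rw [(ht.decomposes hF).slC_eq_mult, hF.slC_eq_mult, ht.mult_act hF]
  induction k using Nat.strong_induction_on with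
  | _ k ih =>
    rcases k with _ | k
    · rw [slP, slP, mul_one, ht.mul_inv]
    · rw [Decomposes.slP_succ, Decomposes.slP_succ, hC, mul_smul_comm, smul_mul_assoc, mul_add,
        add_mul, Finset.mul_sum, Finset.sum_mul]
      congr 2
      refine Finset.sum_congr rfl fun j hj => ?_
      rw [ih _ (by omega), hC, show t * D.slP F η (k - j) * t' * (t * D.slC F η j * t') =
        t * D.slP F η (k - j) * (t' * t) * D.slC F η j * t' by noncomm_ring, ht.inv_mul]
      noncomm_ring

theorem mem_Lam_act (hF : D.Decomposes F) {X : E →L[ℂ] E} (hX : X ∈ D.Lam F) :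
    t * X * t' ∈ D.Lam (act t F) := by
  rw [(ht.decomposes hF).mem_Lam_iff, show D.pr (act t F) = _ from funext (ht.pr_act hF),
    mem_LamN_conj ht.inv_mul]
  exact hF.mem_Lam_iff.1 hX

theorem isReal_conj {X : E →L[ℂ] E} (hX : D.IsReal X) : D.IsReal (t * X * t') := by
  rw [D.isReal_iff] at hX ⊢
  rw [map_mul, map_mul, hX, ht.real, ht.real_inv]

theorem exp_conj (X : E →L[ℂ] E) :
    NormedSpace.exp (t * X * t') = t * NormedSpace.exp X * t' :=
  exp_conj_of_mul_eq_one ht.mul_inv ht.inv_mul X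

theorem act_conj (g : E →L[ℂ] E) (F : ℤ → Submodule ℂ E) :
    act (t * g * t') (act t F) = act t (act g F) := by
  rw [← act_mul, ← act_mul, mul_assoc, ht.inv_mul, mul_one]

theorem isSplit_act (hF : D.IsSplit F) : D.IsSplit (act t F) := fun p q => by
  rw [ht.moves, ht.moves, conjSub_map, ht.real, hF]

theorem exp_I_smul (X : E →L[ℂ] E) :
    NormedSpace.exp (-(Complex.I • (t * X * t'))) = t * NormedSpace.exp (-(Complex.I • X)) * t' := by
  rw [← ht.exp_conj, mul_neg, neg_mul, mul_smul_comm, smul_mul_assoc]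

theorem isDelta_act (hF : D.Decomposes F) {δ : E →L[ℂ] E} (hδ : D.IsDelta F δ) :
    D.IsDelta (act t F) (t * δ * t') := by
  refine ⟨ht.mem_Lam_act hF hδ.1, ht.isReal_conj hδ.2.1, ?_⟩
  rw [ht.exp_I_smul, ht.act_conj]
  exact ht.isSplit_act hδ.2.2

theorem isZeta_act (hF : D.IsGradedPolarizedMHS F) {δ ζ : E →L[ℂ] E} (hδ : D.IsDelta F δ)
    (hζ : D.IsZeta F δ ζ) : D.IsZeta (act t F) (t * δ * t') (t * ζ * t') := by
  obtain ⟨h1, h2, η, h3, h4, h5⟩ := hζ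
  refine ⟨ht.mem_Lam_act hF.decomposes h1, ht.isReal_conj h2, t * η * t',
    ht.mem_Lam_act hF.decomposes h3, ht.isReal_conj h4, ?_⟩
  have hF' := hF.decomposes_exp (X := -(Complex.I • δ))
    (neg_mem (Submodule.smul_mem _ _ (hF.decomposes.mem_Lam_iff.1 hδ.1)))
  rw [ht.exp_I_smul, ht.act_conj]
  simp_rw [ht.slP_act hF']
  have hfs : ∑ᶠ k, t * D.slP (act (NormedSpace.exp (-(Complex.I • δ))) F) η k * t' =
      t * (∑ᶠ k, D.slP (act (NormedSpace.exp (-(Complex.I • δ))) F) η k) * t' := by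
    -- Conjugation is injective, so it commutes with `finsum` without any finiteness of the support.
    refine (AddMonoidHom.map_finsum_of_injective
      ((AddMonoidHom.mulRight t').comp (AddMonoidHom.mulLeft t)) (fun X Y hXY => ?_) _).symm
    have hXY' : t * X * t' = t * Y * t' := hXY
    have := congrArg (fun Z => t' * Z * t) hXY'
    simp only [← mul_assoc, ht.inv_mul, one_mul] at this
    simpa only [mul_assoc, ht.inv_mul, mul_one] using this
  rw [hfs, show Complex.I • (t * δ * t') = t * (Complex.I • δ) * t' by
    rw [mul_smul_comm, smul_mul_assoc], ht.exp_conj, ht.exp_conj, h5]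
  set S := ∑ᶠ k, D.slP (act (NormedSpace.exp (-(Complex.I • δ))) F) η k
  rw [show t * NormedSpace.exp ζ * t' * (t * S * t') =
    t * NormedSpace.exp ζ * (t' * t) * S * t' by noncomm_ring, ht.inv_mul]
  noncomm_ring

/-- Conjugation by `t` transports every condition in the characterization of `ε`; uniqueness at `act
t F` does the rest. -/
theorem eps_act (hF : D.IsGradedPolarizedMHS F) (htF : D.IsGradedPolarizedMHS (act t F)) :
    D.eps (act t F) = t * D.eps F * t' := by
  refine htF.existsUnique_isEps.unique htF.isEps_eps ?_
  obtain ⟨h1, δ, ζ, hδ, hζ, h2⟩ := hF.isEps_eps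
  refine ⟨ht.mem_Lam_act hF.decomposes h1, t * δ * t', t * ζ * t',
    ht.isDelta_act hF.decomposes hδ, ht.isZeta_act hF hδ hζ, ?_⟩
  rw [show Complex.I • (t * δ * t') = t * (Complex.I • δ) * t' by
    rw [mul_smul_comm, smul_mul_assoc], show -(t * ζ * t') = t * (-ζ) * t' by noncomm_ring,
    ht.exp_conj, ht.exp_conj, ht.exp_conj, h2]
  rw [show t * NormedSpace.exp (Complex.I • δ) * t' * (t * NormedSpace.exp (-ζ) * t') =
    t * NormedSpace.exp (Complex.I • δ) * (t' * t) * NormedSpace.exp (-ζ) * t' by noncomm_ring,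
    ht.inv_mul]
  noncomm_ring

end IsRealAut

end Datum

/-- A positive definite hermitian form on a finite-dimensional complex vector space has an orthonormal
basis. -/
theorem exists_basis_orthonormal {V : Type*} [AddCommGroup V] [Module ℂ V] [FiniteDimensional ℂ V]
    (h : V → V → ℂ) (hadd : ∀ u u' v, h (u + u') v = h u v + h u' v)
    (hsmul : ∀ (c : ℂ) u v, h (c • u) v = c * h u v)
    (hsymm : ∀ u v, starRingEnd ℂ (h u v) = h v u) (hpos : ∀ v, v ≠ 0 → 0 < (h v v).re) :
    ∃ (n : ℕ) (b : Module.Basis (Fin n) ℂ V), ∀ i j, h (b i) (b j) = if i = j then 1 else 0 := by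
  have hadd' : ∀ u v v', h u (v + v') = h u v + h u v' := fun u v v' => by
    rw [← hsymm, hadd, map_add, hsymm, hsymm]
  have hsmul' : ∀ (c : ℂ) u v, h u (c • v) = starRingEnd ℂ c * h u v := fun c u v => by
    rw [← hsymm, hsmul, map_mul, hsymm]
  have h0 : h 0 0 = 0 := by simpa using hsmul 0 0 0
  let core : InnerProductSpace.Core ℂ V :=
    { inner := fun u v => h v u
      conj_inner_symm := fun u v => hsymm u v
      re_inner_nonneg := fun v => by
        by_cases hv : v = 0
        · rw [hv, h0]
          exact le_rfl
        · exact (hpos v hv).le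
      add_left := fun u u' v => hadd' v u u'
      smul_left := fun u v c => hsmul' c v u
      definite := fun v hv => by
        by_contra hne
        have := hpos v hne
        rw [hv] at this
        exact lt_irrefl _ this }
  let _ : NormedAddCommGroup V := core.toNormedAddCommGroup
  let _ : InnerProductSpace ℂ V := InnerProductSpace.ofCore core.toCore
  refine ⟨_, (stdOrthonormalBasis ℂ V).toBasis, fun i j => ?_⟩
  have := orthonormal_iff_ite.1 (stdOrthonormalBasis ℂ V).orthonormal j i
  rw [OrthonormalBasis.coe_toBasis]
  simp only [@eq_comm _ i j]
  exact this

theorem repr_apply_eq_sum {E ι : Type*} [NormedAddCommGroup E] [NormedSpace ℂ E] [Fintype ι]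
    (b : Module.Basis ι ℂ E) (X : E →L[ℂ] E) (u : E) (k : ι) :
    b.repr (X u) k = ∑ i, b.repr (X (b i)) k * b.repr u i := by
  conv_lhs => rw [← b.sum_repr u, map_sum, map_sum, Finsupp.finsetSum_apply]
  refine Finset.sum_congr rfl fun i _ => ?_
  rw [map_smul, map_smul, Finsupp.smul_apply, smul_eq_mul, mul_comm]

/-! ### Adapted bases and the metrics in coordinates -/

namespace Datum

variable {E : Type*} [NormedAddCommGroup E] [NormedSpace ℂ E] [FiniteDimensional ℂ E]

variable {D : Datum E} {F : ℤ → Submodule ℂ E}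

variable (D) in
/-- The form `i^{p-q} S_{p+q}(u, conj v)`. -/
def hform (x : ℤ × ℤ) (u v : E) : ℂ :=
  Complex.I ^ (x.1 - x.2) * D.S (x.1 + x.2) u (D.conj v)

theorem hform_add_left (x : ℤ × ℤ) (u u' v : E) :
    D.hform x (u + u') v = D.hform x u v + D.hform x u' v := by
  simp [hform, mul_add]

theorem hform_add_right (x : ℤ × ℤ) (u v v' : E) :
    D.hform x u (v + v') = D.hform x u v + D.hform x u v' := by
  simp [hform, mul_add]

theorem hform_smul_left (x : ℤ × ℤ) (c : ℂ) (u v : E) :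
    D.hform x (c • u) v = c * D.hform x u v := by
  simp [hform, mul_left_comm]

theorem hform_smul_right (x : ℤ × ℤ) (c : ℂ) (u v : E) :
    D.hform x u (c • v) = starRingEnd ℂ c * D.hform x u v := by
  simp [hform, mul_left_comm]

/-- Conjugating `i^{p-q}` costs `(-1)^{p-q}` and exchanging the arguments costs `(-1)^{p+q}`; the
product is `(-1)^{2p} = 1`. -/
theorem hform_symm {x : ℤ × ℤ} {u v : E} (hu : u ∈ D.W (x.1 + x.2)) (hv : v ∈ D.W (x.1 + x.2)) :
    starRingEnd ℂ (D.hform x u v) = D.hform x v u := by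
  rw [hform, hform, map_mul, ← D.S_real _ _ hu _ (D.W_real _ _ hv), D.conj_conj,
    D.S_symm _ _ (D.W_real _ _ hu) _ hv, map_zpow₀, Complex.conj_I, ← mul_assoc]
  congr 1
  rw [← neg_one_mul, mul_zpow, mul_right_comm, ← zpow_add₀ (neg_ne_zero.2 one_ne_zero),
    show x.1 - x.2 + (x.1 + x.2) = 2 * x.1 by ring, zpow_mul]
  simp

theorem hodgeForm_eq_finsum (s : ℝ) (u v : E) : D.hodgeForm s F u v =
    ∑ᶠ x : ℤ × ℤ, (s : ℂ) ^ (x.1 + x.2) * D.hform x (D.pr F x u) (D.pr F x v) := rfl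

theorem hodgeForm_eq_sum {J : Finset (ℤ × ℤ)}
    (hJ : ∀ x ∉ J, D.pr F x = 0) (s : ℝ) (u v : E) :
    D.hodgeForm s F u v =
      ∑ x ∈ J, (s : ℂ) ^ (x.1 + x.2) * D.hform x (D.pr F x u) (D.pr F x v) := by
  rw [hodgeForm_eq_finsum]
  refine finsum_eq_sum_of_support_subset _ fun x hx => ?_
  by_contra h
  exact hx (by simp [hJ x h, hform])

namespace IsGradedPolarizedMHS

variable (hF : D.IsGradedPolarizedMHS F)
include hF

theorem bigr_le_grHodge (p q : ℤ) : D.bigr F p q ≤ D.grHodge F p q := by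
  intro v hv
  refine ⟨le_sup_left (a := F p ⊓ D.W (p + q)) ⟨bigr_le_F p q hv, bigr_le_W p q hv⟩, ?_⟩
  have := bigr_le_pre p q hv
  obtain ⟨a, ha, b, hb, rfl⟩ := Submodule.mem_sup.1 this
  rw [SetLike.mem_coe, mem_conjSub, map_add]
  exact Submodule.add_mem_sup ⟨ha.1, D.W_real _ _ ha.2⟩ (D.W_real _ _ (opp_le_W _ _ hb))

theorem hform_pos {x : ℤ × ℤ} {v : E} (hv : v ∈ D.bigr F x.1 x.2) (h0 : v ≠ 0) :
    0 < (D.hform x v v).re :=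
  hF.pos x.1 x.2 v (hF.bigr_le_grHodge _ _ hv) fun h => h0 (hF.bigr_inf_W hv h)

end IsGradedPolarizedMHS

/-- A basis adapted to the bigrading and orthonormal for the forms `hform`. -/
structure IsAdapted (D : Datum E) (F : ℤ → Submodule ℂ E) {ι : Type*} [Fintype ι] [DecidableEq ι]
    (b : Module.Basis ι ℂ E) (x : ι → ℤ × ℤ) : Prop where
  mem : ∀ i, b i ∈ D.bigr F (x i).1 (x i).2
  hform_eq : ∀ i j, x i = x j → D.hform (x i) (b i) (b j) = if i = j then 1 else 0

theorem IsGradedPolarizedMHS.exists_adapted (hF : D.IsGradedPolarizedMHS F) :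
    ∃ (ι : Type) (_ : Fintype ι) (_ : DecidableEq ι) (b : Module.Basis ι ℂ E) (x : ι → ℤ × ℤ),
      D.IsAdapted F b x := by
  have hd := hF.decomposes
  have hint : DirectSum.IsInternal fun x : ℤ × ℤ => D.bigr F x.1 x.2 :=
    DirectSum.isInternal_submodule_of_iSupIndep_of_iSup_eq_top hd.1 hd.2
  have : ∀ x : ℤ × ℤ, ∃ (n : ℕ) (b : Module.Basis (Fin n) ℂ (D.bigr F x.1 x.2)),
      ∀ i j, D.hform x (b i) (b j) = if i = j then 1 else 0 := fun x =>
    exists_basis_orthonormal (fun u v : D.bigr F x.1 x.2 => D.hform x u v)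
      (fun u u' v => by rw [Submodule.coe_add, hform_add_left])
      (fun c u v => by rw [Submodule.coe_smul, hform_smul_left])
      (fun u v => hform_symm (bigr_le_W _ _ u.2) (bigr_le_W _ _ v.2))
      (fun v hv => hF.hform_pos v.2 fun h => hv (Subtype.ext h))
  choose n b hb using this
  let B := hint.collectedBasis b
  have hBe : ∀ i, B i = b i.1 i.2 := fun i => by
    rw [show (B : (Σ x, Fin (n x)) → E) = _ from hint.collectedBasis_coe b]
  have : Finite (Σ x, Fin (n x)) := Module.Finite.finite_basis B
  let _ : Fintype (Σ x, Fin (n x)) := Fintype.ofFinite _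
  refine ⟨Σ x, Fin (n x), inferInstance, inferInstance, B, fun i => i.1, ?_, ?_⟩
  · exact fun i => hint.collectedBasis_mem b i
  · rintro ⟨x, i⟩ ⟨y, j⟩ h
    obtain rfl : x = y := h
    rw [hBe, hBe]
    refine (hb x i j).trans ?_
    by_cases hij : i = j
    · subst hij
      simp
    · rw [if_neg hij, if_neg fun h => hij (by simpa using h)]

namespace IsAdapted

variable {ι : Type*} [Fintype ι] [DecidableEq ι] {b : Module.Basis ι ℂ E} {x : ι → ℤ × ℤ}
  (hb : D.IsAdapted F b x) (hF : D.Decomposes F)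

include hb hF

theorem pr_basis (i : ι) (y : ℤ × ℤ) : D.pr F y (b i) = if x i = y then b i else 0 := by
  split_ifs with h
  · exact hF.pr_of_mem (h ▸ hb.mem i)
  · exact hF.pr_of_mem_ne h (hb.mem i)

theorem hodgeForm_basis (s : ℝ) (i j : ι) :
    D.hodgeForm s F (b i) (b j) = if i = j then (s : ℂ) ^ ((x i).1 + (x i).2) else 0 := by
  rw [hodgeForm_eq_finsum, finsum_eq_single _ (x i)]
  · rw [hb.pr_basis hF, if_pos rfl, hb.pr_basis hF]
    by_cases h : x j = x i
    · rw [if_pos h, hb.hform_eq i j h.symm]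
      split_ifs <;> simp
    · rw [if_neg h, if_neg fun h' => h (by rw [h'])]
      simp [hform]
  · intro y hy
    rw [hb.pr_basis hF, if_neg hy.symm]
    simp [hform]

theorem repr_pr (y : ℤ × ℤ) (u : E) (i : ι) :
    b.repr (D.pr F y u) i = if x i = y then b.repr u i else 0 := by
  rw [repr_apply_eq_sum, Finset.sum_eq_single i]
  · rw [hb.pr_basis hF]
    split_ifs <;> simp
  · intro j _ hj
    rw [hb.pr_basis hF]
    split_ifs <;> simp [hj]
  · simp

theorem hodgeForm_repr (s : ℝ) (u v : E) : D.hodgeForm s F u v =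
    ∑ i, (s : ℂ) ^ ((x i).1 + (x i).2) * (b.repr u i * starRingEnd ℂ (b.repr v i)) := by
  have hJ : ∀ y ∉ hF.isBigrading.finite.toFinset, D.pr F y = 0 := fun y hy => by simpa using hy
  have hadd : ∀ u u' v, D.hodgeForm s F (u + u') v = D.hodgeForm s F u v + D.hodgeForm s F u' v :=
    fun u u' v => by
      simp_rw [hodgeForm_eq_sum hJ, map_add, hform_add_left, mul_add, Finset.sum_add_distrib]
  have hadd' : ∀ u v v', D.hodgeForm s F u (v + v') = D.hodgeForm s F u v + D.hodgeForm s F u v' :=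
    fun u u' v => by
      simp_rw [hodgeForm_eq_sum hJ, map_add, hform_add_right, mul_add, Finset.sum_add_distrib]
  have hsm : ∀ (c : ℂ) u v, D.hodgeForm s F (c • u) v = c * D.hodgeForm s F u v := fun c u v => by
    simp_rw [hodgeForm_eq_sum hJ, map_smul, hform_smul_left, Finset.mul_sum, mul_left_comm]
  have hsm' : ∀ (c : ℂ) u v, D.hodgeForm s F u (c • v) = starRingEnd ℂ c * D.hodgeForm s F u v :=
    fun c u v => by
      simp_rw [hodgeForm_eq_sum hJ, map_smul, hform_smul_right, Finset.mul_sum, mul_left_comm]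
  let B : E →ₗ[ℂ] E →ₗ⋆[ℂ] ℂ := LinearMap.mk₂'ₛₗ (RingHom.id ℂ) (starRingEnd ℂ)
    (D.hodgeForm s F) hadd hsm hadd' hsm'
  change B u v = _
  conv_lhs => rw [← b.sum_repr u, ← b.sum_repr v]
  rw [LinearMap.map_sum₂]
  refine Finset.sum_congr rfl fun i _ => ?_
  rw [map_sum, Finset.sum_eq_single i]
  · rw [LinearMap.map_smulₛₗ₂, LinearMap.map_smulₛₗ]
    change b.repr u i * (starRingEnd ℂ (b.repr v i) * D.hodgeForm s F (b i) (b i)) = _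
    rw [hb.hodgeForm_basis hF, if_pos rfl]
    ring
  · intro j _ hj
    rw [LinearMap.map_smulₛₗ₂, LinearMap.map_smulₛₗ]
    change b.repr u i * (starRingEnd ℂ (b.repr v j) * D.hodgeForm s F (b i) (b j)) = _
    rw [hb.hodgeForm_basis hF, if_neg hj.symm]
    ring
  · simp

theorem hodgeForm_basis_right (s : ℝ) (u : E) (i : ι) :
    D.hodgeForm s F u (b i) = (s : ℂ) ^ ((x i).1 + (x i).2) * b.repr u i := by
  rw [hb.hodgeForm_repr hF, Finset.sum_eq_single i]
  · simp
  · intro j _ hj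
    simp [hj.symm]
  · simp

theorem hodgeForm_basis_left (s : ℝ) (u : E) (i : ι) :
    D.hodgeForm s F (b i) u = (s : ℂ) ^ ((x i).1 + (x i).2) * starRingEnd ℂ (b.repr u i) := by
  rw [hb.hodgeForm_repr hF, Finset.sum_eq_single i]
  · simp
  · intro j _ hj
    simp [hj.symm]
  · simp

theorem repr_of_adjoint {s : ℝ} (hs : 0 < s) {β β' : E →L[ℂ] E}
    (h : ∀ u v, D.hodgeForm s F (β u) v = D.hodgeForm s F u (β' v)) (i k : ι) :
    b.repr (β' (b k)) i = (s : ℂ) ^ (((x k).1 + (x k).2) - ((x i).1 + (x i).2)) *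
      starRingEnd ℂ (b.repr (β (b i)) k) := by
  have hs' : (s : ℂ) ≠ 0 := by exact_mod_cast hs.ne'
  have := h (b i) (b k)
  rw [hb.hodgeForm_basis_right hF, hb.hodgeForm_basis_left hF] at this
  have h2 := congrArg (starRingEnd ℂ) this
  simp only [map_mul, Complex.conj_conj, map_zpow₀, Complex.conj_ofReal] at h2
  rw [zpow_sub₀ hs', div_mul_eq_mul_div, h2, mul_div_cancel_left₀ _ (zpow_ne_zero _ hs')]

theorem adjoint_unique {s : ℝ} (hs : 0 < s) {β β₁ β₂ : E →L[ℂ] E}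
    (h₁ : ∀ u v, D.hodgeForm s F (β u) v = D.hodgeForm s F u (β₁ v))
    (h₂ : ∀ u v, D.hodgeForm s F (β u) v = D.hodgeForm s F u (β₂ v)) : β₁ = β₂ := by
  refine ContinuousLinearMap.coe_injective (b.ext fun k => b.repr.injective ?_)
  ext i
  exact (hb.repr_of_adjoint hF hs h₁ i k).trans (hb.repr_of_adjoint hF hs h₂ i k).symm

theorem exists_adjoint {s : ℝ} (hs : 0 < s) (β : E →L[ℂ] E) :
    ∃ β' : E →L[ℂ] E, ∀ u v, D.hodgeForm s F (β u) v = D.hodgeForm s F u (β' v) := by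
  have hs' : (s : ℂ) ≠ 0 := by exact_mod_cast hs.ne'
  let M : Matrix ι ι ℂ := Matrix.of fun i k =>
    (s : ℂ) ^ (((x k).1 + (x k).2) - ((x i).1 + (x i).2)) * starRingEnd ℂ (b.repr (β (b i)) k)
  refine ⟨LinearMap.toContinuousLinearMap (Matrix.toLin b b M), fun u v => ?_⟩
  have hM : ∀ i, b.repr (Matrix.toLin b b M v) i = ∑ k, M i k * b.repr v k := fun i => by
    rw [Matrix.repr_toLin]
    rfl
  have hβ : ∀ k, b.repr (β u) k = ∑ i, b.repr u i * b.repr (β (b i)) k := fun k => by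
    rw [repr_apply_eq_sum]
    exact Finset.sum_congr rfl fun i _ => mul_comm _ _
  rw [hb.hodgeForm_repr hF, hb.hodgeForm_repr hF]
  simp only [LinearMap.coe_toContinuousLinearMap']
  simp_rw [hM, hβ, map_sum, Finset.mul_sum, Finset.sum_mul, Finset.mul_sum]
  rw [Finset.sum_comm]
  refine Finset.sum_congr rfl fun i _ => Finset.sum_congr rfl fun k _ => ?_
  simp only [M, Matrix.of_apply, map_mul, map_zpow₀, Complex.conj_ofReal, Complex.conj_conj]
  rw [zpow_sub₀ hs']
  field_simp [zpow_ne_zero _ hs']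

theorem adjointWrt_spec {s : ℝ} (hs : 0 < s) (β : E →L[ℂ] E) (u v : E) :
    D.hodgeForm s F (β u) v = D.hodgeForm s F u (adjointWrt (D.hodgeForm s F) β v) :=
  Classical.epsilon_spec (hb.exists_adjoint hF hs β) u v

/-- The adjoint is the conjugate transpose weighted by powers of `s`, so the trace is a weighted
Hilbert–Schmidt sum from which the later comparisons are read off. -/
theorem endForm_eq {s : ℝ} (hs : 0 < s) (α : E →L[ℂ] E) : D.endForm s F α α =
    ((∑ k, ∑ i, s ^ (((x k).1 + (x k).2) - ((x i).1 + (x i).2)) *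
      ‖b.repr (α (b i)) k‖ ^ 2 : ℝ) : ℂ) := by
  rw [endForm, LinearMap.trace_eq_matrix_trace ℂ b]
  have : ((α * adjointWrt (D.hodgeForm s F) α : E →L[ℂ] E) : E →ₗ[ℂ] E) =
      (α : E →ₗ[ℂ] E) * (adjointWrt (D.hodgeForm s F) α : E →ₗ[ℂ] E) := rfl
  rw [this, LinearMap.toMatrix_mul, Matrix.trace]
  push_cast
  refine Finset.sum_congr rfl fun k _ => ?_
  rw [Matrix.diag_apply, Matrix.mul_apply]
  refine Finset.sum_congr rfl fun i _ => ?_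
  rw [LinearMap.toMatrix_apply, LinearMap.toMatrix_apply]
  have h1 := hb.repr_of_adjoint hF hs (hb.adjointWrt_spec hF hs α) i k
  rw [ContinuousLinearMap.coe_coe, ContinuousLinearMap.coe_coe, h1, mul_left_comm,
    Complex.mul_conj, Complex.normSq_eq_norm_sq]
  push_cast
  rfl

theorem endNorm_eq {s : ℝ} (hs : 0 < s) (α : E →L[ℂ] E) : D.endNorm s F α =
    Real.sqrt (∑ k, ∑ i, s ^ (((x k).1 + (x k).2) - ((x i).1 + (x i).2)) *
      ‖b.repr (α (b i)) k‖ ^ 2) := by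
  rw [endNorm, hb.endForm_eq hF hs, Complex.ofReal_re]

theorem repr_mult (m : ℤ × ℤ → ℂ) (X : E →L[ℂ] E) (i k : ι) :
    b.repr (mult (D.pr F) m X (b i)) k = m (x k - x i) * b.repr (X (b i)) k := by
  have h1 : b.repr ((D.pr F (x k) * mult (D.pr F) m X * D.pr F (x i)) (b i)) k =
      b.repr (mult (D.pr F) m X (b i)) k := by
    change b.repr (D.pr F (x k) (mult (D.pr F) m X (D.pr F (x i) (b i)))) k = _
    rw [hb.repr_pr hF, if_pos rfl, hb.pr_basis hF, if_pos rfl]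
  have h2 : b.repr ((D.pr F (x k) * X * D.pr F (x i)) (b i)) k = b.repr (X (b i)) k := by
    change b.repr (D.pr F (x k) (X (D.pr F (x i) (b i)))) k = _
    rw [hb.repr_pr hF, if_pos rfl, hb.pr_basis hF, if_pos rfl]
  rw [← h1, hF.isBigrading.mult_entry, ← h2]
  simp

/-- All nonzero matrix entries of an endomorphism of type `(p, q)` shift the weight by `p + q`. -/
theorem endNorm_comp {s : ℝ} (hs : 0 < s) (X : E →L[ℂ] E) (p q : ℤ) :
    D.endNorm s F (D.comp F X p q) =
      Real.sqrt (s ^ (p + q)) * D.endNorm 1 F (D.comp F X p q) := by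
  rw [hb.endNorm_eq hF hs, hb.endNorm_eq hF one_pos, ← Real.sqrt_mul (zpow_nonneg hs.le _)]
  congr 1
  rw [Finset.mul_sum]
  refine Finset.sum_congr rfl fun k _ => ?_
  rw [Finset.mul_sum]
  refine Finset.sum_congr rfl fun i _ => ?_
  rw [hF.comp_eq_mult, hb.repr_mult hF]
  by_cases h : x k - x i = (p, q)
  · have h1 : (x k).1 - (x i).1 = p := congrArg Prod.fst h
    have h2 : (x k).2 - (x i).2 = q := congrArg Prod.snd h
    rw [show (x k).1 + (x k).2 - ((x i).1 + (x i).2) = p + q by omega, one_zpow, one_mul]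
  · simp [h]

/-- The norm on endomorphisms dominates the operator norm. -/
theorem hodgeForm_apply_le (X : E →L[ℂ] E) (u : E) :
    (D.hodgeForm 1 F (X u) (X u)).re ≤
      D.endNorm 1 F X ^ 2 * (D.hodgeForm 1 F u u).re := by
  have hh : ∀ u, (D.hodgeForm 1 F u u).re = ∑ i, ‖b.repr u i‖ ^ 2 := fun u => by
    rw [hb.hodgeForm_repr hF, Complex.re_sum]
    refine Finset.sum_congr rfl fun i _ => ?_
    rw [Complex.ofReal_one, one_zpow, one_mul, Complex.mul_conj, Complex.ofReal_re,
      Complex.normSq_eq_norm_sq]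
  rw [hh, hh, hb.endNorm_eq hF one_pos, Real.sq_sqrt (Finset.sum_nonneg fun k _ =>
    Finset.sum_nonneg fun i _ => by positivity), Finset.sum_mul]
  refine Finset.sum_le_sum fun k _ => ?_
  rw [repr_apply_eq_sum]
  simp only [one_zpow, one_mul]
  calc ‖∑ i, b.repr (X (b i)) k * b.repr u i‖ ^ 2
      ≤ (∑ i, ‖b.repr (X (b i)) k‖ * ‖b.repr u i‖) ^ 2 := by
        gcongr
        exact (norm_sum_le _ _).trans_eq (Finset.sum_congr rfl fun i _ => norm_mul _ _)
    _ ≤ _ := Finset.sum_mul_sq_le_sq_mul_sq _ _ _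

end IsAdapted

end Datum

/-! ### Similitudes and the scaling of `τ` and the twisted norm -/

namespace Datum

variable {E : Type*} [NormedAddCommGroup E] [NormedSpace ℂ E] [FiniteDimensional ℂ E]

variable {D : Datum E} {F : ℤ → Submodule ℂ E}

/-- A real automorphism `t` with inverse `t'` that preserves `W` and multiplies the form on `Gr^W_w`
by `c ^ w`. -/
structure IsSimilitude (D : Datum E) (c : ℝ) (t t' : E →L[ℂ] E) : Prop extends
    D.IsRealAut t t' where
  pos : 0 < c
  scale : ∀ w, ∀ u ∈ D.W w, ∀ v ∈ D.W w, D.S w (t u) (t v) = (c : ℂ) ^ w * D.S w u v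

namespace IsRealAut

variable {t t' : E →L[ℂ] E} (ht : D.IsRealAut t t')
include ht

theorem injective : Function.Injective t := injective_of_mul_eq_one ht.inv_mul

theorem conj_apply (v : E) : D.conj (t v) = t (D.conj v) := by
  rw [← bar_conj, ht.real]

theorem apply_mem_W {k : ℤ} {v : E} : t v ∈ D.W k ↔ v ∈ D.W k := by
  constructor
  · intro h
    rw [← ht.map_W] at h
    obtain ⟨u, hu, huv⟩ := h
    rwa [← ht.injective huv]
  · intro h
    rw [← ht.map_W]
    exact ⟨v, h, rfl⟩

theorem conjSub_map (P : Submodule ℂ E) :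
    D.conjSub (P.map (t : E →ₗ[ℂ] E)) = (D.conjSub P).map (t : E →ₗ[ℂ] E) := by
  rw [Datum.conjSub_map, ht.real]

theorem map_inf (P Q : Submodule ℂ E) : (P ⊓ Q).map (t : E →ₗ[ℂ] E) =
    P.map (t : E →ₗ[ℂ] E) ⊓ Q.map (t : E →ₗ[ℂ] E) :=
  Submodule.map_inf (t : E →ₗ[ℂ] E) ht.injective

theorem grFil_act (w p : ℤ) : D.grFil (act t F) w p = (D.grFil F w p).map (t : E →ₗ[ℂ] E) := by
  rw [grFil, grFil, Submodule.map_sup, ht.map_inf, ht.map_W, ht.map_W, act]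

theorem grHodge_act (p q : ℤ) : D.grHodge (act t F) p q = (D.grHodge F p q).map (t : E →ₗ[ℂ] E) := by
  rw [grHodge, grHodge, ht.grFil_act, ht.grFil_act, ht.conjSub_map, ht.map_inf]

end IsRealAut

theorem grFil_le_W (w p : ℤ) : D.grFil F w p ≤ D.W w :=
  sup_le inf_le_right (D.W_mono (by omega))

namespace IsSimilitude

variable {c : ℝ} {t t' : E →L[ℂ] E} (ht : D.IsSimilitude c t t')
include ht

theorem isGradedPolarizedMHS_act (hF : D.IsGradedPolarizedMHS F) :
    D.IsGradedPolarizedMHS (act t F) := by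
  have hr := ht.toIsRealAut
  refine ⟨fun p q h => Submodule.map_mono (hF.anti h), ?_, ?_, fun w p => ?_, fun w p => ?_,
    fun w p q h u hu v hv => ?_, fun p q u hu hu' => ?_, fun p q => ?_⟩
  · obtain ⟨p, hp⟩ := hF.eq_top
    refine ⟨p, eq_top_iff.2 fun v _ => ⟨t' v, ?_, DFunLike.congr_fun ht.mul_inv v⟩⟩
    rw [hp]
    trivial
  · obtain ⟨p, hp⟩ := hF.eq_bot
    exact ⟨p, by rw [act, hp, Submodule.map_bot]⟩
  · rw [hr.grFil_act, hr.grFil_act, hr.conjSub_map, ← Submodule.map_sup, hF.sup_eq, hr.map_W]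
  · rw [hr.grFil_act, hr.grFil_act, hr.conjSub_map, ← hr.map_inf, hF.inf_eq, hr.map_W]
  · rw [hr.grFil_act] at hu hv
    obtain ⟨u, hu, rfl⟩ := hu
    obtain ⟨v, hv, rfl⟩ := hv
    refine (ht.scale w u (grFil_le_W _ _ hu) v (grFil_le_W _ _ hv)).trans ?_
    rw [hF.orth w p q h u hu v hv, mul_zero]
  · rw [hr.grHodge_act] at hu
    obtain ⟨u, hu, rfl⟩ := hu
    have hW := grFil_le_W _ _ hu.1
    have h := hF.pos p q u hu fun h => hu' (hr.apply_mem_W.2 h)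
    change 0 < (Complex.I ^ (p - q) * D.S (p + q) (t u) (D.conj (t u))).re
    rw [hr.conj_apply, ht.scale _ u hW _ (D.W_real _ _ hW), mul_left_comm, ← Complex.ofReal_zpow,
      Complex.re_ofReal_mul]
    exact mul_pos (zpow_pos ht.pos _) h
  · rw [hr.grHodge_act, ← hF.hodge_number]
    exact (Submodule.equivMapOfInjective (t : E →ₗ[ℂ] E) hr.injective _).finrank_eq.symm

/-- The factor `c ^ (p + q)` on `I^{p,q}` has the same shape as the scaling by `s`; this is the
purpose of the parameter in `hodgeForm`. -/
theorem hodgeForm_act (hF : D.Decomposes F) (s : ℝ) (u v : E) :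
    D.hodgeForm s (act t F) (t u) (t v) = D.hodgeForm (s * c) F u v := by
  have hr := ht.toIsRealAut
  have hpr : ∀ x u, D.pr (act t F) x (t u) = t (D.pr F x u) := fun x u => by
    rw [hr.pr_act hF]
    change t (D.pr F x (t' (t u))) = _
    rw [show t' (t u) = u from DFunLike.congr_fun ht.inv_mul u]
  rw [hodgeForm_eq_finsum, hodgeForm_eq_finsum]
  refine finsum_congr fun x => ?_
  have h1 := bigr_le_W _ _ (hF.pr_mem x u)
  have h2 := bigr_le_W _ _ (hF.pr_mem x v)
  rw [hpr, hpr, hform, hform, hr.conj_apply, ht.scale _ _ h1 _ (D.W_real _ _ h2)]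
  push_cast
  rw [mul_zpow]
  ring

/-- By uniqueness the adjoint is transported by conjugation, and the trace is invariant under it. -/
theorem endNorm_act (hF : D.IsGradedPolarizedMHS F) {s : ℝ} (hs : 0 < s) (X : E →L[ℂ] E) :
    D.endNorm s (act t F) (t * X * t') = D.endNorm (s * c) F X := by
  have hF' := ht.isGradedPolarizedMHS_act hF
  obtain ⟨ι, _, _, b, x, hb⟩ := hF.exists_adapted
  obtain ⟨ι', _, _, b', x', hb'⟩ := hF'.exists_adapted
  have hadj : adjointWrt (D.hodgeForm s (act t F)) (t * X * t') =
      t * adjointWrt (D.hodgeForm (s * c) F) X * t' := by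
    refine hb'.adjoint_unique hF'.decomposes hs (hb'.adjointWrt_spec hF'.decomposes hs _)
      fun u v => ?_
    have hu : t (t' u) = u := DFunLike.congr_fun ht.mul_inv u
    have hv : t (t' v) = v := DFunLike.congr_fun ht.mul_inv v
    conv_rhs => rw [← hu]
    conv_lhs => rw [← hv]
    change D.hodgeForm s (act t F) (t (X (t' u))) (t (t' v)) =
      D.hodgeForm s (act t F) (t (t' u)) (t (adjointWrt (D.hodgeForm (s * c) F) X (t' v)))
    rw [ht.hodgeForm_act hF.decomposes, ht.hodgeForm_act hF.decomposes]
    exact hb.adjointWrt_spec hF.decomposes (mul_pos hs ht.pos) X _ _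
  rw [endNorm, endNorm, endForm, endForm, hadj]
  set Y := adjointWrt (D.hodgeForm (s * c) F) X
  rw [show t * X * t' * (t * Y * t') = t * X * (t' * t) * Y * t' by noncomm_ring, ht.inv_mul,
    mul_one, show t * X * Y * t' = t * (X * Y) * t' by noncomm_ring]
  have := LinearMap.trace_mul_cycle ℂ (t : E →ₗ[ℂ] E) ((X * Y : E →L[ℂ] E) : E →ₗ[ℂ] E)
    (t' : E →ₗ[ℂ] E)
  have h2 : (t' : E →ₗ[ℂ] E) * (t : E →ₗ[ℂ] E) = 1 := by
    ext v
    exact DFunLike.congr_fun ht.inv_mul v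
  rw [h2, one_mul] at this
  rw [← this]
  rfl

end IsSimilitude

theorem tau_eq (F : ℤ → Submodule ℂ E) : D.tau F = 1 + ∑ᶠ (x : ℤ × ℤ) (_ : x.1 < 0 ∧ x.2 < 0),
    D.endNorm 1 F (D.comp F (D.eps F) x.1 x.2) ^ (-2 / ((x.1 : ℝ) + (x.2 : ℝ))) := rfl

theorem endNorm_nonneg (s : ℝ) (F : ℤ → Submodule ℂ E) (X : E →L[ℂ] E) : 0 ≤ D.endNorm s F X :=
  Real.sqrt_nonneg _

theorem one_le_tau (F : ℤ → Submodule ℂ E) : 1 ≤ D.tau F := by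
  rw [tau_eq, le_add_iff_nonneg_right]
  exact finsum_nonneg fun x => finsum_nonneg fun _ => Real.rpow_nonneg (endNorm_nonneg _ _ _) _

/-- `‖ε^{p,q}‖` acquires the factor `c ^ ((p + q) / 2)`, and the power `-2 / (p + q)` makes it `c⁻¹`
whatever the type. The summand `1` of `τ` does not scale. -/
theorem IsSimilitude.tau_act {c : ℝ} {t t' : E →L[ℂ] E} (ht : D.IsSimilitude c t t')
    (hF : D.IsGradedPolarizedMHS F) : D.tau (act t F) * c = c + (D.tau F - 1) := by
  have hr := ht.toIsRealAut
  have hF' := ht.isGradedPolarizedMHS_act hF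
  obtain ⟨ι, _, _, b, x, hb⟩ := hF.exists_adapted
  have hc := ht.pos
  have key : ∀ y : ℤ × ℤ,
      (∑ᶠ (_ : y.1 < 0 ∧ y.2 < 0), D.endNorm 1 (act t F) (D.comp (act t F) (D.eps (act t F)) y.1 y.2) ^
        (-2 / ((y.1 : ℝ) + (y.2 : ℝ)))) = c⁻¹ • ∑ᶠ (_ : y.1 < 0 ∧ y.2 < 0),
        D.endNorm 1 F (D.comp F (D.eps F) y.1 y.2) ^ (-2 / ((y.1 : ℝ) + (y.2 : ℝ))) := by
    intro y
    rw [finsum_eq_if, finsum_eq_if]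
    split_ifs with hy
    · rw [hr.eps_act hF hF', hr.comp_act hF.decomposes, ht.endNorm_act hF one_pos, one_mul,
        hb.endNorm_comp hF.decomposes hc, Real.mul_rpow (Real.sqrt_nonneg _) (endNorm_nonneg _ _ _),
        smul_eq_mul, Real.sqrt_eq_rpow, ← Real.rpow_intCast, ← Real.rpow_mul hc.le,
        ← Real.rpow_mul hc.le]
      have hne : ((y.1 : ℝ) + (y.2 : ℝ)) ≠ 0 := by
        have : y.1 + y.2 < 0 := by omega
        have : ((y.1 + y.2 : ℤ) : ℝ) < 0 := by exact_mod_cast this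
        push_cast at this
        exact this.ne
      rw [show ((y.1 + y.2 : ℤ) : ℝ) * (1 / 2) * (-2 / ((y.1 : ℝ) + (y.2 : ℝ))) = -1 by
        push_cast
        field_simp, Real.rpow_neg_one]
    · simp
  rw [tau_eq, tau_eq]
  simp_rw [key]
  rw [← smul_finsum, smul_eq_mul, add_mul, one_mul, mul_right_comm, inv_mul_cancel₀ hc.ne', one_mul,
    add_sub_cancel_left]

/-- The similitude enters only through the positive summand `c`, so the parameter is at least `D.tau
F - 1` uniformly in `t`. -/
theorem IsSimilitude.twistedNorm_act {c : ℝ} {t t' : E →L[ℂ] E} (ht : D.IsSimilitude c t t')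
    (hF : D.IsGradedPolarizedMHS F) (X : E →L[ℂ] E) :
    D.twistedNorm (act t F) (t * X * t') = D.endNorm (c + (D.tau F - 1)) F (D.qPart F X) := by
  rw [twistedNorm, ht.qPart_act hF.decomposes, ht.endNorm_act hF
    (one_pos.trans_le (one_le_tau _)), ht.tau_act hF]

variable (D) in
/-- The weights of mixed Hodge structures lie in an interval that depends only on `W`. -/
theorem exists_weight_bound : ∃ M : ℕ, ∀ F, D.IsGradedPolarizedMHS F →
    ∀ x y : ℤ × ℤ, D.bigr F x.1 x.2 ≠ ⊥ → D.bigr F y.1 y.2 ≠ ⊥ → x.1 + x.2 - (y.1 + y.2) ≤ M := by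
  obtain ⟨k, hk⟩ := D.W_bot
  obtain ⟨l, hl⟩ := D.W_top
  refine ⟨(l - k).toNat, fun F hF x y hx hy => ?_⟩
  have h1 : k < y.1 + y.2 := by
    by_contra hle
    exact hy (eq_bot_iff.2 ((bigr_le_W _ _).trans ((D.W_mono (not_lt.1 hle)).trans hk.le)))
  have h2 : x.1 + x.2 ≤ l := by
    by_contra hlt
    refine hx ((Submodule.eq_bot_iff _).2 fun v hv => hF.bigr_inf_W hv ?_)
    refine D.W_mono (show l ≤ _ by omega) ?_
    rw [hl]
    trivial
  have := Int.self_le_toNat (l - k)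
  omega

/-- On tangent vectors only weight drops `n` with `0 ≤ n ≤ M` occur, and their squared entries carry
`s ^ (-n)`; the ratio for the two parameters is at most `κ ^ n`. -/
theorem endNorm_qPart_le {M : ℕ} (hF : D.IsGradedPolarizedMHS F)
    (hM : ∀ x y : ℤ × ℤ, D.bigr F x.1 x.2 ≠ ⊥ → D.bigr F y.1 y.2 ≠ ⊥ →
      x.1 + x.2 - (y.1 + y.2) ≤ M) {κ s s' : ℝ} (hκ : 1 ≤ κ) (hs : 0 < s) (hs' : 0 < s')
    (h : s ≤ κ * s') (X : E →L[ℂ] E) :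
    D.endNorm s' F (D.qPart F X) ≤ κ ^ M * D.endNorm s F (D.qPart F X) := by
  obtain ⟨ι, _, _, b, x, hb⟩ := hF.exists_adapted
  have hκ0 : 0 < κ := one_pos.trans_le hκ
  have hne : ∀ i, D.bigr F (x i).1 (x i).2 ≠ ⊥ := fun i h => by
    have := hb.mem i
    rw [h, Submodule.mem_bot] at this
    exact b.ne_zero i this
  rw [hb.endNorm_eq hF.decomposes hs', hb.endNorm_eq hF.decomposes hs,
    ← Real.sqrt_sq (pow_nonneg hκ0.le M), ← Real.sqrt_mul (sq_nonneg _)]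
  refine Real.sqrt_le_sqrt ?_
  rw [Finset.mul_sum]
  refine Finset.sum_le_sum fun k _ => ?_
  rw [Finset.mul_sum]
  refine Finset.sum_le_sum fun i _ => ?_
  rw [hF.decomposes.qPart_eq_mult, hb.repr_mult hF.decomposes]
  split_ifs with hd
  · rw [← mul_assoc]
    refine mul_le_mul_of_nonneg_right ?_ (sq_nonneg _)
    obtain ⟨n, hn⟩ : ∃ n : ℕ, (x k).1 + (x k).2 - ((x i).1 + (x i).2) = -(n : ℤ) := by
      refine ⟨((x i).1 + (x i).2 - ((x k).1 + (x k).2)).toNat, ?_⟩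
      have := hd.2
      simp only [Prod.fst_sub, Prod.snd_sub] at this
      omega
    have hnM : n ≤ M := by
      have := hM (x i) (x k) (hne i) (hne k)
      omega
    rw [hn, zpow_neg, zpow_neg, zpow_natCast, zpow_natCast, ← div_eq_mul_inv,
      le_div_iff₀ (pow_pos hs n), inv_mul_le_iff₀ (pow_pos hs' n)]
    calc s ^ n ≤ (κ * s') ^ n := pow_le_pow_left₀ hs.le h n
      _ = s' ^ n * κ ^ n := by rw [mul_pow, mul_comm]
      -- After the square root `κ ^ (M / 2)` would suffice; `κ ^ M` avoids a fractional exponent.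
      _ ≤ s' ^ n * (κ ^ M) ^ 2 := by
        refine mul_le_mul_of_nonneg_left ?_ (pow_pos hs' n).le
        rw [← pow_mul]
        exact pow_le_pow_right₀ hκ (by omega)
  · simp

end Datum

/-! ### `t(y)` is a similitude -/

namespace Datum

variable {E : Type*} [NormedAddCommGroup E] [NormedSpace ℂ E] [FiniteDimensional ℂ E]

variable {D : Datum E}

theorem exp_apply_mem {P : Submodule ℂ E} {X : E →L[ℂ] E} (hX : ∀ v ∈ P, X v ∈ P) {v : E}
    (hv : v ∈ P) : (NormedSpace.exp X : E →L[ℂ] E) v ∈ P := by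
  have hs := (NormedSpace.exp_series_hasSum_exp' (𝕂 := ℂ) X).mapL (ContinuousLinearMap.apply ℂ E v)
  refine P.closed_of_finiteDimensional.mem_of_tendsto hs (Filter.Eventually.of_forall fun s => ?_)
  refine sum_mem fun n _ => ?_
  have hpow : ∀ n, (X ^ n) v ∈ P := fun n => by
    induction n with
    | zero => exact hv
    | succ n ih => rw [pow_succ']; exact hX _ ih
  exact P.smul_mem _ (hpow n)

/-- The exponential of an infinitesimal similitude. -/
theorem S_exp {w : ℤ} {a : ℂ} {X : E →L[ℂ] E} (hW : ∀ v ∈ D.W w, X v ∈ D.W w)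
    (hX : ∀ u ∈ D.W w, ∀ v ∈ D.W w, D.S w (X u) v + D.S w u (X v) = a * D.S w u v) {u v : E}
    (hu : u ∈ D.W w) (hv : v ∈ D.W w) (z : ℂ) :
    D.S w (NormedSpace.exp (z • X) u) (NormedSpace.exp (z • X) v) =
      Complex.exp (z * a) * D.S w u v := by
  let B : E →L[ℂ] E →L[ℂ] ℂ := (D.S w).toContinuousBilinearMap
  have hB : ∀ u v, B u v = D.S w u v := fun u v => rfl
  -- The transported form divided by its expected growth has derivative zero, hence keeps its value
  -- at `z = 0`.
  let f : ℂ → ℂ := fun z => Complex.exp (-(z * a)) *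
    B ((NormedSpace.exp (z • X) : E →L[ℂ] E) u) ((NormedSpace.exp (z • X) : E →L[ℂ] E) v)
  have hmem : ∀ (z : ℂ), ∀ v ∈ D.W w, (NormedSpace.exp (z • X) : E →L[ℂ] E) v ∈ D.W w :=
    fun z v hv => exp_apply_mem (fun v hv => (D.W w).smul_mem z (hW v hv)) hv
  have hexp : ∀ (v : E) (z : ℂ), HasDerivAt (fun z : ℂ => (NormedSpace.exp (z • X) : E →L[ℂ] E) v)
      (X ((NormedSpace.exp (z • X) : E →L[ℂ] E) v)) z := fun v z =>
    (ContinuousLinearMap.apply ℂ E v).hasFDerivAt.comp_hasDerivAt z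
      (hasDerivAt_exp_smul_const' X z)
  have hf : ∀ z, HasDerivAt f 0 z := fun z => by
    have h1 : HasDerivAt (fun z : ℂ => Complex.exp (-(z * a))) (Complex.exp (-(z * a)) * (-a)) z := by
      have := ((hasDerivAt_id z).mul_const a).neg.cexp
      simpa using this
    have h2 := ContinuousLinearMap.hasDerivAt_of_bilinear (B := B) (fun _ => hexp u z)
      (fun _ => hexp v z)
    have h3 := h1.mul h2
    refine h3.congr_deriv ?_
    have := hX _ (hmem z u hu) _ (hmem z v hv)
    simp only [hB]
    rw [add_comm (D.S w _ (X _)), this]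
    ring
  have hconst : f z = f 0 :=
    is_const_of_deriv_eq_zero (fun z => (hf z).differentiableAt) (fun z => (hf z).deriv) z 0
  simp only [f, zero_mul, neg_zero, Complex.exp_zero, zero_smul, NormedSpace.exp_zero,
    one_mul, hB] at hconst
  rw [show (1 : E →L[ℂ] E) u = u from rfl, show (1 : E →L[ℂ] E) v = v from rfl] at hconst
  rw [← hconst, ← mul_assoc, ← Complex.exp_add, add_neg_cancel, Complex.exp_zero, one_mul]

theorem isSimilitude_exp {a : ℝ} {X : E →L[ℂ] E} (hr : D.IsReal X)
    (hW : ∀ k, ∀ v ∈ D.W k, X v ∈ D.W k)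
    (hX : ∀ w, ∀ u ∈ D.W w, ∀ v ∈ D.W w,
      D.S w (X u) v + D.S w u (X v) = ((a * w : ℝ) : ℂ) * D.S w u v) (r : ℝ) :
    D.IsSimilitude (Real.exp (r * a)) (NormedSpace.exp ((r : ℂ) • X))
      (NormedSpace.exp (-((r : ℂ) • X))) where
  mul_inv := exp_mul_exp_neg _
  inv_mul := exp_neg_mul_exp _
  real := by rw [D.bar_exp, D.bar_smul, Complex.conj_ofReal, D.isReal_iff.1 hr]
  map_W k := by
    have key : ∀ z : ℂ, ∀ v ∈ D.W k, (NormedSpace.exp (z • X) : E →L[ℂ] E) v ∈ D.W k :=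
      fun z v hv => exp_apply_mem (fun v hv => (D.W k).smul_mem z (hW k v hv)) hv
    refine le_antisymm (Submodule.map_le_iff_le_comap.2 fun v hv => key _ v hv) fun v hv => ?_
    refine ⟨_, key (-r) v hv, ?_⟩
    rw [neg_smul]
    exact DFunLike.congr_fun (exp_mul_exp_neg ((r : ℂ) • X)) v
  pos := Real.exp_pos _
  scale w u hu v hv := by
    rw [S_exp (hW w) (hX w) hu hv, Complex.ofReal_exp, ← Complex.exp_int_mul]
    congr 2
    push_cast
    ring

theorem IsSimilitude.mul {c d : ℝ} {t t' u u' : E →L[ℂ] E} (ht : D.IsSimilitude c t t')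
    (hu : D.IsSimilitude d u u') : D.IsSimilitude (c * d) (t * u) (u' * t') where
  mul_inv := by
    rw [show t * u * (u' * t') = t * (u * u') * t' by noncomm_ring, hu.mul_inv, mul_one, ht.mul_inv]
  inv_mul := by
    rw [show u' * t' * (t * u) = u' * (t' * t) * u by noncomm_ring, ht.inv_mul, mul_one, hu.inv_mul]
  real := by rw [map_mul, ht.real, hu.real]
  map_W k := by
    have := Submodule.map_comp (u : E →ₗ[ℂ] E) (t : E →ₗ[ℂ] E) (D.W k)
    rw [hu.map_W, ht.map_W] at this
    exact this
  pos := mul_pos ht.pos hu.pos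
  scale w x hx y hy := by
    change D.S w (t (u x)) (t (u y)) = _
    rw [ht.scale w _ (hu.apply_mem_W.2 hx) _ (hu.apply_mem_W.2 hy), hu.scale w x hx y hy]
    push_cast
    rw [mul_zpow, mul_assoc]

theorem isSimilitude_one : D.IsSimilitude 1 (1 : E →L[ℂ] E) 1 where
  mul_inv := one_mul 1
  inv_mul := one_mul 1
  real := map_one _
  map_W k := Submodule.map_id _
  pos := one_pos
  scale w u _ v _ := by simp

theorem exists_isSimilitude_prod (l : List (E →L[ℂ] E))
    (hl : ∀ t ∈ l, ∃ t', D.IsSimilitude 1 t t') : ∃ t', D.IsSimilitude 1 l.prod t' := by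
  induction l with
  | nil => exact ⟨1, isSimilitude_one⟩
  | cons t l ih =>
    obtain ⟨t', ht⟩ := hl t (by simp)
    obtain ⟨u', hu⟩ := ih fun u hu => hl u (by simp [hu])
    rw [List.prod_cons]
    have := ht.mul hu
    rw [one_mul] at this
    exact ⟨_, this⟩

theorem powEnd_neg_half (y : ℝ) (X : E →L[ℂ] E) :
    powEnd y (-((1 / 2 : ℂ) • X)) = NormedSpace.exp (((-(Real.log y / 2) : ℝ) : ℂ) • X) := by
  rw [powEnd, smul_neg, smul_smul, ← neg_smul]
  congr 2
  push_cast
  ring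

theorem IsRealGrading.apply_sub_mem {Y : E →L[ℂ] E} (hY : D.IsRealGrading Y) (w : ℤ) {v : E}
    (hv : v ∈ D.W w) : Y v - (w : ℂ) • v ∈ D.W (w - 1) := by
  revert v
  have h : ∀ v ∈ D.W w, Y v - (w : ℂ) • v ∈ D.W (w - 1) := by
    revert w
    refine W_induction (D := D) (fun w hw v hv => ?_) fun w ih v hv => ?_
    · rw [hw, Submodule.mem_bot] at hv
      rw [hv, map_zero, smul_zero, sub_zero]
      exact zero_mem _
    · rw [← hY.sup_eq] at hv
      obtain ⟨a, ha, e, he, rfl⟩ := Submodule.mem_sup.1 hv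
      have he' : Y e = (w : ℂ) • e := Module.End.mem_eigenspace_iff.1 he
      rw [map_add, he', smul_add, add_sub_add_right_eq_sub]
      have h1 := D.W_mono (show w - 1 - 1 ≤ w - 1 by omega) (ih a ha)
      have h2 : Y a ∈ D.W (w - 1) := by
        simpa using add_mem h1 ((D.W (w - 1)).smul_mem ((w - 1 : ℤ) : ℂ) ha)
      exact sub_mem h2 ((D.W (w - 1)).smul_mem _ ha)
  exact fun v hv => h v hv

theorem S_left_eq_zero {w : ℤ} {u v : E} (hu : u ∈ D.W (w - 1)) (hv : v ∈ D.W w) :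
    D.S w u v = 0 :=
  (D.S_nondeg w u (D.W_mono (by omega) hu)).2 hu v hv

theorem S_right_eq_zero {w : ℤ} {u v : E} (hu : u ∈ D.W w) (hv : v ∈ D.W (w - 1)) :
    D.S w u v = 0 := by
  rw [D.S_symm w u hu v (D.W_mono (by omega) hv), S_left_eq_zero hv hu, mul_zero]

/-- `Y₀` acts as `w` on `Gr^W_w`, so the two arguments together contribute `2 * w`, and the exponent
`-(log y) / 2` yields the factor `(y 0)⁻¹`. The `H j` are infinitesimal isometries and contribute
`1`. -/
theorem TwistDatum.isSimilitude_t {r : ℕ} [NeZero r] (T : D.TwistDatum r) {y : Fin r → ℝ}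
    (hy : ∀ j, 0 < y j) : D.IsSimilitude (y 0)⁻¹ (T.t y) (Ring.inverse (T.t y)) := by
  have hYW : ∀ k, ∀ v ∈ D.W k, T.Y₀ v ∈ D.W k := fun k v hv => by
    simpa using add_mem (D.W_mono (show k - 1 ≤ k by omega) (T.grading.apply_sub_mem k hv))
      ((D.W k).smul_mem (k : ℂ) hv)
  have h0 := isSimilitude_exp (a := 2) T.grading.real hYW (fun w u hu v hv => by
    have h1 : D.S w (T.Y₀ u) v = w * D.S w u v := by
      have := S_left_eq_zero (T.grading.apply_sub_mem w hu) hv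
      rw [map_sub, map_smul, LinearMap.sub_apply, sub_eq_zero] at this
      simpa using this
    have h2 : D.S w u (T.Y₀ v) = w * D.S w u v := by
      have := S_right_eq_zero hu (T.grading.apply_sub_mem w hv)
      rw [map_sub, map_smul, sub_eq_zero] at this
      simpa using this
    rw [h1, h2]
    push_cast
    ring) (-(Real.log (y 0) / 2))
  rw [show -(Real.log (y 0) / 2) * 2 = -Real.log (y 0) by ring, Real.exp_neg,
    Real.exp_log (hy 0), ← powEnd_neg_half] at h0
  obtain ⟨u', hu⟩ := exists_isSimilitude_prod (D := D)
    (List.ofFn fun j => powEnd (y j) (-((1 / 2 : ℂ) • T.H j))) (fun t ht => by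
      obtain ⟨j, rfl⟩ := (List.mem_ofFn' _ _).1 ht
      have hj := T.H_mem j
      have := isSimilitude_exp (a := 0) hj.1 hj.2.1 (fun w u hu v hv => by
        rw [hj.2.2 w u hu v hv]
        simp) (-(Real.log (y j) / 2))
      rw [mul_zero, Real.exp_zero, ← powEnd_neg_half] at this
      exact ⟨_, this⟩)
  have h := h0.mul hu
  rw [mul_one] at h
  have hinv := Ring.inverse_unit (⟨_, _, h.mul_inv, h.inv_mul⟩ : (E →L[ℂ] E)ˣ)
  change D.IsSimilitude _ _ (Ring.inverse (powEnd (y 0) (-((1 / 2 : ℂ) • T.Y₀)) *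
    (List.ofFn fun j => powEnd (y j) (-((1 / 2 : ℂ) • T.H j))).prod))
  rw [show Ring.inverse (powEnd (y 0) (-((1 / 2 : ℂ) • T.Y₀)) *
    (List.ofFn fun j => powEnd (y j) (-((1 / 2 : ℂ) • T.H j))).prod) = _ from hinv]
  exact h

end Datum

theorem isUnit_of_injective {E : Type*} [NormedAddCommGroup E] [NormedSpace ℂ E]
    [FiniteDimensional ℂ E] {T : E →L[ℂ] E} (h : ∀ v, T v = 0 → v = 0) : IsUnit T := by
  have := FiniteDimensional.complete ℂ E
  rw [ContinuousLinearMap.isUnit_iff_bijective]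
  have hinj : Function.Injective (T : E →ₗ[ℂ] E) := (injective_iff_map_eq_zero _).2 h
  exact ⟨hinj, LinearMap.injective_iff_surjective.1 hinj⟩

/-! ### Continuity of the Deligne projections on `𝓜` -/

namespace Datum

variable {E : Type*} [NormedAddCommGroup E] [NormedSpace ℂ E] [FiniteDimensional ℂ E]

variable {D : Datum E} {F : ℤ → Submodule ℂ E}

variable (D) in
/-- The indices of the nonzero `I^{p,q}` lie in a finite set that depends only on the datum. -/
theorem exists_index_finset : ∃ J : Finset (ℤ × ℤ), ∀ F, D.IsGradedPolarizedMHS F →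
    ∀ x ∉ J, D.pr F x = 0 := by
  obtain ⟨k, hk⟩ := D.W_bot
  obtain ⟨l, hl⟩ := D.W_top
  refine ⟨(Finset.Ioc k l).biUnion fun w => (D.h_finite w).toFinset.image fun p => (p, w - p),
    fun F hF x hx => ?_⟩
  have hbot : D.bigr F x.1 x.2 = ⊥ := by
    by_contra hne
    refine hx (Finset.mem_biUnion.2 ⟨x.1 + x.2, Finset.mem_Ioc.2 ⟨?_, ?_⟩, Finset.mem_image.2
      ⟨x.1, ?_, by ext <;> simp⟩⟩)
    · by_contra hle
      exact hne (eq_bot_iff.2 ((bigr_le_W _ _).trans ((D.W_mono (not_lt.1 hle)).trans hk.le)))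
    · by_contra hlt
      refine hne ((Submodule.eq_bot_iff _).2 fun v hv => hF.bigr_inf_W hv ?_)
      refine D.W_mono (show l ≤ _ by omega) ?_
      rw [hl]
      trivial
    -- A vanishing Hodge number forces `grHodge` to equal `W (p + q - 1)`, which meets `I^{p,q}`
    -- trivially.
    · rw [Set.Finite.mem_toFinset, Function.mem_support, add_sub_cancel_left]
      intro h0
      have hfin := hF.hodge_number x.1 x.2
      rw [h0, add_zero] at hfin
      have hle : D.W (x.1 + x.2 - 1) ≤ D.grHodge F x.1 x.2 := fun v hv =>
        ⟨le_sup_right (a := F x.1 ⊓ D.W (x.1 + x.2)) hv,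
          le_sup_right (a := F x.2 ⊓ D.W (x.1 + x.2)) (D.W_real _ _ hv)⟩
      have heq := Submodule.eq_of_le_of_finrank_eq hle hfin.symm
      refine hne ((Submodule.eq_bot_iff _).2 fun v hv => hF.bigr_inf_W hv ?_)
      rw [heq]
      exact hF.bigr_le_grHodge _ _ hv
  ext v
  have := hF.decomposes.pr_mem x v
  rw [hbot, Submodule.mem_bot] at this
  exact this

open Classical in
/-- The projection onto the sum of the `I^x` with `x` in a set `s`; `J` contains all the indices. -/
def setProj (D : Datum E) (J : Finset (ℤ × ℤ)) (F : ℤ → Submodule ℂ E) (s : Set (ℤ × ℤ)) :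
    E →L[ℂ] E := ∑ x ∈ J, if x ∈ s then D.pr F x else 0

section SetProj

variable {J : Finset (ℤ × ℤ)} (hF : D.Decomposes F) (hJ : ∀ x ∉ J, D.pr F x = 0)
include hF hJ

open Classical in
theorem pr_mul_setProj (s : Set (ℤ × ℤ)) (x : ℤ × ℤ) :
    D.pr F x * D.setProj J F s = if x ∈ s then D.pr F x else 0 := by
  rw [setProj, Finset.mul_sum, Finset.sum_eq_single x]
  · split_ifs
    · exact hF.isBigrading.idem x
    · exact mul_zero _
  · intro y _ hy
    split_ifs
    · exact hF.isBigrading.orth x y hy.symm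
    · exact mul_zero _
  · intro hx
    rw [hJ x hx, zero_mul]

theorem setProj_mem (s : Set (ℤ × ℤ)) (v : E) : D.setProj J F s v ∈ D.bigrSet F s := by
  rw [hF.mem_bigrSet_iff]
  intro x hx
  have := pr_mul_setProj hF hJ s x
  rw [if_neg hx] at this
  exact DFunLike.congr_fun this v

theorem eq_of_pr_eq {u v : E} (h : ∀ x, D.pr F x u = D.pr F x v) : u = v := by
  have : ∀ w : E, w = ∑ x ∈ hF.isBigrading.finite.toFinset, D.pr F x w := fun w => by
    rw [← sum_apply, hF.isBigrading.sum_finset]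
    rfl
  rw [this u, this v]
  exact Finset.sum_congr rfl fun x _ => h x

theorem setProj_of_mem {s : Set (ℤ × ℤ)} {v : E} (hv : v ∈ D.bigrSet F s) :
    D.setProj J F s v = v := by
  refine eq_of_pr_eq hF hJ fun x => ?_
  have := DFunLike.congr_fun (pr_mul_setProj hF hJ s x) v
  refine this.trans ?_
  split_ifs with hx
  · rfl
  · exact (hF.mem_bigrSet_iff.1 hv x hx).symm

theorem setProj_of_mem_compl {s : Set (ℤ × ℤ)} {v : E} (hv : v ∈ D.bigrSet F sᶜ) :
    D.setProj J F s v = 0 := by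
  refine eq_of_pr_eq hF hJ fun x => ?_
  have := DFunLike.congr_fun (pr_mul_setProj hF hJ s x) v
  refine this.trans ?_
  rw [map_zero]
  split_ifs with hx
  · exact hF.mem_bigrSet_iff.1 hv x (fun h => h hx)
  · rfl

theorem sub_setProj_mem (s : Set (ℤ × ℤ)) (v : E) : v - D.setProj J F s v ∈ D.bigrSet F sᶜ := by
  rw [hF.mem_bigrSet_iff]
  intro x hx
  have h2 := DFunLike.congr_fun (pr_mul_setProj hF hJ s x) v
  rw [if_pos (not_not.1 hx)] at h2
  rw [map_sub, sub_eq_zero]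
  exact h2.symm

end SetProj

theorem setProj_row (J : Finset (ℤ × ℤ)) (F : ℤ → Submodule ℂ E) (p : ℤ) :
    D.setProj J F {x | x.1 = p} =
      D.setProj J F {x | p ≤ x.1} - D.setProj J F {x | p + 1 ≤ x.1} := by
  classical
  rw [setProj, setProj, setProj, ← Finset.sum_sub_distrib]
  refine Finset.sum_congr rfl fun x _ => ?_
  simp only [Set.mem_ofPred_eq]
  by_cases h1 : x.1 = p
  · rw [if_pos h1, if_pos h1.ge, if_neg (by omega), sub_zero]
  · by_cases h2 : p ≤ x.1
    · rw [if_neg h1, if_pos h2, if_pos (by omega), sub_self]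
    · rw [if_neg h1, if_neg h2, if_neg (by omega), sub_zero]

/-- The complement of `F p` depends only on `conj F` and `W`; under `g ∈ GC` it is therefore moved
by the conjugate of `g`. -/
theorem IsGradedPolarizedMHS.bigrSet_lt_eq_opp (hF : D.IsGradedPolarizedMHS F) {l : ℤ}
    (hl : D.W l = ⊤) (p : ℤ) : D.bigrSet F {x | x.1 < p} = D.opp F p l := by
  refine le_antisymm (bigrSet_le_iff.2 fun a b hab v hv => ?_)
    ((hF.opp_le_bigrSet p l).trans (bigrSet_mono fun x hx => hx.1))
  exact hF.opp_inf_W (hF.bigr_le_opp hab le_rfl hv) (hl ▸ Submodule.mem_top)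

section GC

variable {g : E →L[ℂ] E} (hg : g ∈ D.GC)
include hg

theorem injective_of_mem_GC : Function.Injective g := by
  obtain ⟨u, rfl⟩ := hg.1
  exact injective_of_mul_eq_one u.inv_mul

theorem injective_bar_of_mem_GC : Function.Injective (D.bar g) := by
  obtain ⟨u, rfl⟩ := hg.1
  refine injective_of_mul_eq_one (g' := D.bar ↑u⁻¹) ?_
  rw [← map_mul, u.inv_mul, map_one]

theorem map_bar_W_of_mem_GC (k : ℤ) : (D.W k).map (D.bar g : E →ₗ[ℂ] E) = D.W k := by
  have h : D.conjSub (D.W k) = D.W k := by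
    ext v
    exact D.conj_mem_W
  have := conjSub_map (D := D) g (D.W k)
  rw [hg.2.1, h] at this
  exact this.symm

theorem map_bar_bigrSet (hF : D.IsGradedPolarizedMHS F) (hF' : D.IsGradedPolarizedMHS (act g F))
    (p : ℤ) : D.bigrSet (act g F) {x | x.1 < p} =
      (D.bigrSet F {x | x.1 < p}).map (D.bar g : E →ₗ[ℂ] E) := by
  obtain ⟨l, hl⟩ := D.W_top
  rw [hF.bigrSet_lt_eq_opp hl, hF'.bigrSet_lt_eq_opp hl, opp_act (injective_bar_of_mem_GC hg)
    (map_bar_W_of_mem_GC hg)]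

variable {J : Finset (ℤ × ℤ)} (hJ : ∀ F, D.IsGradedPolarizedMHS F → ∀ x ∉ J, D.pr F x = 0)
  (hF : D.IsGradedPolarizedMHS F) (hF' : D.IsGradedPolarizedMHS (act g F))
include hJ hF hF'

/-- `g` carries the image of `P` to that of the new projector and `D.bar g` does so for the kernels.
Their combination `g P + bar g (1 - P)` intertwines the two, giving a formula continuous in `g`. -/
theorem setProj_act (p : ℤ) :
    IsUnit (g * D.setProj J F {x | p ≤ x.1} + D.bar g * (1 - D.setProj J F {x | p ≤ x.1})) ∧
    D.setProj J (act g F) {x | p ≤ x.1} = g * D.setProj J F {x | p ≤ x.1} *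
      Ring.inverse (g * D.setProj J F {x | p ≤ x.1} +
        D.bar g * (1 - D.setProj J F {x | p ≤ x.1})) := by
  set P := D.setProj J F {x | p ≤ x.1} with hP
  set P' := D.setProj J (act g F) {x | p ≤ x.1} with hP'
  have hc : {x : ℤ × ℤ | p ≤ x.1}ᶜ = {x | x.1 < p} := by
    ext x
    simp
  have h1 : ∀ v, P' (g (P v)) = g (P v) := fun v => by
    refine setProj_of_mem hF'.decomposes (hJ _ hF') ?_
    rw [← hF'.F_eq]
    refine ⟨_, ?_, rfl⟩
    rw [SetLike.mem_coe, hF.F_eq]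
    exact setProj_mem hF.decomposes (hJ _ hF) _ v
  have h2 : ∀ v, P' (D.bar g (v - P v)) = 0 := fun v => by
    refine setProj_of_mem_compl hF'.decomposes (hJ _ hF') ?_
    rw [hc, map_bar_bigrSet hg hF hF']
    refine ⟨_, ?_, rfl⟩
    rw [← hc]
    exact sub_setProj_mem hF.decomposes (hJ _ hF) _ v
  have hPT : P' * (g * P + D.bar g * (1 - P)) = g * P := by
    ext v
    change P' (g (P v) + D.bar g (v - P v)) = g (P v)
    rw [map_add, h1, h2, add_zero]
  have hu : IsUnit (g * P + D.bar g * (1 - P)) := by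
    refine isUnit_of_injective fun v hv => ?_
    have h3 : g (P v) = 0 := by
      have := DFunLike.congr_fun hPT v
      change P' ((g * P + D.bar g * (1 - P)) v) = g (P v) at this
      rw [← this, hv, map_zero]
    have h4 : D.bar g (v - P v) = 0 := by
      change g (P v) + D.bar g (v - P v) = 0 at hv
      rwa [h3, zero_add] at hv
    have h5 := (injective_iff_map_eq_zero g).1 (injective_of_mem_GC hg) _ h3
    have h6 := (injective_iff_map_eq_zero (D.bar g)).1 (injective_bar_of_mem_GC hg) _ h4
    rwa [h5, sub_zero] at h6
  refine ⟨hu, ?_⟩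
  calc P' = P' * ((g * P + D.bar g * (1 - P)) * Ring.inverse (g * P + D.bar g * (1 - P))) := by
        rw [Ring.mul_inverse_cancel _ hu, mul_one]
    _ = g * P * Ring.inverse (g * P + D.bar g * (1 - P)) := by rw [← mul_assoc, hPT]

/-- The element that carries the bigrading of `F` to that of `act g F`. -/
def transport (D : Datum E) (J : Finset (ℤ × ℤ)) (F : ℤ → Submodule ℂ E) (g : E →L[ℂ] E) :
    E →L[ℂ] E :=
  ∑ p ∈ J.image Prod.fst, D.setProj J (act g F) {x | x.1 = p} * D.bar g *
    D.setProj J F {x | x.1 = p}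

theorem transport_apply {x : ℤ × ℤ} {v : E} (hv : v ∈ D.bigr F x.1 x.2) :
    D.transport J F g v = D.setProj J (act g F) {y | y.1 = x.1} (D.bar g v) := by
  rw [transport, sum_apply]
  change ∑ p ∈ J.image Prod.fst, D.setProj J (act g F) {x | x.1 = p} (D.bar g
    (D.setProj J F {x | x.1 = p} v)) = _
  have hne : ∀ p, p ≠ x.1 → D.setProj J F {x | x.1 = p} v = 0 := fun p hp =>
    setProj_of_mem_compl hF.decomposes (hJ _ hF)
      (bigr_le_bigrSet (s := {x : ℤ × ℤ | x.1 = p}ᶜ) (p := x.1) (q := x.2)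
        (fun h : x.1 = p => hp h.symm) hv)
  rw [Finset.sum_eq_single x.1]
  · rw [setProj_of_mem hF.decomposes (hJ _ hF) (bigr_le_bigrSet
      (s := {y : ℤ × ℤ | y.1 = x.1}) (p := x.1) (q := x.2) (show x.1 = x.1 from rfl) hv)]
  · intro p _ hp
    rw [hne p hp, map_zero, map_zero]
  · intro hx
    have hxJ : x ∉ J := fun h => hx (Finset.mem_image_of_mem _ h)
    have : v = 0 := by
      rw [← hF.decomposes.pr_of_mem hv, hJ _ hF x hxJ]
      rfl
    rw [this]
    simp

theorem bar_apply_mem {x : ℤ × ℤ} {v : E} (hv : v ∈ D.bigr F x.1 x.2) :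
    D.bar g v ∈ D.bigrSet (act g F) {y | y = x ∨ y.1 < x.1 ∧ y.1 + y.2 ≤ x.1 + x.2} := by
  have := hF'.pre_eq_bigrSet x.1 x.2
  rw [Prod.mk.eta] at this
  rw [← this, pre_act (injective_bar_of_mem_GC hg) (map_bar_W_of_mem_GC hg)]
  exact ⟨v, bigr_le_pre _ _ hv, rfl⟩

/-- `D.bar g` carries `pre` to the new `pre`, whose only part in row `p` is the new `I^{p,q}`;
truncating to that row removes the rest. -/
theorem transport_mem {x : ℤ × ℤ} {v : E} (hv : v ∈ D.bigr F x.1 x.2) :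
    D.transport J F g v ∈ D.bigr (act g F) x.1 x.2 := by
  have hd := hF'.decomposes
  rw [transport_apply hg hJ hF hF' hv, hd.bigr_eq_bigrSet, hd.mem_bigrSet_iff]
  intro y hy
  have h1 := DFunLike.congr_fun (pr_mul_setProj hd (hJ _ hF') {y | y.1 = x.1} y) (D.bar g v)
  refine h1.trans ?_
  split_ifs with h
  · refine hd.mem_bigrSet_iff.1 (bar_apply_mem hg hJ hF hF' hv) y ?_
    rintro (h' | h')
    · exact hy h'
    · exact absurd h h'.1.ne
  · rfl

theorem transport_mul_pr (x : ℤ × ℤ) :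
    D.transport J F g * D.pr F x = D.pr (act g F) x * D.transport J F g := by
  refine hF.decomposes.ext fun y v hv => ?_
  change D.transport J F g (D.pr F x v) = D.pr (act g F) x (D.transport J F g v)
  have hm := transport_mem hg hJ hF hF' hv
  by_cases hxy : y = x
  · subst hxy
    rw [hF.decomposes.pr_of_mem hv, hF'.decomposes.pr_of_mem hm]
  · rw [hF.decomposes.pr_of_mem_ne hxy hv, hF'.decomposes.pr_of_mem_ne hxy hm, map_zero]

/-- If the truncation of `bar g u` to row `p` vanishes, then `bar g u` lies in lower rows. These are
the image under `bar g` of the old lower rows, so `u`, lying in row `p`, is zero. -/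
theorem isUnit_transport : IsUnit (D.transport J F g) := by
  refine isUnit_of_injective fun v hv => ?_
  refine eq_of_pr_eq hF.decomposes (hJ _ hF) fun x => ?_
  rw [map_zero]
  have hd := hF'.decomposes
  have h1 : D.transport J F g (D.pr F x v) = 0 := by
    have := DFunLike.congr_fun (transport_mul_pr hg hJ hF hF' x) v
    refine this.trans ?_
    change D.pr (act g F) x (D.transport J F g v) = 0
    rw [hv, map_zero]
  have hu := hF.decomposes.pr_mem x v
  set u := D.pr F x v with hudef
  rw [transport_apply hg hJ hF hF' hu] at h1
  have h2 : D.bar g u ∈ D.bigrSet (act g F) {y | y.1 < x.1} := by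
    rw [hd.mem_bigrSet_iff]
    intro y hy
    by_cases h : y.1 = x.1
    · have h3 := DFunLike.congr_fun (pr_mul_setProj hd (hJ _ hF') {y | y.1 = x.1} y) (D.bar g u)
      rw [if_pos (show y ∈ {y : ℤ × ℤ | y.1 = x.1} from h)] at h3
      refine h3.symm.trans ?_
      change D.pr (act g F) y (D.setProj J (act g F) {y | y.1 = x.1} (D.bar g u)) = 0
      rw [h1, map_zero]
    · refine hd.mem_bigrSet_iff.1 (bar_apply_mem hg hJ hF hF' hu) y ?_
      rintro (h' | h')
      · exact h (by rw [h'])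
      · exact hy h'.1
  rw [map_bar_bigrSet hg hF hF'] at h2
  obtain ⟨w, hw, hwu⟩ := h2
  have hwu' : w = u := injective_bar_of_mem_GC hg hwu
  rw [hwu'] at hw
  have h4 := hF.decomposes.mem_bigrSet_iff.1 hw x
    (show x ∉ {y : ℤ × ℤ | y.1 < x.1} from lt_irrefl x.1)
  rwa [hF.decomposes.pr_of_mem hu] at h4

theorem pr_act_eq (x : ℤ × ℤ) : D.pr (act g F) x =
    D.transport J F g * D.pr F x * Ring.inverse (D.transport J F g) := by
  rw [transport_mul_pr hg hJ hF hF', mul_assoc,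
    Ring.mul_inverse_cancel _ (isUnit_transport hg hJ hF hF'), mul_one]

end GC

theorem continuous_inverse_comp {Z : Type*} [TopologicalSpace Z] {f : Z → E →L[ℂ] E}
    (hf : Continuous f) (hu : ∀ z, IsUnit (f z)) : Continuous fun z => Ring.inverse (f z) := by
  refine continuous_iff_continuousAt.2 fun z => ?_
  obtain ⟨u, hu⟩ := hu z
  have := NormedRing.inverse_continuousAt u
  rw [hu] at this
  exact ContinuousAt.comp (f := f) this hf.continuousAt

/-- The topology is final for the orbit maps, so continuity is tested on `g ↦ act g F`, where
projectors onto rows and then `transport` have explicit continuous formulas. -/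
theorem continuous_pr (x : ℤ × ℤ) : Continuous fun F : D.ClassifyingSpace => D.pr F.fil x := by
  obtain ⟨J, hJ⟩ := D.exists_index_finset
  refine continuous_iSup_dom.2 fun F => continuous_coinduced_dom.2 ?_
  have hF := F.prop
  let Z := {g : E →L[ℂ] E // g ∈ D.GC ∧ D.IsGradedPolarizedMHS (act g F.fil)}
  change Continuous fun g : Z => D.pr (act g.1 F.fil) x
  have hP : ∀ p, Continuous fun g : Z => D.setProj J (act g.1 F.fil) {x | p ≤ x.1} := fun p => by
    have h : ∀ g : Z, _ := fun g => setProj_act g.2.1 hJ hF g.2.2 p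
    simp_rw [fun g : Z => (h g).2]
    have hc : Continuous fun g : Z => (g.1 : E →L[ℂ] E) := continuous_subtype_val
    have hb : Continuous fun g : Z => D.bar g.1 := D.continuous_bar.comp hc
    exact (hc.mul continuous_const).mul (continuous_inverse_comp
      ((hc.mul continuous_const).add (hb.mul continuous_const)) fun g => (h g).1)
  have hR : Continuous fun g : Z => D.transport J F.fil g.1 := by
    refine continuous_finsetSum _ fun p _ => ?_
    simp_rw [setProj_row J (act _ F.fil)]
    exact (((hP p).sub (hP (p + 1))).mul
      (D.continuous_bar.comp continuous_subtype_val)).mul continuous_const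
  simp_rw [fun g : Z => pr_act_eq g.2.1 hJ hF g.2.2 x]
  exact (hR.mul continuous_const).mul
    (continuous_inverse_comp hR fun g => isUnit_transport g.2.1 hJ hF g.2.2)

end Datum

/-! ### The lower bound for `τ - 1` on compact sets off the split locus -/

open Filter Topology

/-- A continuous family of quadratic forms on a finite-dimensional space that is positive definite
at one point is uniformly comparable to the square of the norm near this point. -/
theorem eventually_quadratic_bounds {X E : Type*} [TopologicalSpace X] [NormedAddCommGroup E]
    [NormedSpace ℂ E] [FiniteDimensional ℂ E] {Q : X → E → ℝ}
    (hQ : Continuous fun z : X × E => Q z.1 z.2)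
    (hs : ∀ x (a : ℝ) u, Q x ((a : ℂ) • u) = a ^ 2 * Q x u) {x₀ : X}
    (hpos : ∀ u, u ≠ 0 → 0 < Q x₀ u) : ∃ a b : ℝ, 0 < a ∧ 0 < b ∧ ∀ᶠ x in 𝓝 x₀, ∀ u,
      a * ‖u‖ ^ 2 ≤ Q x u ∧ Q x u ≤ b * ‖u‖ ^ 2 := by
  have hS : IsCompact (Metric.sphere (0 : E) 1) := by
    have := FiniteDimensional.proper ℂ E
    exact isCompact_sphere _ _
  have hc : Continuous fun u => Q x₀ u := hQ.comp (continuous_const.prodMk continuous_id)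
  obtain ⟨a, ha, ha'⟩ := hS.exists_forall_le' hc.continuousOn (a := 0)
    fun u hu => hpos u (by rintro rfl; simp at hu)
  obtain ⟨b, hb⟩ := hS.bddAbove_image hc.continuousOn
  have hb0 : (0 : ℝ) < max b 0 + 1 := by positivity
  refine ⟨a / 2, max b 0 + 1, half_pos ha, hb0, ?_⟩
  have hev : ∀ᶠ x in 𝓝 x₀, ∀ u ∈ Metric.sphere (0 : E) 1,
      a / 2 < Q x u ∧ Q x u < max b 0 + 1 := by
    refine hS.eventually_forall_of_forall_eventually fun u hu => ?_
    have h1 : a ≤ Q x₀ u := ha' u hu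
    have h2 : Q x₀ u ≤ b := hb ⟨u, hu, rfl⟩
    have h3 : a / 2 < Q x₀ u := by linarith
    have h4 : Q x₀ u < max b 0 + 1 := by linarith [le_max_left b 0]
    have ht : Tendsto (fun z : X × E => Q z.1 z.2) (𝓝 (x₀, u)) (𝓝 (Q x₀ u)) := hQ.tendsto (x₀, u)
    exact (ht.eventually_const_lt h3).and (ht.eventually_lt_const h4)
  filter_upwards [hev] with x hx u
  by_cases hu : u = 0
  · have : Q x 0 = 0 := by simpa using hs x 0 0
    simp [hu, this]
  · have hn : (0 : ℝ) < ‖u‖ := norm_pos_iff.2 hu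
    have h := hx (((‖u‖⁻¹ : ℝ) : ℂ) • u) (by
      rw [mem_sphere_zero_iff_norm, norm_smul, Complex.norm_real, norm_inv, norm_norm,
        inv_mul_cancel₀ hn.ne'])
    rw [hs, inv_pow, inv_mul_eq_div, lt_div_iff₀ (by positivity),
      div_lt_iff₀ (by positivity)] at h
    exact ⟨h.1.le, h.2.le⟩

namespace Datum

variable {E : Type*} [NormedAddCommGroup E] [NormedSpace ℂ E] [FiniteDimensional ℂ E]

variable {D : Datum E} {F : ℤ → Submodule ℂ E}

/-- The quadratic form of the mixed Hodge metric, as a function of the projections. -/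
def hquad (D : Datum E) (J : Finset (ℤ × ℤ)) (π : ℤ × ℤ → E →L[ℂ] E) (u : E) : ℝ :=
  ∑ x ∈ J, (D.hform x (π x u) (π x u)).re

theorem continuous_hform (x : ℤ × ℤ) : Continuous fun z : E × E => D.hform x z.1 z.2 := by
  have h : Continuous fun z : E × E => (D.S (x.1 + x.2)).toContinuousBilinearMap z.1 z.2 :=
    ((D.S (x.1 + x.2)).toContinuousBilinearMap).continuous₂
  exact continuous_const.mul
    (h.comp (continuous_fst.prodMk (D.continuous_conj.comp continuous_snd)))

theorem continuous_hquad (J : Finset (ℤ × ℤ)) :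
    Continuous fun z : (ℤ × ℤ → E →L[ℂ] E) × E => D.hquad J z.1 z.2 := by
  refine continuous_finsetSum _ fun x _ => Complex.continuous_re.comp ?_
  have h : Continuous fun z : (ℤ × ℤ → E →L[ℂ] E) × E => z.1 x z.2 :=
    ((continuous_apply x).comp continuous_fst).clm_apply continuous_snd
  exact (D.continuous_hform x).comp (h.prodMk h)

theorem hquad_smul (J : Finset (ℤ × ℤ)) (π : ℤ × ℤ → E →L[ℂ] E) (a : ℝ) (u : E) :
    D.hquad J π ((a : ℂ) • u) = a ^ 2 * D.hquad J π u := by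
  rw [hquad, hquad, Finset.mul_sum]
  refine Finset.sum_congr rfl fun x _ => ?_
  rw [map_smul, hform_smul_left, hform_smul_right, Complex.conj_ofReal, ← mul_assoc,
    ← Complex.ofReal_mul, Complex.re_ofReal_mul, sq]

theorem hodgeForm_re_eq_hquad {J : Finset (ℤ × ℤ)} (hJ : ∀ x ∉ J, D.pr F x = 0) (u : E) :
    (D.hodgeForm 1 F u u).re = D.hquad J (D.pr F) u := by
  rw [hodgeForm_eq_sum hJ, Complex.re_sum]
  simp [hquad]

theorem hquad_pos (hF : D.IsGradedPolarizedMHS F) {J : Finset (ℤ × ℤ)}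
    (hJ : ∀ x ∉ J, D.pr F x = 0) {u : E} (hu : u ≠ 0) : 0 < D.hquad J (D.pr F) u := by
  have hnn : ∀ x ∈ J, 0 ≤ (D.hform x (D.pr F x u) (D.pr F x u)).re := fun x _ => by
    by_cases h : D.pr F x u = 0
    · rw [h]
      simp [hform]
    · exact (hF.hform_pos (hF.decomposes.pr_mem x u) h).le
  refine lt_of_le_of_ne (Finset.sum_nonneg hnn) fun h0 => hu ?_
  refine eq_of_pr_eq hF.decomposes hJ fun x => ?_
  rw [map_zero]
  by_cases hx : x ∈ J
  · by_contra h
    exact (hF.hform_pos (hF.decomposes.pr_mem x u) h).ne'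
      ((Finset.sum_eq_zero_iff_of_nonneg hnn).1 h0.symm x hx)
  · rw [hJ x hx]
    rfl

/-- The mixed Hodge metrics of structures with nearby bigradings are uniformly comparable to the
given norm. -/
theorem eventually_hquad_bounds (hF : D.IsGradedPolarizedMHS F) {J : Finset (ℤ × ℤ)}
    (hJ : ∀ x ∉ J, D.pr F x = 0) : ∃ a b : ℝ, 0 < a ∧ 0 < b ∧ ∀ᶠ π in 𝓝 (D.pr F), ∀ u,
      a * ‖u‖ ^ 2 ≤ D.hquad J π u ∧ D.hquad J π u ≤ b * ‖u‖ ^ 2 :=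
  eventually_quadratic_bounds (D.continuous_hquad J) (hquad_smul J) fun _ hu => hquad_pos hF hJ hu

theorem comp_eq_zero {J : Finset (ℤ × ℤ)} (hJ : ∀ x ∉ J, D.pr F x = 0) (X : E →L[ℂ] E) {d : ℤ × ℤ}
    (hd : d ∉ (J ×ˢ J).image fun z => z.1 - z.2) : D.comp F X d.1 d.2 = 0 := by
  refine finsum_eq_zero_of_forall_eq_zero fun x => ?_
  change D.pr F (x + d) * X * D.pr F x = 0
  by_cases h1 : x ∈ J
  · rw [hJ (x + d), zero_mul, zero_mul]
    intro h2
    exact hd (Finset.mem_image.2 ⟨(x + d, x), Finset.mk_mem_product h2 h1, add_sub_cancel_left x d⟩)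
  · rw [hJ x h1, mul_zero]

theorem Decomposes.comp_eq_zero_of_mem_LamN (hF : D.Decomposes F) {X : E →L[ℂ] E}
    (hX : X ∈ LamN (D.pr F) 2) {d : ℤ × ℤ} (hd : ¬ (d.1 < 0 ∧ d.2 < 0)) :
    D.comp F X d.1 d.2 = 0 := by
  rw [hF.comp_eq_mult]
  refine hF.isBigrading.ext fun x y => ?_
  rw [hF.isBigrading.mult_entry, mul_zero, zero_mul]
  split_ifs with h
  · rw [mem_LamN_two.1 hX, smul_zero]
    rintro ⟨h1, h2⟩
    have h3 : x.1 - y.1 = d.1 := congrArg Prod.fst h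
    have h4 : x.2 - y.2 = d.2 := congrArg Prod.snd h
    exact hd ⟨by omega, by omega⟩
  · exact zero_smul _ _

theorem Decomposes.sum_comp (hF : D.Decomposes F) {J : Finset (ℤ × ℤ)}
    (hJ : ∀ x ∉ J, D.pr F x = 0) (X : E →L[ℂ] E) :
    ∑ d ∈ (J ×ˢ J).image fun z => z.1 - z.2, D.comp F X d.1 d.2 = X := by
  have h := hF.isBigrading.finsum_mult (f := id) Function.injective_id (fun _ => 1) (fun _ => 1)
    (fun _ => rfl) (fun d hd => absurd ⟨d, rfl⟩ hd) X
  have h1 : mult (D.pr F) (fun _ => 1) X = X :=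
    (hF.isBigrading.mult_unique fun x y => (one_smul _ _).symm).symm
  rw [h1] at h
  rw [← h, ← finsum_eq_sum_of_support_subset]
  · refine finsum_congr fun d => ?_
    rw [one_smul, h, hF.comp_eq_mult]
    rfl
  · intro d hd
    by_contra h2
    exact hd (by rw [h]; exact comp_eq_zero hJ X h2)

/-- `τ - 1` is a sum of nonnegative terms with finite support, so it dominates each of them; then
the power is inverted. -/
theorem IsGradedPolarizedMHS.endNorm_comp_eps_le (hF : D.IsGradedPolarizedMHS F) {d : ℤ × ℤ}
    (hd : d.1 < 0 ∧ d.2 < 0) : D.endNorm 1 F (D.comp F (D.eps F) d.1 d.2) ≤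
      (D.tau F - 1) ^ (-2 / ((d.1 : ℝ) + (d.2 : ℝ)))⁻¹ := by
  obtain ⟨J, hJ⟩ := D.exists_index_finset
  have hpos : ∀ d : ℤ × ℤ, d.1 < 0 ∧ d.2 < 0 → 0 < -2 / ((d.1 : ℝ) + (d.2 : ℝ)) := fun d hd => by
    have h1 : (d.1 : ℝ) < 0 := by exact_mod_cast hd.1
    have h2 : (d.2 : ℝ) < 0 := by exact_mod_cast hd.2
    exact div_pos_of_neg_of_neg (by norm_num) (by linarith)
  have hle : D.endNorm 1 F (D.comp F (D.eps F) d.1 d.2) ^ (-2 / ((d.1 : ℝ) + (d.2 : ℝ))) ≤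
      D.tau F - 1 := by
    rw [tau_eq, add_sub_cancel_left]
    refine le_trans ?_ (single_le_finsum d ?_ fun x => finsum_nonneg fun _ =>
      Real.rpow_nonneg (endNorm_nonneg _ _ _) _)
    · rw [finsum_eq_if, if_pos hd]
    · refine ((J ×ˢ J).image fun z => z.1 - z.2).finite_toSet.subset fun x hx => ?_
      by_contra h
      refine hx ?_
      beta_reduce
      rw [finsum_eq_if]
      split_ifs with hx'
      · rw [comp_eq_zero (hJ F hF) _ h]
        obtain ⟨ι, _, _, b, y, hb⟩ := hF.exists_adapted
        rw [hb.endNorm_eq hF.decomposes one_pos]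
        simp [Real.zero_rpow (hpos x hx').ne']
      · rfl
  exact (Real.rpow_rpow_inv (endNorm_nonneg _ _ _) (hpos d hd).ne').symm.trans_le
    (Real.rpow_le_rpow (Real.rpow_nonneg (endNorm_nonneg _ _ _) _) hle
      (inv_nonneg.2 (hpos d hd).le))

theorem norm_le_endNorm (hF : D.IsGradedPolarizedMHS F) {J : Finset (ℤ × ℤ)}
    (hJ : ∀ x ∉ J, D.pr F x = 0) {a b : ℝ} (ha : 0 < a) (hb : 0 < b)
    (h : ∀ u, a * ‖u‖ ^ 2 ≤ D.hquad J (D.pr F) u ∧ D.hquad J (D.pr F) u ≤ b * ‖u‖ ^ 2)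
    (X : E →L[ℂ] E) : ‖X‖ ≤ Real.sqrt (b / a) * D.endNorm 1 F X := by
  obtain ⟨ι, _, _, β, y, hβ⟩ := hF.exists_adapted
  refine X.opNorm_le_bound (mul_nonneg (Real.sqrt_nonneg _) (endNorm_nonneg _ _ _)) fun u => ?_
  have h1 := hβ.hodgeForm_apply_le hF.decomposes X u
  rw [hodgeForm_re_eq_hquad hJ, hodgeForm_re_eq_hquad hJ] at h1
  have h2 : a * ‖X u‖ ^ 2 ≤ D.endNorm 1 F X ^ 2 * (b * ‖u‖ ^ 2) :=
    (h _).1.trans (h1.trans (mul_le_mul_of_nonneg_left (h u).2 (sq_nonneg _)))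
  refine abs_le_of_sq_le_sq' ?_ (mul_nonneg (mul_nonneg (Real.sqrt_nonneg _)
    (endNorm_nonneg _ _ _)) (norm_nonneg _)) |>.2
  rw [mul_pow, mul_pow, Real.sq_sqrt (by positivity), div_mul_eq_mul_div, div_mul_eq_mul_div,
    le_div_iff₀ ha]
  linarith

/-- The element `ε` tends to zero where `τ` tends to one and the bigradings converge. -/
theorem tendsto_eps {l : Filter D.ClassifyingSpace} {F : D.ClassifyingSpace}
    (hpr : Tendsto (fun G : D.ClassifyingSpace => D.pr G.fil) l (𝓝 (D.pr F.fil)))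
    (hτ : Tendsto (fun G : D.ClassifyingSpace => D.tau G.fil) l (𝓝 1)) :
    Tendsto (fun G : D.ClassifyingSpace => D.eps G.fil) l (𝓝 0) := by
  obtain ⟨J, hJ⟩ := D.exists_index_finset
  obtain ⟨a, b, ha, hb, hab⟩ := eventually_hquad_bounds F.prop (hJ _ F.prop)
  have hcomp : ∀ d : ℤ × ℤ, Tendsto
      (fun G : D.ClassifyingSpace => D.comp G.fil (D.eps G.fil) d.1 d.2) l (𝓝 0) := fun d => by
    by_cases hd : d.1 < 0 ∧ d.2 < 0
    · have hpos : 0 < (-2 / ((d.1 : ℝ) + (d.2 : ℝ)))⁻¹ := by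
        have h1 : (d.1 : ℝ) < 0 := by exact_mod_cast hd.1
        have h2 : (d.2 : ℝ) < 0 := by exact_mod_cast hd.2
        exact inv_pos.2 (div_pos_of_neg_of_neg (by norm_num) (by linarith))
      have hlim : Tendsto (fun G : D.ClassifyingSpace =>
          Real.sqrt (b / a) * (D.tau G.fil - 1) ^ (-2 / ((d.1 : ℝ) + (d.2 : ℝ)))⁻¹) l (𝓝 0) := by
        have := ((hτ.sub_const 1).rpow_const (p := (-2 / ((d.1 : ℝ) + (d.2 : ℝ)))⁻¹)
          (Or.inr hpos.le)).const_mul (Real.sqrt (b / a))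
        rwa [sub_self, Real.zero_rpow hpos.ne', mul_zero] at this
      refine squeeze_zero_norm' ?_ hlim
      filter_upwards [hpr.eventually hab] with G hG
      exact (norm_le_endNorm G.prop (hJ _ G.prop) ha hb hG _).trans
        (mul_le_mul_of_nonneg_left (G.prop.endNorm_comp_eps_le hd) (Real.sqrt_nonneg _))
    · refine tendsto_const_nhds.congr fun G => ?_
      rw [G.prop.decomposes.comp_eq_zero_of_mem_LamN G.prop.eps_mem hd]
  have hsum := tendsto_finsetSum ((J ×ˢ J).image fun z => z.1 - z.2) fun d _ => hcomp d
  rw [Finset.sum_const_zero] at hsum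
  exact hsum.congr fun G => G.prop.decomposes.sum_comp (hJ _ G.prop) _

/-- On a compact set that does not meet the split locus, `τ` is bounded away from `1`. -/
theorem exists_lt_tau_sub_one {C : Set D.ClassifyingSpace} (hC : IsCompact C)
    (hsplit : Disjoint C D.splitLocus) : ∃ c : ℝ, 0 < c ∧ ∀ F ∈ C, c ≤ D.tau F.fil - 1 := by
  by_contra! hcon
  -- Continuity of `τ` is not needed: the filter itself imposes `τ → 1`, and compactness supplies a
  -- cluster point in `C`.
  let l : Filter D.ClassifyingSpace := comap (fun G => D.tau G.fil) (𝓝 1) ⊓ 𝓟 C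
  have hne : l.NeBot := by
    rw [Filter.inf_principal_neBot_iff]
    intro U hU
    obtain ⟨V, hV, hVU⟩ := hU
    obtain ⟨c, hc, hcV⟩ := Metric.mem_nhds_iff.1 hV
    obtain ⟨G, hG, hGc⟩ := hcon c hc
    refine ⟨G, hVU (hcV ?_), hG⟩
    rw [Metric.mem_ball, Real.dist_eq, abs_of_nonneg (sub_nonneg.2 (one_le_tau _))]
    exact hGc
  obtain ⟨F, hFC, hF⟩ := hC (f := l) inf_le_right
  have hne' : (𝓝 F ⊓ l).NeBot := hF
  have hpr : ∀ x, Tendsto (fun G : D.ClassifyingSpace => D.pr G.fil x) (𝓝 F ⊓ l)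
      (𝓝 (D.pr F.fil x)) := fun x => ((continuous_pr x).tendsto F).mono_left inf_le_left
  have hτ : Tendsto (fun G : D.ClassifyingSpace => D.tau G.fil) (𝓝 F ⊓ l) (𝓝 1) :=
    tendsto_comap.mono_left (inf_le_right.trans inf_le_left)
  have hε := tendsto_eps (tendsto_pi_nhds.2 hpr) hτ
  have he : Tendsto (fun G : D.ClassifyingSpace => NormedSpace.exp (D.eps G.fil)) (𝓝 F ⊓ l)
      (𝓝 1) := by
    have := (continuous_exp.tendsto (0 : E →L[ℂ] E)).comp hε
    rwa [NormedSpace.exp_zero] at this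
  have he' : Tendsto (fun G : D.ClassifyingSpace => NormedSpace.exp (-D.eps G.fil)) (𝓝 F ⊓ l)
      (𝓝 1) := by
    have := (continuous_exp.tendsto (-0 : E →L[ℂ] E)).comp hε.neg
    rwa [neg_zero, NormedSpace.exp_zero] at this
  refine Set.disjoint_left.1 hsplit hFC (F.prop.decomposes.isSplit_iff.2 fun x => ?_)
  have h1 := (D.continuous_bar.tendsto _).comp ((he'.mul (hpr x.swap)).mul he)
  have h2 := (he'.mul (hpr x)).mul he
  -- Limit of the splitting identity for `e^{-ε}.G` as `ε → 0`; what remains is the splitting of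
  -- `F`.
  have h3 := tendsto_nhds_unique h1 (h2.congr fun G => (G.prop.bar_exp_eps x).symm)
  change D.bar (D.pr F.fil x.swap) = _
  simpa using h3

end Datum

/-! ### Lengths of curves under a similitude -/

namespace Datum

open MeasureTheory

variable {E : Type*} [NormedAddCommGroup E] [NormedSpace ℂ E] [FiniteDimensional ℂ E]

variable {D : Datum E} {F : ℤ → Submodule ℂ E}

namespace IsSimilitude

variable {c : ℝ} {t t' : E →L[ℂ] E} (ht : D.IsSimilitude c t t')
include ht

theorem inv_apply_mem_W {k : ℤ} {v : E} : t' v ∈ D.W k ↔ v ∈ D.W k := by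
  rw [← ht.toIsRealAut.apply_mem_W]
  exact iff_of_eq (congrArg (· ∈ D.W k) (DFunLike.congr_fun ht.mul_inv v))

theorem conj_mem_GC {g : E →L[ℂ] E} (hg : g ∈ D.GC) : t * g * t' ∈ D.GC := by
  have hgW : ∀ {k : ℤ} {v : E}, v ∈ D.W k → g v ∈ D.W k := fun {k v} hv => by
    rw [← hg.2.1 k]
    exact ⟨v, hv, rfl⟩
  have hu : IsUnit t := ⟨⟨t, t', ht.mul_inv, ht.inv_mul⟩, rfl⟩
  have hu' : IsUnit t' := ⟨⟨t', t, ht.inv_mul, ht.mul_inv⟩, rfl⟩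
  refine ⟨(hu.mul hg.1).mul hu', fun k => ?_, fun w u hu v hv => ?_⟩
  · have h : (D.W k).map (t' : E →ₗ[ℂ] E) = D.W k := by
      refine le_antisymm (Submodule.map_le_iff_le_comap.2 fun v hv => ht.inv_apply_mem_W.2 hv)
        fun v hv => ⟨t v, ht.toIsRealAut.apply_mem_W.2 hv, DFunLike.congr_fun ht.inv_mul v⟩
    calc _ = (((D.W k).map (t' : E →ₗ[ℂ] E)).map (g : E →ₗ[ℂ] E)).map (t : E →ₗ[ℂ] E) := by
          rw [← Submodule.map_comp, ← Submodule.map_comp]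
          rfl
      _ = D.W k := by rw [h, hg.2.1, ht.map_W]
  · have hu' := ht.inv_apply_mem_W.2 hu
    have hv' := ht.inv_apply_mem_W.2 hv
    change D.S w (t (g (t' u))) (t (g (t' v))) = _
    rw [ht.scale w _ (hgW hu') _ (hgW hv'), hg.2.2 w _ hu' _ hv', ← ht.scale w _ hu' _ hv']
    exact congrArg₂ (fun a b => D.S w a b) (DFunLike.congr_fun ht.mul_inv u)
      (DFunLike.congr_fun ht.mul_inv v)

/-- The action of a similitude on the classifying space. -/
def actPoint (F : D.ClassifyingSpace) : D.ClassifyingSpace :=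
  ⟨act t F.fil, ht.isGradedPolarizedMHS_act F.prop⟩

theorem isLift_act {γ : ℝ → D.ClassifyingSpace} {g : ℝ → E →L[ℂ] E} (hg : D.IsLift γ g) :
    D.IsLift (fun s => ht.actPoint (γ s)) fun s => t * g s * t' := by
  refine ⟨(contDiffOn_const.mul hg.1).mul contDiffOn_const, fun s hs =>
    ⟨ht.conj_mem_GC (hg.2 s hs).1, ?_⟩⟩
  change act t (γ s).fil = act (t * g s * t') (act t (γ 0).fil)
  rw [ht.toIsRealAut.act_conj, (hg.2 s hs).2]

theorem velocity_conj {γ : ℝ → D.ClassifyingSpace} {g : ℝ → E →L[ℂ] E} (hg : D.IsLift γ g) {s : ℝ}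
    (hs : s ∈ Set.Icc (0 : ℝ) 1) :
    derivWithin (fun s => t * g s * t') (Set.Icc 0 1) s * Ring.inverse (t * g s * t') =
      t * (derivWithin g (Set.Icc 0 1) s * Ring.inverse (g s)) * t' := by
  have hd : DifferentiableWithinAt ℝ g (Set.Icc 0 1) s := hg.1.differentiableOn one_ne_zero s hs
  have hder : derivWithin (fun s => t * g s * t') (Set.Icc 0 1) s =
      t * derivWithin g (Set.Icc 0 1) s * t' := by
    rw [derivWithin_mul_const (hd.const_mul t), derivWithin_const_mul _ hd]
  have hinv : Ring.inverse (t * g s * t') = t * Ring.inverse (g s) * t' := by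
    have hu := (hg.2 s hs).1
    refine left_inv_eq_right_inv (Ring.inverse_mul_cancel _ (ht.conj_mem_GC hu).1) ?_
    calc _ = t * g s * (t' * t) * Ring.inverse (g s) * t' := by noncomm_ring
      _ = t * (g s * Ring.inverse (g s)) * t' := by rw [ht.inv_mul]; noncomm_ring
      _ = 1 := by rw [Ring.mul_inverse_cancel _ hu.1, mul_one, ht.mul_inv]
  rw [hder, hinv]
  calc _ = t * derivWithin g (Set.Icc 0 1) s * (t' * t) * Ring.inverse (g s) * t' := by noncomm_ring
    _ = _ := by rw [ht.inv_mul]; noncomm_ring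

theorem speed_act_le {M : ℕ} (hM : ∀ F, D.IsGradedPolarizedMHS F → ∀ x y : ℤ × ℤ,
      D.bigr F x.1 x.2 ≠ ⊥ → D.bigr F y.1 y.2 ≠ ⊥ → x.1 + x.2 - (y.1 + y.2) ≤ M)
    {κ : ℝ} (hκ : 1 ≤ κ) {γ : ℝ → D.ClassifyingSpace} {g : ℝ → E →L[ℂ] E} (hg : D.IsLift γ g)
    {s : ℝ} (hs : s ∈ Set.Icc (0 : ℝ) 1) (hτ : D.tau (γ s).fil ≤ κ * (D.tau (γ s).fil - 1)) :
    D.speed (fun s => ht.actPoint (γ s)) (fun s => t * g s * t') s ≤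
      ENNReal.ofReal (κ ^ M) * D.speed γ g s := by
  rw [speed, speed, ht.velocity_conj hg hs, ← ENNReal.ofReal_mul (by positivity)]
  refine ENNReal.ofReal_le_ofReal ?_
  have hF := (γ s).prop
  have h1 := one_le_tau (D := D) (γ s).fil
  have hc := ht.pos
  change D.twistedNorm (act t (γ s).fil) _ ≤ _
  rw [ht.twistedNorm_act hF]
  -- The parameters are `s = τ` and `s' = c + (τ - 1)`, with `τ ≤ κ (τ - 1) ≤ κ s'`.
  exact endNorm_qPart_le hF (hM _ hF) hκ (one_pos.trans_le h1) (by linarith)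
    (hτ.trans (mul_le_mul_of_nonneg_left (by linarith) (by linarith))) _

/-- A similitude increases the distance of the end points of a shortest geodesic along which `τ` is
bounded away from `1` at most by a constant factor. -/
theorem twistedDist_act_le {M : ℕ} (hM : ∀ F, D.IsGradedPolarizedMHS F → ∀ x y : ℤ × ℤ,
      D.bigr F x.1 x.2 ≠ ⊥ → D.bigr F y.1 y.2 ≠ ⊥ → x.1 + x.2 - (y.1 + y.2) ≤ M)
    {κ : ℝ} (hκ : 1 ≤ κ) {γ : ℝ → D.ClassifyingSpace} {P Q : D.ClassifyingSpace}
    (hγ : D.IsShortestGeodesic γ P Q)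
    (hτ : ∀ s ∈ Set.Icc (0 : ℝ) 1, D.tau (γ s).fil ≤ κ * (D.tau (γ s).fil - 1)) :
    D.twistedDist (ht.actPoint P) (ht.actPoint Q) ≤
      ENNReal.ofReal (κ ^ M) * D.twistedDist P Q := by
  obtain ⟨h0, h1, g, hg, hspeed⟩ := hγ
  -- The image curve need not be a geodesic; it is one competitor in the infimum. The original curve
  -- has constant speed equal to the distance, so the integral over `[0, 1]` is immediate.
  calc D.twistedDist (ht.actPoint P) (ht.actPoint Q)
      ≤ ∫⁻ s in Set.Icc (0 : ℝ) 1,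
          D.speed (fun s => ht.actPoint (γ s)) (fun s => t * g s * t') s :=
        iInf_le_of_le _ (iInf_le_of_le _ (iInf_le_of_le
          ⟨ht.isLift_act hg, by rw [← h0], by rw [← h1]⟩ le_rfl))
    _ ≤ ∫⁻ _ in Set.Icc (0 : ℝ) 1, ENNReal.ofReal (κ ^ M) * D.twistedDist P Q :=
        setLIntegral_mono' measurableSet_Icc fun s hs => by
          rw [← hspeed s hs]
          exact ht.speed_act_le hM hκ hg hs (hτ s hs)
    _ = ENNReal.ofReal (κ ^ M) * D.twistedDist P Q := by simp

end IsSimilitude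

end Datum

end MixedHodge

end

theorem mainTheorem9 {E : Type*} [NormedAddCommGroup E] [NormedSpace ℂ E]
    [FiniteDimensional ℂ E] (D : MixedHodge.Datum E)
    {r : ℕ} [NeZero r] (T : D.TwistDatum r)
    (C : Set D.ClassifyingSpace) (hC : IsCompact C) (hsplit : Disjoint C D.splitLocus) :
    ∃ K : ℝ≥0, ∀ y : Fin r → ℝ, (∀ j, 0 < y j) →
      ∀ F₁ F₂ G₁ G₂ : D.ClassifyingSpace,
        G₁.fil = MixedHodge.act (Ring.inverse (T.t y)) F₁.fil →
        G₂.fil = MixedHodge.act (Ring.inverse (T.t y)) F₂.fil →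
        (∃ U : Set D.ClassifyingSpace, D.GeodesicallyConvex U ∧ U ⊆ C ∧ G₁ ∈ U ∧ G₂ ∈ U) →
        D.twistedDist F₁ F₂ ≤ (K : ℝ≥0∞) * D.twistedDist G₁ G₂ := by
  obtain ⟨c, hc, hτ⟩ := MixedHodge.Datum.exists_lt_tau_sub_one hC hsplit
  obtain ⟨M, hM⟩ := D.exists_weight_bound
  -- With `κ = 1 + 1 / c`, the bound `τ - 1 ≥ c` on `C` gives `τ ≤ κ (τ - 1)`. Both `c` and `M` are
  -- independent of `y`.
  refine ⟨Real.toNNReal ((1 + 1 / c) ^ M), fun y hy F₁ F₂ G₁ G₂ h₁ h₂ hU => ?_⟩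
  obtain ⟨U, hconv, hUC, hG₁, hG₂⟩ := hU
  have ht := T.isSimilitude_t hy
  have hact : ∀ F G : D.ClassifyingSpace,
      G.fil = MixedHodge.act (Ring.inverse (T.t y)) F.fil → ht.actPoint G = F := fun F G h => by
    refine MixedHodge.Datum.ClassifyingSpace.ext ?_
    change MixedHodge.act (T.t y) G.fil = F.fil
    rw [h, ← MixedHodge.act_mul, ht.mul_inv, MixedHodge.act_one]
  obtain ⟨γ, hγ, hγU, -⟩ := hconv G₁ hG₁ G₂ hG₂
  rw [← hact F₁ G₁ h₁, ← hact F₂ G₂ h₂]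
  refine ht.twistedDist_act_le hM (le_add_of_nonneg_right (by positivity)) hγ fun s hs => ?_
  have h := hτ _ (hUC (hγU s hs))
  have h' : 1 ≤ 1 / c * (D.tau (γ s).fil - 1) := by
    rwa [one_div, inv_mul_eq_div, one_le_div hc]
  linarith
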